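/- **Setting.** All graphs are finite, simple and undirected; $n$ is the number of vertices. Fix $a\in\mathbb N$; a weighted graph $G=(V,E,w)$ has integer edge weights $w:E\to\{1,\dots,n^a\}$. A subgraph $H$ of $G$ has cost $w(H)=\sum_{e\in E(H)}w(e)$, and $\mathrm{hop}_H(u,v)$ is the least number of edges of a path from $u$ to $v$ in $H$ ($\infty$ if there is none). Given a hop bound $h\ge 1$ and a set $D\subseteq V\times V$ of demand pairs, a subgraph $H\subseteq G$ is feasible if $\mathrm{hop}_H(s,t)\le h$ for all $(s,t)\in D$, and $\mathrm{OPT}(D)$ is the least cost of a feasible subgraph. A solution of *$h$-hop-constrained oblivious Steiner forest* is a choice, made before $D$ is known, of a (not necessarily simple) path $P_{uv}$ of $G$ from $u$ to $v$ for every ordered pair $(u,v)$ of vertices that are connected in $G$ (hence for every pair if $G$ is complete or just connected). The solution induced by a demand set $D$ is the subgraph $H_D=\bigcup_{(s,t)\in D}P_{st}$. In *min-cost client-server $h$-spanner* a client graph $G_c=(V,E_c)$ and a weighted server graph $G_s=(V,E_s,w)$ on the same vertex set are given, a subgraph $H\subseteq G_s$ is feasible if $\mathrm{hop}_H(u,v)\le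 h$ for all $\{u,v\}\in E_c$, and $\mathrm{OPT}$ is the least cost of a feasible subgraph. Algorithms are randomized, use independent fair coin flips, and run in worst-case time polynomial in $n$ and the bit length of $h$ on a random access machine with logarithmic cost. **Theorem.** For all $a,c\in\mathbb N$ there are a polynomial-time randomized algorithm and a constant $C$ with the following property. For every $n\ge1$, every weighted graph $G$ with $n$ vertices and weights in $\{1,\dots,n^a\}$, and every $h\ge 1$, the algorithm always returns a path $P_{uv}$ of $G$ for every ordered pair $(u,v)$ of vertices connected in $G$, and with probability at least $1-n^{-c}$ the following holds simultaneously for all demand sets $D$ that have a feasible subgraph: $$w(H_D)\le C\log^3 n\cdot \mathrm{OPT}(D)\qquad\text{and}\qquad \mathrm{hop}_{H_D}(s,t)\le C\,h\log^3 n\ \text{ for all }(s,t)\in D .$$ **Corollary.** For all $a,c\in\mathbb N$ there are a polynomial-time randomized algorithm and a constant $C$ such that, for every $n\ge 1$, every $h\ge1$, every client graph $G_c$ and every weighted server graph $G_s$ on the same $n$ vertices with weights in $\{1,\dots,n^a\}$, the algorithm always returns a subgraph $H\subseteq G_s$, and, if a feasible subgraph exists, then with probability at least $1-n^{-c}$ $$w(H)\le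 C\log^3 n\cdot\mathrm{OPT}\qquad\text{and}\qquad \mathrm{hop}_H(u,v)\le C\,h\log^3 n\ \text{ for all }\{u,v\}\in E_c .$$ -/

import Mathlib

namespace HopSF

/-! ### Hop-constrained Steiner forest and client-server spanners

Vertex sets are `Fin n`.  A weighted graph is a simple graph `G` together with edge weights `w`
(only the values of `w` on edges of `G` are ever used).  A subgraph of `G` is identified with its
edge set, that is, with a simple graph `H ≤ G` on the same vertices.  The hop distance between two
vertices of `H` is Mathlib's `H.edist` (in `ℕ∞`, infinite if there is no path). -/

open Classical in
/-- The cost of `H`: the sum of the weights of its edges. -/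
noncomputable def cost {n : ℕ} (w : Sym2 (Fin n) → ℕ) (H : SimpleGraph (Fin n)) : ℕ :=
  ∑ e : Sym2 (Fin n) with e ∈ H.edgeSet, w e

/-- `H` is a feasible solution of offline `h`-hop-constrained Steiner forest on `G` with the
demand pairs `D`. -/
def IsFeasible {n : ℕ} (G : SimpleGraph (Fin n)) (h : ℕ) (D : Set (Fin n × Fin n))
    (H : SimpleGraph (Fin n)) : Prop :=
  H ≤ G ∧ ∀ p ∈ D, H.edist p.1 p.2 ≤ h

/-- The cost of an optimal offline `h`-hop-constrained Steiner forest for the demand pairs `D`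
(used only where there is a feasible solution). -/
noncomputable def opt {n : ℕ} (G : SimpleGraph (Fin n)) (w : Sym2 (Fin n) → ℕ) (h : ℕ)
    (D : Set (Fin n × Fin n)) : ℕ :=
  sInf {k | ∃ H, IsFeasible G h D H ∧ cost w H = k}

/-- A solution of the oblivious problem: a (not necessarily simple) path of `G` for every ordered
pair of vertices that some path of `G` connects (so for every pair, if `G` is connected). -/
def PathSystem {n : ℕ} (G : SimpleGraph (Fin n)) : Type :=
  ∀ u v : Fin n, G.Reachable u v → G.Walk u v

/-- The solution that the demand pairs `D` induce: the union of the paths of the pairs in `D`. -/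
def PathSystem.induced {n : ℕ} {G : SimpleGraph (Fin n)} (P : PathSystem G)
    (D : Set (Fin n × Fin n)) : SimpleGraph (Fin n) :=
  SimpleGraph.fromEdgeSet
    {e | ∃ p ∈ D, ∃ hp : G.Reachable p.1 p.2, e ∈ (P p.1 p.2 hp).edges}

/-- `H` is a feasible solution of client-server `h`-spanner with client graph `Gc` and server
graph `Gs`. -/
def IsHopSpanner {n : ℕ} (Gc Gs : SimpleGraph (Fin n)) (h : ℕ) (H : SimpleGraph (Fin n)) : Prop :=
  H ≤ Gs ∧ ∀ u v, Gc.Adj u v → H.edist u v ≤ h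

/-- The cost of an optimal client-server `h`-spanner (used only where there is a feasible one). -/
noncomputable def spannerOpt {n : ℕ} (Gc Gs : SimpleGraph (Fin n)) (w : Sym2 (Fin n) → ℕ)
    (h : ℕ) : ℕ :=
  sInf {k | ∃ H, IsHopSpanner Gc Gs h H ∧ cost w H = k}

/-! ### The machine model: a random access machine with logarithmic cost

A program is a fixed structured program over natural-number registers and arrays.  Every
evaluation of a subexpression costs one plus the bit length of its value, and every executed command
costs one more than the expressions it evaluates; so polynomial time is that of Turing machines.
A randomized program finds its random bits, a uniformly random 0/1 string, in an input array. -/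

/-- The memory: registers and arrays of natural numbers. -/
structure Store where
  reg : ℕ → ℕ
  arr : ℕ → ℕ → ℕ

/-- Binary operations on natural numbers. -/
inductive Op
  | add | sub | mul | div | mod | lt | eq

def Op.eval : Op → ℕ → ℕ → ℕ
  | .add, x, y => x + y
  | .sub, x, y => x - y
  | .mul, x, y => x * y
  | .div, x, y => x / y
  | .mod, x, y => x % y
  | .lt, x, y => if x < y then 1 else 0
  | .eq, x, y => if x = y then 1 else 0

/-- Expressions: numerals, register contents, array cells, binary operations. -/
inductive Expr
  | lit (k : ℕ)
  | reg (x : ℕ)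
  | arr (a : ℕ) (i : Expr)
  | bin (o : Op) (e f : Expr)

def Expr.eval (s : Store) : Expr → ℕ
  | .lit k => k
  | .reg x => s.reg x
  | .arr a i => s.arr a (i.eval s)
  | .bin o e f => o.eval (e.eval s) (f.eval s)

/-- The cost of evaluating an expression. -/
def Expr.time (s : Store) : Expr → ℕ
  | .lit k => 1 + Nat.size k
  | .reg x => 1 + Nat.size (s.reg x)
  | .arr a i => 1 + Nat.size (s.arr a (i.eval s)) + i.time s
  | .bin o e f => 1 + Nat.size (o.eval (e.eval s) (f.eval s)) + e.time s + f.time s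

/-- Programs. -/
inductive Prog
  | skip
  | assign (x : ℕ) (e : Expr)
  | store (a : ℕ) (i e : Expr)
  | seq (p q : Prog)
  | ite (b : Expr) (p q : Prog)
  | loop (b : Expr) (p : Prog)

def Store.setReg (s : Store) (x v : ℕ) : Store :=
  { s with reg := Function.update s.reg x v }

def Store.setArr (s : Store) (a i v : ℕ) : Store :=
  { s with arr := Function.update s.arr a (Function.update (s.arr a) i v) }

/-- `Exec p s s' t`: the program `p`, started in memory `s`, halts in memory `s'` after time `t`.
`ite b p q` runs `p` if `b` is not zero and `q` otherwise; `loop b p` repeats `p` while `b` is not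
zero. -/
inductive Exec : Prog → Store → Store → ℕ → Prop
  | skip (s) : Exec .skip s s 1
  | assign (x e s) : Exec (.assign x e) s (s.setReg x (e.eval s)) (1 + e.time s)
  | store (a i e s) :
      Exec (.store a i e) s (s.setArr a (i.eval s) (e.eval s)) (1 + i.time s + e.time s)
  | seq {p q s s' s'' t t'} (hp : Exec p s s' t) (hq : Exec q s' s'' t') :
      Exec (.seq p q) s s'' (t + t' + 1)
  | iteTrue {b p q s s' t} (hb : b.eval s ≠ 0) (hp : Exec p s s' t) :
      Exec (.ite b p q) s s' (1 + b.time s + t)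
  | iteFalse {b p q s s' t} (hb : b.eval s = 0) (hq : Exec q s s' t) :
      Exec (.ite b p q) s s' (1 + b.time s + t)
  | loopDone {b p s} (hb : b.eval s = 0) : Exec (.loop b p) s s (1 + b.time s)
  | loopStep {b p s s' s'' t t'} (hb : b.eval s ≠ 0) (hp : Exec p s s' t)
      (hl : Exec (.loop b p) s' s'' t') : Exec (.loop b p) s s'' (1 + b.time s + t + t')

/-! ### Inputs, outputs, running time and probability -/

open Classical in
/-- The `n × n` weight matrix of a weighted graph, stored row by row: cell `u * n + v` holds the
weight of the edge `uv`, or `0` if this is not an edge. -/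
noncomputable def weightMatrix {n : ℕ} (G : SimpleGraph (Fin n)) (w : Sym2 (Fin n) → ℕ) (i : ℕ) :
    ℕ :=
  if hi : i < n * n then
    let u : Fin n := ⟨i / n, Nat.div_lt_of_lt_mul hi⟩
    let v : Fin n := ⟨i % n, Nat.mod_lt i (Nat.pos_of_lt_mul_left hi)⟩
    if G.Adj u v then w s(u, v) else 0
  else 0

/-- The cells of the random string `r`. -/
def randomBits {m : ℕ} (r : Fin m → Bool) (i : ℕ) : ℕ :=
  if h : i < m then (r ⟨i, h⟩).toNat else 0

/-- The initial memory for the instance `(G, w, h)`: register `0` holds `n`, register `1` holds `h`,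
array `0` holds the weight matrix and array `1` the random bits; everything else is `0`. -/
noncomputable def forestInput {n m : ℕ} (G : SimpleGraph (Fin n)) (w : Sym2 (Fin n) → ℕ) (h : ℕ)
    (r : Fin m → Bool) : Store where
  reg x := if x = 0 then n else if x = 1 then h else 0
  arr a := if a = 0 then weightMatrix G w else if a = 1 then randomBits r else 0

/-- The initial memory for the spanner instance `(Gc, Gs, w, h)`: as before for `(Gs, w, h)`, and
array `2` holds the adjacency matrix of the client graph. -/
noncomputable def spannerInput {n m : ℕ} (Gc Gs : SimpleGraph (Fin n)) (w : Sym2 (Fin n) → ℕ)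
    (h : ℕ) (r : Fin m → Bool) : Store where
  reg x := if x = 0 then n else if x = 1 then h else 0
  arr a := if a = 0 then weightMatrix Gs w else if a = 1 then randomBits r else
    if a = 2 then weightMatrix Gc (fun _ => 1) else 0

/-- The memory `s` holds the path system `P`: for every connected pair `(u, v)`, cell `u * n + v`
of array `3` is the number of hops of its path, and the vertices of the path stand in consecutive
cells of array `5`, the first one in the cell whose index is in cell `u * n + v` of array `4`. -/
def HoldsPaths {n : ℕ} {G : SimpleGraph (Fin n)} (s : Store) (P : PathSystem G) : Prop :=
  ∀ (u v : Fin n) (huv : G.Reachable u v),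
    s.arr 3 (u * n + v) = (P u v huv).length ∧
    ∀ i ≤ (P u v huv).length,
      s.arr 5 (s.arr 4 (u * n + v) + i) = ((P u v huv).getVert i : ℕ)

/-- Array `3` of the memory `s` holds the adjacency matrix of `H`. -/
def HoldsGraph {n : ℕ} (s : Store) (H : SimpleGraph (Fin n)) : Prop :=
  ∀ u v : Fin n, (H.Adj u v → s.arr 3 (u * n + v) = 1) ∧ (¬ H.Adj u v → s.arr 3 (u * n + v) = 0)

/-- Started in memory `s`, the program `p` halts within time `T`, in a memory that satisfies `Q`. -/
def HaltsWithin (p : Prog) (s : Store) (T : ℕ) (Q : Store → Prop) : Prop :=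
  ∃ s' t, Exec p s s' t ∧ t ≤ T ∧ Q s'

/-- The polynomial time bound with parameter `K`, in the number `n` of vertices and the bit length
of the hop bound `h`. -/
def timeBound (K n h : ℕ) : ℕ :=
  K * (n + Nat.size h) ^ K

/-- The probability of an event under `m` independent fair coin flips. -/
noncomputable def coinProb {m : ℕ} (E : Set (Fin m → Bool)) : ℝ :=
  (E.ncard : ℝ) / 2 ^ m

end HopSF

open HopSF

/-! Weights and hops are merged into one length: at level `i` an edge `e` has length `h * w e + 2 ^
i`, so a walk of length at most `ρ * 2 ^ i * h` has weight at most `ρ * 2 ^ i` and at most `ρ * h`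
hops. A hierarchy has one partition for each of `L = O(log n)` levels. Clusters of level `i` have
diameter at most `ρ * 2 ^ i * h`, and the ball of radius `4 * 2 ^ i * h` around an unmarked vertex
stays in its cluster. The common refinements of the levels `j, …, L` are nested, and discrete for `j
= 0`. A pair is routed through the representatives of its classes: upwards from `s` until the
classes of `s` and `t` agree, then down to `t`. The ends of a demand that are unmarked at all levels
share the top class (`IsHierarchy.rep_top_eq`), so the route has at most `2 * L + 1` legs of at most
`ρ * h` hops each.

Cost. A class of level `j` that some route leaves costs `O(ρ * 2 ^ j)`, once for all demands
together. A feasible `H` contains a path with at most `h` edges from an unmarked vertex out of this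
class, hence out of a cluster of some level `i ≥ j`. Either an edge of this path has weight at least
`2 ^ i`, or beyond its last unmarked vertex the path must cover so much distance that its edges at
marked vertices weigh at least `2 ^ i` (`IsHierarchy.exists_charge`). So the darts of `H` that start
in the class pay `2 ^ i`. Classes of one level `j` are disjoint and `∑ j ≤ i, 2 ^ j ≤ 2 * 2 ^ i`, so
the whole cost is `O(ρ)` times the total payment (`IsHierarchy.sum_card_le`). Over all levels a dart
pays at most its weight times two plus the number of marks of its tail (`sum_dartCharge_le`).

Marks are rare. Region growing stops a ball when the mass of the next shell is at most `1 / q` of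
the mass of the ball, where `q = 8 * L`; cutting in the middle of the shell and marking the shell
gives a partition whose marked vertices have at most `1 / q` of the total mass (`RegionInv.step`).
Doubling the masses of marked vertices multiplies the total by at most `1 + 1 / q`. With `l` the bit
length of `n`, there are `4 * l` hierarchies, and the total stays below `2 ^ (2 * l)`
(`potential_lt`). Hence every vertex receives fewer than `2 * l` marks altogether: each pair has a
hierarchy that marks neither end, and the marks average to a constant per hierarchy
(`cost_le_of_hierarchies`).

A ball that does not stop gains the factor `1 + 1 / q` in mass, so its radius grows at most `2 * l *
q` times and `ρ = O(log² n)`. With `O(log n)` hierarchies the cost factor is `O(log³ n)`, and `O(log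
n)` legs give the same factor for hops.

The rest verifies this algorithm as a loop program. Its loops have `k * n` rounds and each of its
products has a short factor, so its time is polynomial. -/

namespace HopSF

/-! The program is deterministic. It forms hierarchies of partitions by region growing; the masses of
the vertices, doubled whenever a vertex falls near a boundary, take the place of random radii. So the
guarantee holds with probability one. -/

/-! ### Loop programs and their polynomial running time -/

/-- Functions bounded by a polynomial on the positive integers. -/
def PolyBounded (f : ℕ → ℕ) : Prop := ∃ K, ∀ B, 1 ≤ B → f B ≤ K * B ^ K

theorem PolyBounded.const (c : ℕ) : PolyBounded fun _ => c :=
  ⟨c, fun _ hB => Nat.le_mul_of_pos_right _ (Nat.pow_pos hB)⟩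

theorem PolyBounded.id : PolyBounded fun B => B := ⟨1, fun B _ => by simp⟩

theorem PolyBounded.add {f g : ℕ → ℕ} (hf : PolyBounded f) (hg : PolyBounded g) :
    PolyBounded fun B => f B + g B := by
  obtain ⟨K, hK⟩ := hf
  obtain ⟨M, hM⟩ := hg
  refine ⟨K + M, fun B hB => (Nat.add_le_add (hK B hB) (hM B hB)).trans ?_⟩
  rw [add_mul]
  exact Nat.add_le_add (Nat.mul_le_mul_left _ (Nat.pow_le_pow_right hB (by omega)))
    (Nat.mul_le_mul_left _ (Nat.pow_le_pow_right hB (by omega)))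

theorem PolyBounded.mul {f g : ℕ → ℕ} (hf : PolyBounded f) (hg : PolyBounded g) :
    PolyBounded fun B => f B * g B := by
  obtain ⟨K, hK⟩ := hf
  obtain ⟨M, hM⟩ := hg
  refine ⟨K + M + K * M, fun B hB => (Nat.mul_le_mul (hK B hB) (hM B hB)).trans ?_⟩
  calc K * B ^ K * (M * B ^ M) = K * M * B ^ (K + M) := by ring
    _ ≤ (K + M + K * M) * B ^ (K + M + K * M) :=
      Nat.mul_le_mul (by omega) (Nat.pow_le_pow_right hB (by omega))

/-- Every number in the memory has at most `b` bits. -/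
def Store.Bits (s : Store) (b : ℕ) : Prop :=
  (∀ x, Nat.size (s.reg x) ≤ b) ∧ ∀ a i, Nat.size (s.arr a i) ≤ b

theorem Store.Bits.mono {s : Store} {b c : ℕ} (hs : s.Bits b) (h : b ≤ c) : s.Bits c :=
  ⟨fun x => (hs.1 x).trans h, fun a i => (hs.2 a i).trans h⟩

theorem Store.Bits.setReg {s : Store} {b x v : ℕ} (hs : s.Bits b) (hv : Nat.size v ≤ b) :
    (s.setReg x v).Bits b := by
  refine ⟨fun y => ?_, hs.2⟩
  by_cases h : y = x
  · subst h; simpa [Store.setReg] using hv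
  · simpa [Store.setReg, h] using hs.1 y

theorem Store.Bits.setArr {s : Store} {b a i v : ℕ} (hs : s.Bits b) (hv : Nat.size v ≤ b) :
    (s.setArr a i v).Bits b := by
  refine ⟨hs.1, fun y j => ?_⟩
  by_cases h : y = a
  · subst h
    by_cases hj : j = i
    · subst hj; simpa [Store.setArr] using hv
    · simpa [Store.setArr, hj] using hs.2 y j
  · simpa [Store.setArr, h] using hs.2 y j

theorem size_le_self (m : ℕ) : Nat.size m ≤ m := Nat.size_le.2 Nat.lt_two_pow_self

theorem size_add_le (x y : ℕ) : Nat.size (x + y) ≤ max (Nat.size x) (Nat.size y) + 1 := by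
  rw [Nat.size_le, pow_succ]
  have hx := (Nat.size_le (m := x)).1 (le_max_left (Nat.size x) (Nat.size y))
  have hy := (Nat.size_le (m := y)).1 (le_max_right (Nat.size x) (Nat.size y))
  omega

theorem size_mul_le (x y : ℕ) : Nat.size (x * y) ≤ Nat.size x + Nat.size y := by
  rw [Nat.size_le, pow_add]
  exact Nat.mul_lt_mul'' (Nat.lt_size_self x) (Nat.lt_size_self y)

/-- Expressions by which a product may be formed: their values have few bits whatever the memory
holds outside registers `0` and `1`. -/
def Expr.small : Expr → Bool
  | .lit _ => true
  | .reg x => decide (x ≤ 1)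
  | .bin .lt _ _ => true
  | .bin .eq _ _ => true
  | _ => false

/-- Expressions whose values are longer than the numbers in the memory by few bits only. -/
def Expr.safe : Expr → Bool
  | .lit _ => true
  | .reg _ => true
  | .arr _ i => i.safe
  | .bin .mul e f => e.safe && f.safe && f.small
  | .bin _ e f => e.safe && f.safe

theorem Expr.small_size {f : Expr} (hf : f.small = true) : ∃ c, ∀ (s : Store) (B : ℕ),
    s.reg 0 ≤ B → Nat.size (s.reg 1) ≤ B → 1 ≤ B → Nat.size (f.eval s) ≤ c * B := by
  have hb : ∀ (p : Prop) [Decidable p], Nat.size (if p then 1 else 0) ≤ 1 := by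
    intro p _; split <;> simp
  match f, hf with
  | .lit k, _ => exact ⟨Nat.size k, fun s B _ _ hB => Nat.le_mul_of_pos_right _ hB⟩
  | .reg x, h =>
    refine ⟨1, fun s B h0 h1 _ => ?_⟩
    have hx : x ≤ 1 := by simpa [Expr.small] using h
    interval_cases x
    · simpa [Expr.eval] using (size_le_self _).trans h0
    · simpa [Expr.eval] using h1
  | .bin .lt e g, _ => exact ⟨1, fun s B _ _ hB => (hb _).trans (by simpa using hB)⟩
  | .bin .eq e g, _ => exact ⟨1, fun s B _ _ hB => (hb _).trans (by simpa using hB)⟩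

/-- Products are admitted only with a short factor, so every operation lengthens numbers by an
additive term that does not depend on the memory. Growth by a constant factor in bit length would be
exponential under iteration. -/
theorem Expr.size_time {e : Expr} (he : e.safe = true) : ∃ c, ∀ (s : Store) (b B : ℕ),
    s.Bits b → s.reg 0 ≤ B → Nat.size (s.reg 1) ≤ B → 1 ≤ B →
    Nat.size (e.eval s) ≤ b + c * B ∧ e.time s ≤ c * (b + B) := by
  induction e with
  | lit k =>
    refine ⟨1 + Nat.size k, fun s b B _ _ _ hB => ⟨?_, ?_⟩⟩
    · have := Nat.le_mul_of_pos_right (1 + Nat.size k) hB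
      simp only [Expr.eval]; omega
    · exact Nat.le_mul_of_pos_right _ (by omega)
  | reg x =>
    refine ⟨1, fun s b B hs _ _ hB => ⟨?_, ?_⟩⟩
    · exact (hs.1 x).trans (Nat.le_add_right _ _)
    · have := hs.1 x
      simp only [Expr.time]; omega
  | arr a i ih =>
    obtain ⟨c, hc⟩ := ih (by simpa [Expr.safe] using he)
    refine ⟨c + 1, fun s b B hs h0 h1 hB => ⟨?_, ?_⟩⟩
    · exact (hs.2 a _).trans (Nat.le_add_right _ _)
    · have h2 := hs.2 a (i.eval s)
      have h3 := (hc s b B hs h0 h1 hB).2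
      simp only [Expr.time]
      rw [add_mul, one_mul]; omega
  | bin o e f ihe ihf =>
    have hs' : e.safe = true ∧ f.safe = true := by
      cases o <;> simp_all [Expr.safe]
    obtain ⟨c, hc⟩ := ihe hs'.1
    obtain ⟨d, hd⟩ := ihf hs'.2
    suffices H : ∃ k, ∀ (s : Store) (b B : ℕ),
        s.Bits b → s.reg 0 ≤ B → Nat.size (s.reg 1) ≤ B → 1 ≤ B →
        Nat.size (o.eval (e.eval s) (f.eval s)) ≤ b + k * B by
      obtain ⟨k, hk⟩ := H
      refine ⟨k + c + d + 1, fun s b B hs h0 h1 hB => ⟨?_, ?_⟩⟩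
      · refine (hk s b B hs h0 h1 hB).trans ?_
        gcongr; omega
      · have h1' := hk s b B hs h0 h1 hB
        have h2 := (hc s b B hs h0 h1 hB).2
        have h3 := (hd s b B hs h0 h1 hB).2
        have h4 : k * B ≤ k * (b + B) := by gcongr; omega
        simp only [Expr.time]
        calc _ ≤ 1 + (b + k * (b + B)) + c * (b + B) + d * (b + B) := by omega
          _ ≤ _ := by ring_nf; omega
    cases o with
    | add =>
      refine ⟨c + d + 1, fun s b B hs h0 h1 hB => ?_⟩
      have h2 := (hc s b B hs h0 h1 hB).1
      have h3 := (hd s b B hs h0 h1 hB).1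
      refine (size_add_le _ _).trans ?_
      rw [add_mul, add_mul, one_mul]; omega
    | sub =>
      exact ⟨c, fun s b B hs h0 h1 hB =>
        (Nat.size_le_size (Nat.sub_le _ _)).trans (hc s b B hs h0 h1 hB).1⟩
    | mul =>
      obtain ⟨k, hk⟩ := Expr.small_size (f := f) (by simp_all [Expr.safe])
      refine ⟨c + k, fun s b B hs h0 h1 hB => (size_mul_le _ _).trans ?_⟩
      have h2 := (hc s b B hs h0 h1 hB).1
      have h3 := hk s B h0 h1 hB
      rw [add_mul]; omega
    | div =>
      exact ⟨c, fun s b B hs h0 h1 hB =>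
        (Nat.size_le_size (Nat.div_le_self _ _)).trans (hc s b B hs h0 h1 hB).1⟩
    | mod =>
      exact ⟨c, fun s b B hs h0 h1 hB =>
        (Nat.size_le_size (Nat.mod_le _ _)).trans (hc s b B hs h0 h1 hB).1⟩
    | lt =>
      refine ⟨1, fun s b B hs h0 h1 hB => ?_⟩
      have : Nat.size (Op.eval .lt (e.eval s) (f.eval s)) ≤ 1 := by
        simp only [Op.eval]; split <;> simp
      omega
    | eq =>
      refine ⟨1, fun s b B hs h0 h1 hB => ?_⟩
      have : Nat.size (Op.eval .eq (e.eval s) (f.eval s)) ≤ 1 := by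
        simp only [Op.eval]; split <;> simp
      omega

/-- Loop programs: `rep x k p` runs `p` for `x = 0, …, k * n - 1`, where `n` is the content of
register `0`. -/
inductive Cmd
  | skip
  | set (x : ℕ) (e : Expr)
  | put (a : ℕ) (i e : Expr)
  | seq (p q : Cmd)
  | ite (b : Expr) (p q : Cmd)
  | rep (x k : ℕ) (p : Cmd)

/-- The memory after `m` rounds of a loop with counter `x` and body `f`. -/
def Store.iter (x : ℕ) (f : Store → Store) (s : Store) : ℕ → Store
  | 0 => s
  | m + 1 => f ((Store.iter x f s m).setReg x m)

/-- The effect of a loop program on the memory. -/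
def Cmd.run : Cmd → Store → Store
  | .skip, s => s
  | .set x e, s => s.setReg x (e.eval s)
  | .put a i e, s => s.setArr a (i.eval s) (e.eval s)
  | .seq p q, s => q.run (p.run s)
  | .ite b p q, s => if b.eval s ≠ 0 then p.run s else q.run s
  | .rep x k p, s => (Store.iter x p.run s (k * s.reg 0)).setReg x (k * s.reg 0)

/-- The registers that a loop program writes. -/
def Cmd.regs : Cmd → List ℕ
  | .skip => []
  | .set x _ => [x]
  | .put _ _ _ => []
  | .seq p q => p.regs ++ q.regs
  | .ite _ p q => p.regs ++ q.regs
  | .rep x _ p => x :: p.regs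

/-- The arrays that a loop program writes. -/
def Cmd.arrs : Cmd → List ℕ
  | .skip => []
  | .set _ _ => []
  | .put a _ _ => [a]
  | .seq p q => p.arrs ++ q.arrs
  | .ite _ p q => p.arrs ++ q.arrs
  | .rep _ _ p => p.arrs

/-- Translation to the language of the machine. -/
def Cmd.toProg : Cmd → Prog
  | .skip => .skip
  | .set x e => .assign x e
  | .put a i e => .store a i e
  | .seq p q => .seq p.toProg q.toProg
  | .ite b p q => .ite b p.toProg q.toProg
  | .rep x k p => .seq (.assign x (.lit 0))
      (.loop (.bin .lt (.reg x) (.bin .mul (.lit k) (.reg 0)))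
        (.seq p.toProg (.assign x (.bin .add (.reg x) (.lit 1)))))

/-- Loop programs that run in polynomial time. -/
def Cmd.Safe : Cmd → Prop
  | .skip => True
  | .set x e => 2 ≤ x ∧ e.safe = true
  | .put _ i e => i.safe = true ∧ e.safe = true
  | .seq p q => p.Safe ∧ q.Safe
  | .ite b p q => b.safe = true ∧ p.Safe ∧ q.Safe
  | .rep x _ p => 2 ≤ x ∧ x ∉ p.regs ∧ p.Safe

/-- Two memories agree outside the registers `X` and the arrays `A`. -/
def Store.AgreeOff (X A : List ℕ) (s s' : Store) : Prop :=
  (∀ x, x ∉ X → s'.reg x = s.reg x) ∧ ∀ a, a ∉ A → s'.arr a = s.arr a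

/-- The frame rule: what a program does not write survives it. Later correctness proofs transport
facts by computing the lists `regs` and `arrs`. -/
theorem Cmd.run_agreeOff (p : Cmd) (s : Store) : s.AgreeOff p.regs p.arrs (p.run s) := by
  induction p generalizing s with
  | skip => exact ⟨fun _ _ => rfl, fun _ _ => rfl⟩
  | set x e =>
    exact ⟨fun y hy => Function.update_of_ne (by simpa [Cmd.regs] using hy) _ _, fun _ _ => rfl⟩
  | put a i e =>
    exact ⟨fun _ _ => rfl, fun y hy => Function.update_of_ne (by simpa [Cmd.arrs] using hy) _ _⟩
  | seq p q ihp ihq =>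
    simp only [Cmd.regs, Cmd.arrs, Store.AgreeOff, List.mem_append, not_or, Cmd.run]
    exact ⟨fun x hx => ((ihq _).1 x hx.2).trans ((ihp _).1 x hx.1),
      fun x hx => ((ihq _).2 x hx.2).trans ((ihp _).2 x hx.1)⟩
  | ite b p q ihp ihq =>
    simp only [Cmd.regs, Cmd.arrs, Store.AgreeOff, List.mem_append, not_or, Cmd.run]
    split
    · exact ⟨fun x hx => (ihp _).1 x hx.1, fun x hx => (ihp _).2 x hx.1⟩
    · exact ⟨fun x hx => (ihq _).1 x hx.2, fun x hx => (ihq _).2 x hx.2⟩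
  | rep x k p ih =>
    have key : ∀ m, s.AgreeOff (x :: p.regs) p.arrs (Store.iter x p.run s m) := by
      intro m
      induction m with
      | zero => exact ⟨fun _ _ => rfl, fun _ _ => rfl⟩
      | succ m ihm =>
        refine ⟨fun y hy => ?_, fun a ha => ((ih _).2 a ha).trans (ihm.2 a ha)⟩
        have h := (ih ((Store.iter x p.run s m).setReg x m)).1 y (fun h => hy (by simp [h]))
        refine h.trans ?_
        rw [← ihm.1 y hy]
        exact Function.update_of_ne (fun h => hy (by simp [h])) _ _
    refine ⟨fun y hy => ?_, fun a ha => (key _).2 a ha⟩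
    rw [← (key (k * s.reg 0)).1 y hy]
    exact Function.update_of_ne (fun h => hy (by simp [Cmd.regs, h])) _ _

theorem Store.iter_agreeOff (p : Cmd) (x : ℕ) (s : Store) (m : ℕ) :
    s.AgreeOff (x :: p.regs) p.arrs (Store.iter x p.run s m) := by
  induction m with
  | zero => exact ⟨fun _ _ => rfl, fun _ _ => rfl⟩
  | succ m ihm =>
    refine ⟨fun y hy => ?_, fun a ha => ((p.run_agreeOff _).2 a ha).trans (ihm.2 a ha)⟩
    have h := (p.run_agreeOff ((Store.iter x p.run s m).setReg x m)).1 y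
      (fun h => hy (by simp [h]))
    refine h.trans ?_
    rw [← ihm.1 y hy]
    exact Function.update_of_ne (fun h => hy (by simp [h])) _ _

theorem Cmd.Safe.two_le {p : Cmd} (hp : p.Safe) : ∀ x ∈ p.regs, 2 ≤ x := by
  induction p with
  | skip => simp [Cmd.regs]
  | set x e => simpa [Cmd.regs] using hp.1
  | put a i e => simp [Cmd.regs]
  | seq p q ihp ihq =>
    simp only [Cmd.regs, List.mem_append]
    rintro x (h | h)
    exacts [ihp hp.1 x h, ihq hp.2 x h]
  | ite b p q ihp ihq =>
    simp only [Cmd.regs, List.mem_append]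
    rintro x (h | h)
    exacts [ihp hp.2.1 x h, ihq hp.2.2 x h]
  | rep x k p ih =>
    simp only [Cmd.regs, List.mem_cons]
    rintro y (rfl | h)
    exacts [hp.1, ih hp.2.2 y h]

theorem Store.setReg_reg_same (s : Store) (x u : ℕ) : (s.setReg x u).reg x = u := by
  simp [Store.setReg]

theorem Store.setReg_reg_ne (s : Store) {x y : ℕ} (u : ℕ) (h : y ≠ x) :
    (s.setReg x u).reg y = s.reg y := by
  simp [Store.setReg, h]

/-- Loop programs halt in polynomial time and their numbers stay short. -/
theorem Cmd.exec (p : Cmd) (hp : p.Safe) : ∃ f, PolyBounded f ∧ ∀ (s : Store) (b B : ℕ),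
    s.Bits b → s.reg 0 ≤ B → Nat.size (s.reg 1) ≤ B → 1 ≤ B →
    ∃ t, Exec p.toProg s (p.run s) t ∧ t ≤ f B * (b + 1) ∧ (p.run s).Bits (b + f B) := by
  induction p with
  | skip =>
    exact ⟨_, .const 1, fun s b B hs _ _ hB => ⟨1, .skip s, by simp, hs.mono (by simp)⟩⟩
  | set x e =>
    obtain ⟨c, hc⟩ := Expr.size_time hp.2
    refine ⟨fun B => 1 + c * B, (PolyBounded.const 1).add ((PolyBounded.const c).mul .id),
      fun s b B hs h0 h1 hB => ⟨_, .assign x e s, ?_, ?_⟩⟩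
    · have := (hc s b B hs h0 h1 hB).2
      have h2 : c * (b + B) ≤ c * B * (b + 1) := by
        rw [mul_assoc]; gcongr; nlinarith
      ring_nf at *; omega
    · have := (hc s b B hs h0 h1 hB).1
      exact (hs.mono (by omega)).setReg (by simp only; omega)
  | put a i e =>
    obtain ⟨c, hc⟩ := Expr.size_time hp.1
    obtain ⟨d, hd⟩ := Expr.size_time hp.2
    refine ⟨fun B => 1 + (c + d) * B, (PolyBounded.const 1).add ((PolyBounded.const _).mul .id),
      fun s b B hs h0 h1 hB => ⟨_, .store a i e s, ?_, ?_⟩⟩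
    · have := (hc s b B hs h0 h1 hB).2
      have := (hd s b B hs h0 h1 hB).2
      have h2 : (c + d) * (b + B) ≤ (c + d) * B * (b + 1) := by
        rw [mul_assoc]; gcongr; nlinarith
      ring_nf at *; omega
    · have := (hd s b B hs h0 h1 hB).1
      exact (hs.mono (by omega)).setArr (by simp only [add_mul]; omega)
  | seq p q ihp ihq =>
    obtain ⟨f, hf, Hf⟩ := ihp hp.1
    obtain ⟨g, hg, Hg⟩ := ihq hp.2
    -- The second program starts with numbers of `b + f B` bits, so it takes time `g B * (b + f B +
    -- 1)`, at most `g B * (f B + 1) * (b + 1)`.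
    refine ⟨fun B => f B + g B * (f B + 1) + 1,
      (hf.add (hg.mul (hf.add (.const 1)))).add (.const 1), fun s b B hs h0 h1 hB => ?_⟩
    obtain ⟨t, ht, htle, hb⟩ := Hf s b B hs h0 h1 hB
    have hr := p.run_agreeOff s
    have e0 := hr.1 0 (fun h => by have := hp.1.two_le 0 h; omega)
    have e1 := hr.1 1 (fun h => by have := hp.1.two_le 1 h; omega)
    obtain ⟨t', ht', htle', hb'⟩ := Hg (p.run s) _ B hb (e0 ▸ h0) (e1 ▸ h1) hB
    refine ⟨_, .seq ht ht', ?_, hb'.mono ?_⟩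
    · have : g B * (b + f B + 1) ≤ g B * (f B + 1) * (b + 1) := by
        rw [mul_assoc]; gcongr; nlinarith
      calc t + t' + 1 ≤ f B * (b + 1) + g B * (f B + 1) * (b + 1) + (b + 1) := by omega
        _ = _ := by ring
    · have : g B ≤ g B * (f B + 1) := Nat.le_mul_of_pos_right _ (by omega)
      simp only; omega
  | ite e p q ihp ihq =>
    obtain ⟨c, hc⟩ := Expr.size_time hp.1
    obtain ⟨f, hf, Hf⟩ := ihp hp.2.1
    obtain ⟨g, hg, Hg⟩ := ihq hp.2.2
    refine ⟨fun B => 1 + c * B + f B + g B,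
      (((PolyBounded.const 1).add ((PolyBounded.const c).mul .id)).add hf).add hg,
      fun s b B hs h0 h1 hB => ?_⟩
    have h3 := (hc s b B hs h0 h1 hB).2
    have h2 : c * (b + B) ≤ c * B * (b + 1) := by
      rw [mul_assoc]; gcongr; nlinarith
    obtain ⟨t, ht, htle, hb⟩ := Hf s b B hs h0 h1 hB
    obtain ⟨t', ht', htle', hb'⟩ := Hg s b B hs h0 h1 hB
    simp only [Cmd.run]
    by_cases he : e.eval s = 0
    · refine ⟨_, .iteFalse he (by simpa [he] using ht'), ?_, ?_⟩
      · simp only [add_mul] at *; omega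
      · simpa [he] using hb'.mono (by omega)
    · refine ⟨_, .iteTrue he (by simpa [he] using ht), ?_, ?_⟩
      · simp only [add_mul] at *; omega
      · simpa [he] using hb.mono (by omega)
  | rep x k p ih =>
    obtain ⟨f, hf, Hf⟩ := ih hp.2.2
    obtain ⟨c, hc⟩ := Expr.size_time
      (e := .bin .lt (.reg x) (.bin .mul (.lit k) (.reg 0))) (by simp [Expr.safe, Expr.small])
    obtain ⟨d, hd⟩ := Expr.size_time
      (e := .bin .add (.reg x) (.lit 1)) (by simp [Expr.safe])
    -- Bits gained in the loop: at most `k * B` rounds, each with `f B` for the body and `k * B` for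
    -- writing the counter; the last term is for the counter of the current round.
    let g : ℕ → ℕ := fun B => k * B * (f B + k * B) + k * B
    have hkB : PolyBounded fun B => k * B := (PolyBounded.const k).mul .id
    have hg : PolyBounded g := (hkB.mul (hf.add hkB)).add hkB
    let G : ℕ → ℕ := fun B => g B + f B + 1
    have hG : PolyBounded G := (hg.add hf).add (.const 1)
    refine ⟨fun B => (k * B + 1) * ((3 + c + f B + d) * (G B + B + 1)) + 4 + G B,
      (((hkB.add (.const 1)).mul ((((PolyBounded.const (3 + c)).add hf).add (.const d)).mul
        ((hG.add .id).add (.const 1)))).add (.const 4)).add hG,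
      fun s b B hs h0 h1 hB => ?_⟩
    have hx0 : (0 : ℕ) ≠ x := by have := hp.1; omega
    have hx1 : (1 : ℕ) ≠ x := by have := hp.1; omega
    set N := k * s.reg 0 with hN
    have hNle : N ≤ k * B := by rw [hN]; gcongr
    have h0p : (0 : ℕ) ∉ x :: p.regs := by
      intro h; have := (show (Cmd.rep x k p).Safe from hp).two_le 0 h; omega
    have h1p : (1 : ℕ) ∉ x :: p.regs := by
      intro h; have := (show (Cmd.rep x k p).Safe from hp).two_le 1 h; omega
    let S : ℕ → Store := fun m => Store.iter x p.run s m
    have hS0 : ∀ m, (S m).reg 0 = s.reg 0 := fun m => (Store.iter_agreeOff p x s m).1 0 h0p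
    have hS1 : ∀ m, (S m).reg 1 = s.reg 1 := fun m => (Store.iter_agreeOff p x s m).1 1 h1p
    have hstep : ∀ m, m ≤ N → ∀ b', (S m).Bits b' → ((S m).setReg x m).Bits (b' + k * B) :=
      fun m hm b' hb' => (hb'.mono (by omega)).setReg ((size_le_self m).trans (by omega))
    have hbits : ∀ m, m ≤ N → (S m).Bits (b + m * (f B + k * B)) := by
      intro m
      induction m with
      | zero => intro _; exact hs.mono (by omega)
      | succ m ihm =>
        intro hm
        obtain ⟨t, -, -, hb⟩ := Hf ((S m).setReg x m) _ B (hstep m (by omega) _ (ihm (by omega)))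
          (by rw [Store.setReg_reg_ne _ _ hx0, hS0]; exact h0)
          (by rw [Store.setReg_reg_ne _ _ hx1, hS1]; exact h1) hB
        exact hb.mono (by rw [add_mul]; omega)
    have hbits' : ∀ m, m ≤ N → ((S m).setReg x m).Bits (b + g B) := fun m hm => by
      refine (hstep m hm _ (hbits m hm)).mono ?_
      have : m * (f B + k * B) ≤ k * B * (f B + k * B) := by gcongr; omega
      simp only [g]; omega
    have hreg0 : ∀ m, ((S m).setReg x m).reg 0 ≤ B := fun m => by
      rw [Store.setReg_reg_ne _ _ hx0, hS0]; exact h0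
    have hreg1 : ∀ m, Nat.size (((S m).setReg x m).reg 1) ≤ B := fun m => by
      rw [Store.setReg_reg_ne _ _ hx1, hS1]; exact h1
    have hcond : ∀ m, (Expr.bin .lt (.reg x) (.bin .mul (.lit k) (.reg 0))).eval
        ((S m).setReg x m) = if m < N then 1 else 0 := by
      intro m
      have e0 : ((S m).setReg x m).reg 0 = s.reg 0 := by rw [Store.setReg_reg_ne _ _ hx0, hS0]
      simp [Expr.eval, Op.eval, Store.setReg_reg_same, e0, hN]
    -- Induction on the number `j` of rounds that remain, as `Exec` unfolds a loop from its first
    -- round.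
    have hloop : ∀ j m, m + j = N → ∃ t, Exec (.loop (.bin .lt (.reg x) (.bin .mul (.lit k)
        (.reg 0))) (.seq p.toProg (.assign x (.bin .add (.reg x) (.lit 1)))))
        ((S m).setReg x m) ((S N).setReg x N) t ∧
        t ≤ (j + 1) * (3 + c * (b + G B + B) + f B * (b + G B + B) + d * (b + G B + B)) := by
      intro j
      induction j with
      | zero =>
        intro m hm
        obtain rfl : N = m := by omega
        refine ⟨_, .loopDone (by rw [hcond]; simp), ?_⟩
        have := (hc _ _ B (hbits' N le_rfl) (hreg0 N) (hreg1 N) hB).2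
        have h5 : c * (b + g B + B) ≤ c * (b + G B + B) := by gcongr; simp [G]; omega
        omega
      | succ j ihj =>
        intro m hm
        obtain ⟨t, ht, htle⟩ := ihj (m + 1) (by omega)
        obtain ⟨t', ht', htle', hb'⟩ := Hf _ _ B (hbits' m (by omega)) (hreg0 m) (hreg1 m) hB
        have hSm : p.run ((S m).setReg x m) = S (m + 1) := rfl
        rw [hSm] at ht' hb'
        have hSx : (S (m + 1)).reg x = m := by
          rw [← hSm, (p.run_agreeOff _).1 x hp.2.1, Store.setReg_reg_same]
        have hasg : Exec (.assign x (.bin .add (.reg x) (.lit 1))) (S (m + 1))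
            ((S (m + 1)).setReg x (m + 1))
            (1 + (Expr.bin .add (.reg x) (.lit 1)).time (S (m + 1))) := by
          have := Exec.assign x (.bin .add (.reg x) (.lit 1)) (S (m + 1))
          simpa only [Expr.eval, Op.eval, hSx] using this
        refine ⟨_, .loopStep (by rw [hcond]; simp; omega) (.seq ht' hasg) ht, ?_⟩
        have e1 := (hc _ _ B (hbits' m (by omega)) (hreg0 m) (hreg1 m) hB).2
        have e2 := (hd (S (m + 1)) _ B hb' (by rw [hS0]; exact h0) (by rw [hS1]; exact h1) hB).2
        have h5 : c * (b + g B + B) ≤ c * (b + G B + B) := by gcongr; simp [G]; omega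
        have h6 : d * (b + g B + f B + B) ≤ d * (b + G B + B) :=
          Nat.mul_le_mul_left _ (by simp only [G]; omega)
        have h7 : f B * (b + g B + 1) ≤ f B * (b + G B + B) := by gcongr; simp [G]; omega
        rw [add_mul (j + 1) 1, one_mul]
        omega
    obtain ⟨t, ht, htle⟩ := hloop N 0 (by omega)
    have hasg : Exec (.assign x (.lit 0)) s ((S 0).setReg x 0) 2 := by
      have := Exec.assign x (.lit 0) s
      simpa [Expr.eval, Expr.time, S, Store.iter] using this
    refine ⟨_, .seq hasg ht, ?_, ?_⟩
    · have e1 : b + G B + B ≤ (G B + B + 1) * (b + 1) := by nlinarith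
      have e2 : 3 ≤ 3 * ((G B + B + 1) * (b + 1)) := Nat.le_mul_of_pos_right _ (by positivity)
      have e3 : t ≤ (k * B + 1) * ((3 + c + f B + d) * (G B + B + 1)) * (b + 1) := by
        calc t ≤ (k * B + 1) * (3 * ((G B + B + 1) * (b + 1)) + c * ((G B + B + 1) * (b + 1)) +
              f B * ((G B + B + 1) * (b + 1)) + d * ((G B + B + 1) * (b + 1))) := by
              refine htle.trans ?_; gcongr
          _ = _ := by ring
      have e4 : (k * B + 1) * ((3 + c + f B + d) * (G B + B + 1)) * (b + 1) + 4 * (b + 1) ≤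
          ((k * B + 1) * ((3 + c + f B + d) * (G B + B + 1)) + 4 + G B) * (b + 1) := by
        rw [← add_mul]; exact Nat.mul_le_mul_right _ (by omega)
      simp only
      omega
    · refine (hbits' N le_rfl).mono ?_
      simp only [G]; omega

/-! ### Walks, lengths and distances -/

variable {n : ℕ}

/-- A sequence of consecutively adjacent vertices is a walk. -/
theorem exists_walk_of_seq {G : SimpleGraph (Fin n)} (g : ℕ → Fin n) (m : ℕ)
    (hg : ∀ k < m, G.Adj (g k) (g (k + 1))) :
    ∃ p : G.Walk (g 0) (g m), p.length = m ∧ (∀ k ≤ m, p.getVert k = g k) ∧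
      p.edges = (List.range m).map fun k => s(g k, g (k + 1)) := by
  induction m with
  | zero => exact ⟨.nil, rfl, fun k hk => by simp [Nat.le_zero.1 hk], rfl⟩
  | succ m ih =>
    obtain ⟨p, hl, hv, he⟩ := ih fun k hk => hg k (by omega)
    refine ⟨p.concat (hg m (by omega)), by simp [hl], fun k hk => ?_, ?_⟩
    · rw [SimpleGraph.Walk.concat_eq_append, SimpleGraph.Walk.getVert_append, hl]
      split_ifs with h
      · exact hv k h.le
      · obtain h | rfl : k = m ∨ k = m + 1 := by omega
        · subst h; simp
        · simp
    · rw [SimpleGraph.Walk.edges_concat, he, List.range_succ]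
      simp

/-- The length of an edge at level `i`: weights and hops are traded at the rate `2 ^ i` to `h`. -/
def levelLength (w : Sym2 (Fin n) → ℕ) (h i : ℕ) (e : Sym2 (Fin n)) : ℕ := h * w e + 2 ^ i

/-- `d` holds the distances of `G` for the edge lengths `f`, increased by one, and zero for pairs
that are not connected. -/
def IsDist (G : SimpleGraph (Fin n)) (f : Sym2 (Fin n) → ℕ) (d : ℕ → ℕ → ℕ) : Prop :=
  ∀ u v : Fin n, (d u v ≠ 0 → ∃ p : G.Walk u v, (p.edges.map f).sum + 1 = d u v) ∧
    ∀ p : G.Walk u v, d u v ≠ 0 ∧ d u v ≤ (p.edges.map f).sum + 1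

section IsDist

variable {G : SimpleGraph (Fin n)} {f : Sym2 (Fin n) → ℕ} {d : ℕ → ℕ → ℕ}

theorem IsDist.reachable (hd : IsDist G f d) {u v : Fin n} : G.Reachable u v ↔ d u v ≠ 0 :=
  ⟨fun ⟨p⟩ => ((hd u v).2 p).1, fun h => ⟨((hd u v).1 h).choose⟩⟩

theorem IsDist.self (hd : IsDist G f d) (u : Fin n) : d u u = 1 := by
  have h := (hd u u).2 .nil
  simp at h
  omega

theorem IsDist.symm (hd : IsDist G f d) (u v : Fin n) : d u v = d v u := by
  have key : ∀ u v : Fin n, d u v ≠ 0 → d v u ≠ 0 ∧ d v u ≤ d u v := by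
    intro u v h
    obtain ⟨p, hp⟩ := (hd u v).1 h
    have := (hd v u).2 p.reverse
    rw [SimpleGraph.Walk.edges_reverse, List.map_reverse, List.sum_reverse, hp] at this
    exact this
  by_cases h : d u v = 0
  · by_contra h'
    exact (key v u (by omega)).1 h
  · have h1 := key u v h
    have h2 := key v u h1.1
    omega

theorem IsDist.triangle (hd : IsDist G f d) {u v x : Fin n} (h1 : d u v ≠ 0) (h2 : d v x ≠ 0) :
    d u x ≠ 0 ∧ d u x + 1 ≤ d u v + d v x := by
  obtain ⟨p, hp⟩ := (hd u v).1 h1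
  obtain ⟨q, hq⟩ := (hd v x).1 h2
  have := (hd u x).2 (p.append q)
  rw [SimpleGraph.Walk.edges_append, List.map_append, List.sum_append] at this
  omega

/-- The first edge of an optimal walk: a shorter remainder would shorten the whole walk. -/
theorem IsDist.exists_next (hd : IsDist G f d) {u v : Fin n} (h : d u v ≠ 0) (huv : u ≠ v) :
    ∃ x, G.Adj u x ∧ d u v = d x v + f s(u, x) := by
  obtain ⟨p, hp⟩ := (hd u v).1 h
  cases p with
  | nil => exact absurd rfl huv
  | @cons _ x _ hux q =>
    refine ⟨x, hux, ?_⟩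
    have h1 := (hd x v).2 q
    obtain ⟨r, hr⟩ := (hd x v).1 h1.1
    have h2 := (hd u v).2 (.cons hux r)
    simp only [SimpleGraph.Walk.edges_cons, List.map_cons, List.sum_cons] at hp h2
    omega

theorem IsDist.le_seq (hd : IsDist G f d) (g : ℕ → Fin n) (m : ℕ)
    (hg : ∀ k < m, G.Adj (g k) (g (k + 1))) :
    d (g 0) (g m) ≠ 0 ∧ d (g 0) (g m) ≤ ∑ k ∈ Finset.range m, f s(g k, g (k + 1)) + 1 := by
  obtain ⟨p, -, -, he⟩ := exists_walk_of_seq g m hg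
  have := (hd _ _).2 p
  rw [he, List.map_map] at this
  exact this

end IsDist

/-! ### Charging the cost of a cluster to a feasible subgraph -/

/-- What the dart from `x` to `y` pays at level `i` if `unp i` marks the vertices near the boundary
of their cluster. -/
def dartCharge (w : Sym2 (Fin n) → ℕ) (unp : ℕ → ℕ → ℕ) (i : ℕ) (x y : Fin n) : ℕ :=
  if 2 ^ i ≤ w s(x, y) then 2 ^ i else if unp i x ≠ 0 then w s(x, y) else 0

/-- The data of one hierarchy: at every level a partition `X i` and marks `unp i`, where the
clusters have diameter at most `ρ` units and unmarked vertices are padded. -/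
structure IsHierarchy (G : SimpleGraph (Fin n)) (h L ρ : ℕ) (D : ℕ → ℕ → ℕ → ℕ)
    (X unp rep : ℕ → ℕ → ℕ) : Prop where
  diam : ∀ i, 1 ≤ i → i ≤ L → ∀ u v : Fin n, X i u = X i v →
    D i u v ≠ 0 ∧ D i u v ≤ ρ * (2 ^ i * h) + 1
  padded : ∀ i, 1 ≤ i → i ≤ L → ∀ u v : Fin n, unp i u = 0 → D i u v ≠ 0 →
    D i u v ≤ 4 * (2 ^ i * h) + 1 → X i u = X i v
  rep_zero : ∀ u : Fin n, rep 0 u = u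
  rep_lt : ∀ j ≤ L, ∀ u : Fin n, rep j u < n
  rep_eq : ∀ j ≤ L, ∀ u v : Fin n, rep j u = rep j v ↔ ∀ i, j ≤ i → i ≤ L → X i u = X i v
  rep_mem : ∀ i ≤ L, ∀ u : Fin n, ∀ j ≤ i, X i (rep j u) = X i u

section Charge

variable {G H : SimpleGraph (Fin n)} {w : Sym2 (Fin n) → ℕ} {h L ρ : ℕ} {D : ℕ → ℕ → ℕ → ℕ}
  {X unp rep : ℕ → ℕ → ℕ}

open Classical in
/-- A cluster that a short path of `H` leaves is paid for by the darts of `H` that start in it. -/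
theorem IsHierarchy.exists_charge (hX : IsHierarchy G h L ρ D X unp rep)
    (hD : ∀ i, 1 ≤ i → i ≤ L → IsDist G (levelLength w h i) (D i)) (hHG : H ≤ G)
    (hw : ∀ e ∈ G.edgeSet, 1 ≤ w e) {s t : Fin n} (p : H.Walk s t) (hp : p.IsPath)
    (hph : p.length ≤ h) (hs : ∀ i, 1 ≤ i → i ≤ L → unp i s = 0) {j : ℕ} (hj : j ≤ L)
    (hst : rep j s ≠ rep j t) :
    ∃ i, j ≤ i ∧ i ≤ L ∧
      2 ^ i ≤ ∑ x ∈ Finset.univ.filter (fun x : Fin n => rep j x = rep j s), ∑ y with H.Adj x y, dartCharge w unp i x y := by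
  let g := p.getVert
  have hg0 : g 0 = s := p.getVert_zero
  have hgl : g p.length = t := p.getVert_length
  have hadj : ∀ k < p.length, H.Adj (g k) (g (k + 1)) := fun k hk => p.adj_getVert_succ hk
  have hex : ∃ k, rep j (g k) ≠ rep j s := ⟨p.length, by rw [hgl]; exact hst.symm⟩
  -- `b` is the first position outside the class of `s`; all darts before it start inside.
  obtain ⟨b, hb, hmin⟩ : ∃ b, rep j (g b) ≠ rep j s ∧ ∀ k < b, rep j (g k) = rep j s :=
    ⟨Nat.find hex, Nat.find_spec hex, fun k hk => not_not.1 (Nat.find_min hex hk)⟩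
  have hbl : b ≤ p.length := by
    by_contra hlt
    exact hst.symm (by rw [← hgl]; exact hmin _ (by omega))
  have hb0 : b ≠ 0 := by rintro rfl; exact hb (by rw [hg0])
  -- Leaving the common refinement means leaving the cluster of one of its levels.
  obtain ⟨i, hji, hiL, hi⟩ : ∃ i, j ≤ i ∧ i ≤ L ∧ X i (g b) ≠ X i s := by
    by_contra hcon
    push Not at hcon
    exact hb ((hX.rep_eq j hj _ _).2 hcon)
  refine ⟨i, hji, hiL, ?_⟩
  have hinj : ∀ k < b, ∀ k' < b, g k = g k' → k = k' := fun k hk k' hk' he =>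
    hp.getVert_injOn (by simp; omega) (by simp; omega) he
  -- On a path distinct positions have distinct darts, so the charges of any set of positions before
  -- `b` may be added up.
  have hsum : ∀ I : Finset ℕ, (∀ k ∈ I, k < b) →
      ∑ k ∈ I, dartCharge w unp i (g k) (g (k + 1)) ≤
        ∑ x ∈ Finset.univ.filter (fun x : Fin n => rep j x = rep j s), ∑ y with H.Adj x y, dartCharge w unp i x y := by
    intro I hI
    rw [Finset.sum_sigma']
    refine (Finset.sum_le_sum_of_subset
      (s := I.image fun k => (⟨g k, g (k + 1)⟩ : (_ : Fin n) × Fin n)) ?_).trans' ?_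
    · intro d hd
      obtain ⟨k, hk, rfl⟩ := Finset.mem_image.1 hd
      simp only [Finset.mem_sigma, Finset.mem_filter, Finset.mem_univ, true_and]
      exact ⟨hmin k (hI k hk), hadj k (by have := hI k hk; omega)⟩
    · rw [Finset.sum_image]
      intro k hk k' hk' he
      simp only [Sigma.mk.injEq] at he
      exact hinj k (hI k hk) k' (hI k' hk') he.1
  -- A single edge of weight at least `2 ^ i` pays alone.
  by_cases hheavy : ∃ k < b, 2 ^ i ≤ w s(g k, g (k + 1))
  · obtain ⟨k, hk, hki⟩ := hheavy
    refine le_trans ?_ (hsum {k} (by simpa using hk))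
    simp [dartCharge, hki]
  push Not at hheavy
  -- Weights are positive, so at level `0` every edge would be heavy.
  have hi1 : 1 ≤ i := by
    by_contra h0
    obtain rfl : i = 0 := by omega
    have h1 := hheavy 0 (by omega)
    have h2 := hw s(g 0, g (0 + 1)) (hHG (hadj 0 (by omega)))
    simp at h1 h2
    omega
  have hP : unp i (g 0) = 0 := by rw [hg0]; exact hs i hi1 hiL
  -- `a` is the last unmarked position before `b`, and exists because `s` is unmarked. The darts
  -- strictly between `a` and `b` start at marked vertices and therefore pay their weights.
  obtain ⟨a, hab, ha, hmax⟩ : ∃ a < b, unp i (g a) = 0 ∧ ∀ k, a < k → k < b → unp i (g k) ≠ 0 := by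
    have hbd : ∃ m, ∀ k < b, unp i (g k) = 0 → k ≤ m := ⟨b, fun k hk _ => hk.le⟩
    let a := Nat.findGreatest (fun k => k < b ∧ unp i (g k) = 0) b
    have h1 : a < b ∧ unp i (g a) = 0 :=
      Nat.findGreatest_spec (P := fun k => k < b ∧ unp i (g k) = 0) (m := 0) (by omega)
        ⟨by omega, hP⟩
    exact ⟨a, h1.1, h1.2, fun k hk hkb h2 =>
      Nat.findGreatest_is_greatest (P := fun k => k < b ∧ unp i (g k) = 0) hk hkb.le ⟨hkb, h2⟩⟩
  have hXa : X i (g a) = X i s :=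
    (hX.rep_eq j hj _ _).1 (hmin a hab) i hji hiL
  have hle := (hD i hi1 hiL).le_seq (fun k => g (a + k)) (b - a)
    fun k hk => hHG (hadj (a + k) (by omega))
  simp only [add_zero, show a + (b - a) = b by omega] at hle
  have hfar : 4 * (2 ^ i * h) + 1 < D i (g a) (g b) := by
    by_contra hcon
    have := hX.padded i hi1 hiL _ _ ha hle.1 (by omega)
    exact hi (this ▸ hXa)
  -- Of a length above `4 * (2 ^ i * h)`, the hops account for at most `2 ^ i * h`, since there are
  -- at most `h` of them, and the weight of the light edge leaving `a` for another `2 ^ i * h`. The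
  -- edges strictly between carry the rest, more than is needed.
  have hsplit : ∑ k ∈ Finset.range (b - a), levelLength w h i s(g (a + k), g (a + k + 1)) ≤
      2 ^ i * h + (2 ^ i * h + h * ∑ k ∈ Finset.Ioo a b, w s(g k, g (k + 1))) := by
    have hba : b - a = (b - a - 1) + 1 := by omega
    simp only [levelLength, Finset.sum_add_distrib, Finset.sum_const, Finset.card_range,
      smul_eq_mul]
    rw [add_comm]
    refine Nat.add_le_add ?_ ?_
    · rw [mul_comm]; exact Nat.mul_le_mul_left _ (by omega)
    · rw [hba, Finset.sum_range_succ', ← Finset.mul_sum, add_comm]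
      refine Nat.add_le_add ?_ ?_
      · rw [mul_comm (2 ^ i)]; exact Nat.mul_le_mul_left _ (by simpa using (hheavy a hab).le)
      · refine Nat.mul_le_mul_left _ (le_of_eq ?_)
        refine Finset.sum_bij (fun k _ => a + (k + 1)) ?_ ?_ ?_ ?_
        · intro k hk; simp at hk ⊢; omega
        · intro k _ k' _ h; simpa using h
        · intro k hk; simp at hk; exact ⟨k - a - 1, by simp; omega, by omega⟩
        · intro k _; simp
  have hpos : 0 < h := by
    have : p.length ≠ 0 := by omega
    omega
  have hbig : 2 ^ i ≤ ∑ k ∈ Finset.Ioo a b, w s(g k, g (k + 1)) := by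
    have h1 : h * 2 ^ i ≤ h * ∑ k ∈ Finset.Ioo a b, w s(g k, g (k + 1)) := by
      have : 2 ^ i * h = h * 2 ^ i := mul_comm _ _
      simp only [← add_assoc] at hle
      omega
    exact Nat.le_of_mul_le_mul_left h1 hpos
  refine hbig.trans (le_trans (le_of_eq ?_) (hsum (Finset.Ioo a b) (by simp)))
  refine Finset.sum_congr rfl fun k hk => ?_
  simp only [Finset.mem_Ioo] at hk
  rw [dartCharge, if_neg (by have := hheavy k hk.2; omega), if_pos (hmax k hk.1 hk.2)]

theorem sum_two_pow_le (m v : ℕ) :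
    ∑ i ∈ Finset.range m, (if 2 ^ i ≤ v then 2 ^ i else 0) ≤ 2 * v := by
  -- The bound by `2 ^ m` strengthens the induction; it is what applies when the next power is at
  -- most `v`.
  suffices H : ∑ i ∈ Finset.range m, (if 2 ^ i ≤ v then 2 ^ i else 0) ≤ 2 * v ∧
      ∑ i ∈ Finset.range m, (if 2 ^ i ≤ v then 2 ^ i else 0) < 2 ^ m from H.1
  induction m with
  | zero => simp
  | succ m ih =>
    rw [Finset.sum_range_succ, pow_succ]
    split_ifs with h <;> omega

/-- Over all levels, a dart pays in proportion to its weight and the number of marks. -/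
theorem sum_dartCharge_le (w : Sym2 (Fin n) → ℕ) (unp : ℕ → ℕ → ℕ) (L : ℕ) {x y : Fin n}
    (hxy : 1 ≤ w s(x, y)) : ∑ i ∈ Finset.range (L + 1), dartCharge w unp i x y ≤
      w s(x, y) * (2 + (Finset.filter (fun i => unp i x ≠ 0) (Finset.Icc 1 L)).card) := by
  have h1 : ∀ i ∈ Finset.range (L + 1), dartCharge w unp i x y ≤
      (if 2 ^ i ≤ w s(x, y) then 2 ^ i else 0) +
        if 1 ≤ i ∧ unp i x ≠ 0 then w s(x, y) else 0 := by
    intro i _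
    unfold dartCharge
    by_cases hi : i = 0
    · subst hi; simp [hxy]
    · have : 1 ≤ i := by omega
      split_ifs <;> simp_all
  refine (Finset.sum_le_sum h1).trans ?_
  rw [Finset.sum_add_distrib, mul_add]
  refine Nat.add_le_add ((sum_two_pow_le _ _).trans (by omega)) ?_
  rw [← Finset.sum_filter, Finset.sum_const, smul_eq_mul, mul_comm]
  refine Nat.mul_le_mul_left _ (Finset.card_le_card fun i hi => ?_)
  simp at hi ⊢
  exact ⟨⟨hi.2.1, by omega⟩, hi.2.2⟩

end Charge

/-! ### The cost of a family of hierarchies -/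

section Cost

variable {n : ℕ} {G H : SimpleGraph (Fin n)} {w : Sym2 (Fin n) → ℕ} {h L ρ : ℕ}
  {D : ℕ → ℕ → ℕ → ℕ}

-- Every edge carries two darts, one in each direction.
open Classical in
theorem sum_darts_le (w : Sym2 (Fin n) → ℕ) (H : SimpleGraph (Fin n)) :
    ∑ x, ∑ y with H.Adj x y, w s(x, y) ≤ 2 * cost w H := by
  have h1 : ∑ x, ∑ y with H.Adj x y, w s(x, y) =
      ∑ p ∈ Finset.univ.filter (fun p : Fin n × Fin n => H.Adj p.1 p.2), w s(p.1, p.2) := by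
    rw [Finset.sum_filter, Fintype.sum_prod_type]
    simp only [Finset.sum_filter]
  rw [h1, cost, Finset.mul_sum, ← Finset.sum_fiberwise_of_maps_to
    (t := Finset.univ.filter fun e => e ∈ H.edgeSet) (g := fun p : Fin n × Fin n => s(p.1, p.2))
    (by simp)]
  refine Finset.sum_le_sum fun e _ => ?_
  induction e with | _ a b => ?_
  calc _ ≤ ∑ p ∈ ({(a, b), (b, a)} : Finset (Fin n × Fin n)), w s(a, b) := by
        refine (Finset.sum_congr rfl fun p hp => ?_).trans_le (Finset.sum_le_sum_of_subset ?_)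
        · rw [(Finset.mem_filter.1 hp).2]
        · intro p hp
          have := (Finset.mem_filter.1 hp).2
          rw [Sym2.eq_iff] at this
          simp only [Finset.mem_insert, Finset.mem_singleton, Prod.ext_iff]
          exact this
    _ ≤ _ := by
        rw [Finset.sum_const, smul_eq_mul]
        exact Nat.mul_le_mul_right _ Finset.card_le_two

/-- The number of levels at which a vertex is marked. -/
def marks (unp : ℕ → ℕ → ℕ) (L v : ℕ) : ℕ := ((Finset.Icc 1 L).filter fun i => unp i v ≠ 0).card

open Classical in
/-- The clusters that have to be left are paid for by the feasible subgraph. -/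
theorem IsHierarchy.sum_card_le {X unp rep : ℕ → ℕ → ℕ} (hX : IsHierarchy G h L ρ D X unp rep)
    (hD : ∀ i, 1 ≤ i → i ≤ L → IsDist G (levelLength w h i) (D i)) (hHG : H ≤ G)
    (hw : ∀ e ∈ G.edgeSet, 1 ≤ w e) (Q : ℕ → Finset ℕ)
    (hQ : ∀ j < L, ∀ q ∈ Q j, ∃ s t : Fin n, (∃ p : H.Walk s t, p.length ≤ h) ∧
      marks unp L s = 0 ∧ rep j s = q ∧ rep j s ≠ rep j t) :
    ∑ j ∈ Finset.range L, 2 ^ j * (Q j).card ≤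
      2 * ∑ x : Fin n, ∑ y with H.Adj x y, w s(x, y) * (2 + marks unp L x) := by
  let c := dartCharge w unp
  let S : ℕ → ℕ → ℕ → ℕ := fun j q i =>
    ∑ x ∈ Finset.univ.filter (fun x : Fin n => rep j x = q), ∑ y with H.Adj x y, c i x y
  let C : ℕ → ℕ := fun i => ∑ x : Fin n, ∑ y with H.Adj x y, c i x y
  -- Division by `2 ^ i` turns every class that has to be left into one unit. The level `i` that
  -- pays depends on the class, hence the sum over all of them.
  have h1 : ∀ j < L, ∀ q ∈ Q j, (1 : ℝ) ≤ ∑ i ∈ Finset.Icc j L, (S j q i : ℝ) / 2 ^ i := by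
    intro j hj q hq
    obtain ⟨s, t, ⟨p, hp⟩, hs, rfl, hst⟩ := hQ j hj q hq
    have hs' : ∀ i, 1 ≤ i → i ≤ L → unp i s = 0 := by
      intro i hi hiL
      rw [marks, Finset.card_eq_zero, Finset.filter_eq_empty_iff] at hs
      exact not_not.1 (hs (Finset.mem_Icc.2 ⟨hi, hiL⟩))
    obtain ⟨i, hji, hiL, hi⟩ := hX.exists_charge hD hHG hw p.bypass p.bypass_isPath
      (p.length_bypass_le_length.trans hp) hs' hj.le hst
    refine le_trans ?_ (Finset.single_le_sum (f := fun i => (S j (rep j s) i : ℝ) / 2 ^ i)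
      (fun i _ => by positivity) (Finset.mem_Icc.2 ⟨hji, hiL⟩))
    rw [one_le_div (by positivity)]
    exact_mod_cast hi
  have h2 : ∀ j < L, ((Q j).card : ℝ) ≤ ∑ i ∈ Finset.Icc j L, (C i : ℝ) / 2 ^ i := by
    intro j hj
    calc ((Q j).card : ℝ) = ∑ q ∈ Q j, 1 := by simp
      _ ≤ ∑ q ∈ Q j, ∑ i ∈ Finset.Icc j L, (S j q i : ℝ) / 2 ^ i :=
        Finset.sum_le_sum (h1 j hj)
      _ = ∑ i ∈ Finset.Icc j L, (∑ q ∈ Q j, (S j q i : ℝ)) / 2 ^ i := by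
        rw [Finset.sum_comm]; simp_rw [Finset.sum_div]
      _ ≤ _ := by
        refine Finset.sum_le_sum fun i _ => ?_
        gcongr
        -- For fixed `j` the classes are disjoint, so no dart is charged by two of them.
        have : ∑ q ∈ Q j, S j q i ≤ C i :=
          Finset.sum_fiberwise_le_sum_of_sum_fiber_nonneg (s := Finset.univ)
            (g := fun x : Fin n => rep j x) fun _ _ => Nat.zero_le _
        exact_mod_cast this
  -- After the exchange of sums, level `i` has the coefficient `∑ j ≤ i, 2 ^ j / 2 ^ i`, which is at
  -- most `2`.
  have h3 : ∑ j ∈ Finset.range L, (2 : ℝ) ^ j * (Q j).card ≤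
      2 * ∑ i ∈ Finset.range (L + 1), (C i : ℝ) := by
    calc ∑ j ∈ Finset.range L, (2 : ℝ) ^ j * (Q j).card
        ≤ ∑ j ∈ Finset.range L, ∑ i ∈ Finset.Icc j L, (2 : ℝ) ^ j * ((C i : ℝ) / 2 ^ i) := by
          refine Finset.sum_le_sum fun j hj => ?_
          rw [← Finset.mul_sum]
          gcongr
          exact h2 j (Finset.mem_range.1 hj)
      _ ≤ ∑ i ∈ Finset.range (L + 1), ∑ j ∈ Finset.range (i + 1),
          (2 : ℝ) ^ j * ((C i : ℝ) / 2 ^ i) := by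
          rw [Finset.sum_sigma', Finset.sum_sigma']
          have hinj : Set.InjOn (fun a : (_ : ℕ) × ℕ => (⟨a.2, a.1⟩ : (_ : ℕ) × ℕ))
              ((Finset.range L).sigma fun j => Finset.Icc j L) := by
            rintro ⟨a, b⟩ _ ⟨a', b'⟩ _ hab
            simp only [Sigma.mk.injEq, heq_eq_eq] at hab ⊢
            exact ⟨hab.2, hab.1⟩
          refine le_trans (le_of_eq ?_) (Finset.sum_le_sum_of_subset_of_nonneg
            (s := ((Finset.range L).sigma fun j => Finset.Icc j L).image
              fun a => (⟨a.2, a.1⟩ : (_ : ℕ) × ℕ)) ?_ fun _ _ _ => by positivity)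
          · rw [Finset.sum_image hinj]
          · intro a ha
            obtain ⟨b, hb, rfl⟩ := Finset.mem_image.1 ha
            simp only [Finset.mem_sigma, Finset.mem_range, Finset.mem_Icc] at hb ⊢
            omega
      _ ≤ ∑ i ∈ Finset.range (L + 1), 2 * (C i : ℝ) := by
          refine Finset.sum_le_sum fun i _ => ?_
          rw [← Finset.sum_mul, geom_sum_eq (by norm_num), mul_div_assoc', div_le_iff₀ (by positivity)]
          have : (0 : ℝ) ≤ C i := by positivity
          rw [pow_succ]
          nlinarith
      _ = _ := by rw [Finset.mul_sum]
  have h4 : ∑ i ∈ Finset.range (L + 1), C i ≤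
      ∑ x : Fin n, ∑ y with H.Adj x y, w s(x, y) * (2 + marks unp L x) := by
    simp only [C]
    rw [Finset.sum_comm]
    refine Finset.sum_le_sum fun x _ => ?_
    rw [Finset.sum_comm]
    refine Finset.sum_le_sum fun y hy => ?_
    exact sum_dartCharge_le w unp L (hw _ (hHG (Finset.mem_filter.1 hy).2))
  have h5 : ∑ j ∈ Finset.range L, 2 ^ j * (Q j).card ≤
      2 * ∑ i ∈ Finset.range (L + 1), C i := by exact_mod_cast h3
  exact h5.trans (Nat.mul_le_mul_left _ h4)

end Cost

/-! ### Shortest paths by repeated hops -/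

/-- The last number below `n` with property `P`, or zero. -/
def lastSat (P : ℕ → Prop) [DecidablePred P] : ℕ → ℕ
  | 0 => 0
  | m + 1 => if P m then m else lastSat P m

theorem lastSat_spec {P : ℕ → Prop} [DecidablePred P] {n : ℕ} (hP : ∃ m < n, P m) :
    lastSat P n < n ∧ P (lastSat P n) := by
  induction n with
  | zero => simp at hP
  | succ n ih =>
    unfold lastSat
    split_ifs with hn
    · exact ⟨by omega, hn⟩
    · obtain ⟨m, hm, hPm⟩ := hP
      have hmn : m ≠ n := by rintro rfl; exact hn hPm
      have := ih ⟨m, by omega, hPm⟩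
      exact ⟨by omega, this.2⟩

theorem lastSat_congr {P Q : ℕ → Prop} [DecidablePred P] [DecidablePred Q] {n : ℕ}
    (h : ∀ m < n, (P m ↔ Q m)) : lastSat P n = lastSat Q n := by
  induction n with
  | zero => rfl
  | succ n ih =>
    unfold lastSat
    rw [ih fun m hm => h m (by omega)]
    simp [h n (by omega)]

/-- One step from `x` towards `t` for the distances `d` at level `i`, where `W` is the weight
matrix. -/
def hop (n : ℕ) (W : ℕ → ℕ) (h i : ℕ) (d : ℕ → ℕ → ℕ) (t x : ℕ) : ℕ :=
  if x = t then x
  else lastSat (fun y => W (x * n + y) ≠ 0 ∧ d x t = d y t + (h * W (x * n + y) + 2 ^ i)) n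

/-- The steps of the path from `u` to `t` that repeated hops make. -/
def HopStep (n : ℕ) (W : ℕ → ℕ) (h i : ℕ) (d : ℕ → ℕ → ℕ) (u t x y : ℕ) : Prop :=
  ∃ k < n, x = (hop n W h i d t)^[k] u ∧ y = (hop n W h i d t)^[k + 1] u ∧ x ≠ t

section Hop

variable {n : ℕ} {G : SimpleGraph (Fin n)} {w : Sym2 (Fin n) → ℕ} {h i : ℕ} {d : ℕ → ℕ → ℕ}

theorem weightMatrix_apply (G : SimpleGraph (Fin n)) [DecidableRel G.Adj] (w : Sym2 (Fin n) → ℕ)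
    (u v : Fin n) :
    weightMatrix G w (u * n + v) = if G.Adj u v then w s(u, v) else 0 := by
  have hlt : (u : ℕ) * n + v < n * n := by
    calc (u : ℕ) * n + v < u * n + n := by omega
      _ = (u + 1) * n := by ring
      _ ≤ n * n := Nat.mul_le_mul_right _ u.2
  have h1 : ((u : ℕ) * n + v) / n = u := by
    rw [mul_comm, Nat.mul_add_div (by omega), Nat.div_eq_of_lt v.2, add_zero]
  have h2 : ((u : ℕ) * n + v) % n = v := by
    rw [mul_comm, Nat.mul_add_mod, Nat.mod_eq_of_lt v.2]
  unfold weightMatrix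
  simp only [hlt, dif_pos, h1, h2, Fin.eta]

/-- The search succeeds because of the first edge of a shortest walk. Positive weights make a
nonzero entry of the matrix equivalent to adjacency. -/
theorem hop_spec (hd : IsDist G (levelLength w h i) d) (hw : ∀ e ∈ G.edgeSet, 1 ≤ w e)
    {x t : Fin n} (hxt : d x t ≠ 0) (hne : x ≠ t) :
    ∃ y : Fin n, hop n (weightMatrix G w) h i d t x = y ∧ G.Adj x y ∧
      d x t = d y t + levelLength w h i s(x, y) := by
  classical
  obtain ⟨y, hy, hdy⟩ := hd.exists_next hxt hne
  have hex : ∃ m < n, weightMatrix G w (x * n + m) ≠ 0 ∧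
      d x t = d m t + (h * weightMatrix G w (x * n + m) + 2 ^ i) := by
    refine ⟨y, y.2, ?_⟩
    have := hw s(x, y) hy
    rw [weightMatrix_apply, if_pos hy]
    exact ⟨by omega, hdy⟩
  obtain ⟨h1, h2, h3⟩ := lastSat_spec hex
  refine ⟨⟨_, h1⟩, ?_, ?_⟩
  · rw [hop, if_neg (fun hc => hne (Fin.ext hc))]
  · have e := weightMatrix_apply G w x ⟨_, h1⟩
    simp only at e
    rw [e] at h2 h3
    split_ifs at h2 h3 with hadj
    · exact ⟨hadj, h3⟩
    · exact absurd rfl h2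

/-- The vertices that repeated hops visit. -/
theorem exists_hop_seq (hd : IsDist G (levelLength w h i) d) (hw : ∀ e ∈ G.edgeSet, 1 ≤ w e)
    {u t : Fin n} (hut : d u t ≠ 0) :
    ∃ g : ℕ → Fin n, (∀ k, (hop n (weightMatrix G w) h i d t)^[k] u = g k) ∧
      (∀ k, g k ≠ t → G.Adj (g k) (g (k + 1))) ∧
      (∀ m, ∑ k ∈ (Finset.range m).filter (fun k => g k ≠ t),
        levelLength w h i s(g k, g (k + 1)) + d (g m) t = d u t) ∧ g n = t := by
  have key : ∀ k, ∃ y : Fin n, (hop n (weightMatrix G w) h i d t)^[k] u = y ∧ d y t ≠ 0 := by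
    intro k
    induction k with
    | zero => exact ⟨u, rfl, hut⟩
    | succ k ih =>
      obtain ⟨y, hy, hyt⟩ := ih
      rw [Function.iterate_succ_apply', hy]
      by_cases hne : y = t
      · exact ⟨y, by simp [hop, hne], hyt⟩
      · obtain ⟨z, hz, hadj, hdz⟩ := hop_spec hd hw hyt hne
        refine ⟨z, hz, ?_⟩
        exact hd.reachable.1 (hadj.symm.reachable.trans (hd.reachable.2 hyt))
  choose g hg hgt using key
  have hg0 : g 0 = u := Fin.ext (hg 0).symm
  have hsucc : ∀ k, hop n (weightMatrix G w) h i d t (g k) = g (k + 1) := by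
    intro k
    rw [← hg k, ← hg (k + 1), Function.iterate_succ_apply']
  have hstay : ∀ k, g k = t → g (k + 1) = t := by
    intro k hk
    apply Fin.ext
    rw [← hsucc k, hk, hop, if_pos rfl]
  have hstep : ∀ k, g k ≠ t → G.Adj (g k) (g (k + 1)) ∧
      d (g k) t = d (g (k + 1)) t + levelLength w h i s(g k, g (k + 1)) := by
    intro k hk
    obtain ⟨z, hz, hadj, hdz⟩ := hop_spec hd hw (hgt k) hk
    rw [hsucc] at hz
    obtain rfl : g (k + 1) = z := Fin.ext hz
    exact ⟨hadj, hdz⟩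
  refine ⟨g, hg, fun k hk => (hstep k hk).1, fun m => ?_, ?_⟩
  · induction m with
    | zero => simp [hg0]
    | succ m ih =>
      rw [Finset.range_add_one, Finset.filter_insert]
      split_ifs with hm
      · rw [Finset.sum_insert (by simp)]
        have := (hstep m hm).2
        omega
      · rw [not_not] at hm
        rw [hstay m hm]
        rw [hm] at ih
        exact ih
  · by_contra hne
    have hall : ∀ k ≤ n, g k ≠ t := by
      intro k hk hkt
      have : ∀ j, g (k + j) = t := by
        intro j
        induction j with
        | zero => exact hkt
        | succ j ih => exact hstay _ ih
      exact hne (by rw [← this (n - k)]; congr; omega)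
    -- Every hop before the arrival lowers the distance to `t` by at least `2 ^ i`. Without an
    -- arrival within `n` hops, `n + 1` distinct vertices would occur.
    have hanti : ∀ a b, a < b → b ≤ n → d (g b) t < d (g a) t := by
      intro a b hab
      induction b, hab using Nat.le_induction with
      | base =>
        intro hb
        have := (hstep a (hall a (by omega))).2
        have h2 : 0 < 2 ^ i := by positivity
        simp only [levelLength] at this
        simp only [Nat.succ_eq_add_one]
        omega
      | succ b hab ih =>
        intro hb
        have h1 := (hstep b (hall b (by omega))).2
        have h2 := ih (by omega)
        omega
    have hinj : Function.Injective fun k : Fin (n + 1) => g k := by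
      intro a b hab
      by_contra hne
      rcases lt_or_gt_of_ne hne with hlt | hlt
      · have := hanti a b hlt (by omega)
        simp only at hab
        rw [hab] at this; omega
      · have := hanti b a hlt (by omega)
        simp only at hab
        rw [hab] at this; omega
    have := Fintype.card_le_of_injective _ hinj
    simp at this

/-- Repeated hops arrive. -/
theorem hop_iterate_eq (hd : IsDist G (levelLength w h i) d) (hw : ∀ e ∈ G.edgeSet, 1 ≤ w e)
    {u t : Fin n} (hut : d u t ≠ 0) : (hop n (weightMatrix G w) h i d t)^[n] u = t := by
  obtain ⟨g, hg, -, -, hgn⟩ := exists_hop_seq hd hw hut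
  rw [hg, hgn]

/-- The number of hops on the path from `u` to `t`. -/
def hopCount (n : ℕ) (W : ℕ → ℕ) (h i : ℕ) (d : ℕ → ℕ → ℕ) (u t m : ℕ) : ℕ :=
  ((Finset.range m).filter fun k => (hop n W h i d t)^[k] u ≠ t).card

theorem hopCount_le (n : ℕ) (W : ℕ → ℕ) (h i : ℕ) (d : ℕ → ℕ → ℕ) (u t m : ℕ) :
    hopCount n W h i d u t m ≤ m :=
  (Finset.card_filter_le _ _).trans (by simp)

/-- Each hop has level length at least `2 ^ i`. -/
theorem hopCount_le_of_dist (hd : IsDist G (levelLength w h i) d)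
    (hw : ∀ e ∈ G.edgeSet, 1 ≤ w e) {u t : Fin n} (hut : d u t ≠ 0) {ρ : ℕ}
    (hρ : d u t ≤ ρ * (2 ^ i * h) + 1) :
    hopCount n (weightMatrix G w) h i d u t n ≤ ρ * h := by
  obtain ⟨g, hg, -, hsum, hgn⟩ := exists_hop_seq hd hw hut
  have h1 := hsum n
  rw [hgn, hd.self] at h1
  have h2 : hopCount n (weightMatrix G w) h i d u t n =
      ((Finset.range n).filter fun k => g k ≠ t).card := by
    simp only [hopCount, hg, ne_eq, Fin.val_inj]
  rw [h2]
  have h3 : ((Finset.range n).filter fun k => g k ≠ t).card * 2 ^ i ≤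
      ∑ k ∈ (Finset.range n).filter (fun k => g k ≠ t), levelLength w h i s(g k, g (k + 1)) := by
    rw [← smul_eq_mul]
    exact Finset.card_nsmul_le_sum _ _ _ fun k _ => Nat.le_add_left _ _
  refine Nat.le_of_mul_le_mul_right (c := 2 ^ i) (h3.trans ?_) (by positivity)
  calc _ ≤ ρ * (2 ^ i * h) := by omega
    _ = _ := by ring

/-- The level length of an edge is at least `h` times its weight. The edges are collected in a set
since many routes share a leg, which has to be paid for only once. -/
theorem exists_hopStep_edges (hd : IsDist G (levelLength w h i) d)
    (hw : ∀ e ∈ G.edgeSet, 1 ≤ w e) {u t : Fin n} (hut : d u t ≠ 0) {ρ : ℕ} (hh : 0 < h)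
    (hρ : d u t ≤ ρ * (2 ^ i * h) + 1) :
    ∃ E : Finset (Sym2 (Fin n)), (∀ x y : Fin n,
      HopStep n (weightMatrix G w) h i d u t x y → s(x, y) ∈ E) ∧ ∑ e ∈ E, w e ≤ ρ * 2 ^ i := by
  classical
  obtain ⟨g, hg, -, hsum, hgn⟩ := exists_hop_seq hd hw hut
  have h1 := hsum n
  rw [hgn, hd.self] at h1
  refine ⟨((Finset.range n).filter fun k => g k ≠ t).image fun k => s(g k, g (k + 1)), ?_, ?_⟩
  · rintro x y ⟨k, hk, hx, hy, hxt⟩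
    rw [hg] at hx hy
    rw [Fin.ext hx, Fin.ext hy]
    refine Finset.mem_image.2 ⟨k, Finset.mem_filter.2 ⟨Finset.mem_range.2 hk, ?_⟩, rfl⟩
    intro hc
    exact hxt (by rw [hx, hc])
  · have h3 : ∑ e ∈ ((Finset.range n).filter fun k => g k ≠ t).image
        (fun k => s(g k, g (k + 1))), w e ≤
        ∑ k ∈ (Finset.range n).filter (fun k => g k ≠ t), w s(g k, g (k + 1)) :=
      Finset.sum_image_le_of_nonneg (fun _ _ => Nat.zero_le _)
    refine h3.trans (le_of_mul_le_mul_left (a := h) ?_ hh)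
    calc _ ≤ ∑ k ∈ (Finset.range n).filter (fun k => g k ≠ t),
          levelLength w h i s(g k, g (k + 1)) := by
          rw [Finset.mul_sum]
          exact Finset.sum_le_sum fun k _ => Nat.le_add_right _ _
      _ ≤ ρ * (2 ^ i * h) := by omega
      _ = _ := by ring

theorem HopStep.adj (hd : IsDist G (levelLength w h i) d)
    (hw : ∀ e ∈ G.edgeSet, 1 ≤ w e) {u t : Fin n} (hut : d u t ≠ 0) {x y : ℕ}
    (hxy : HopStep n (weightMatrix G w) h i d u t x y) :
    ∃ (hx : x < n) (hy : y < n), G.Adj ⟨x, hx⟩ ⟨y, hy⟩ := by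
  obtain ⟨g, hg, hadj, -, -⟩ := exists_hop_seq hd hw hut
  obtain ⟨k, hk, hx, hy, hxt⟩ := hxy
  rw [hg] at hx hy
  subst hx hy
  exact ⟨(g k).2, (g (k + 1)).2, hadj k fun hc => hxt (by rw [hc])⟩

end Hop

/-! ### Solutions that follow hierarchies -/

section Hierarchy

variable {n : ℕ} {G H : SimpleGraph (Fin n)} {w : Sym2 (Fin n) → ℕ} {h L ρ : ℕ}
  {D : ℕ → ℕ → ℕ → ℕ} {X unp rep : ℕ → ℕ → ℕ}

/-- The representatives of the clusters that the partitions of the levels `j, …, L` generate. -/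
def IsRep (n L : ℕ) (X rep : ℕ → ℕ → ℕ) : Prop :=
  ∀ j ≤ L, ∀ v < n, rep j v =
    lastSat (fun u => (j < L → rep (j + 1) u = rep (j + 1) v) ∧ X j u = X j v) n

theorem IsRep.spec (hr : IsRep n L X rep) {j v : ℕ} (hj : j ≤ L) (hv : v < n) :
    rep j v < n ∧ (j < L → rep (j + 1) (rep j v) = rep (j + 1) v) ∧ X j (rep j v) = X j v := by
  rw [hr j hj v hv]
  exact lastSat_spec (P := fun u => (j < L → rep (j + 1) u = rep (j + 1) v) ∧ X j u = X j v)
    ⟨v, hv, fun _ => rfl, rfl⟩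

theorem IsRep.eq_iff (hr : IsRep n L X rep) {j u v : ℕ} (hj : j ≤ L) (hu : u < n) (hv : v < n) :
    rep j u = rep j v ↔ (j < L → rep (j + 1) u = rep (j + 1) v) ∧ X j u = X j v := by
  constructor
  · intro h
    have h1 := hr.spec hj hu
    have h2 := hr.spec hj hv
    rw [h] at h1
    exact ⟨fun hl => (h1.2.1 hl).symm.trans (h2.2.1 hl), h1.2.2.symm.trans h2.2.2⟩
  · rintro ⟨h1, h2⟩
    rw [hr j hj u hu, hr j hj v hv]
    refine lastSat_congr fun m _ => ?_
    rw [h2]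
    exact and_congr_left' (imp_congr_right fun hl => by rw [h1 hl])

/-- Recursion from the top level down turns the comparison of neighbouring levels into agreement at
all levels from `j` on. -/
theorem IsRep.eq_iff_forall (hr : IsRep n L X rep) {j u v : ℕ} (hj : j ≤ L) (hu : u < n)
    (hv : v < n) : rep j u = rep j v ↔ ∀ i, j ≤ i → i ≤ L → X i u = X i v := by
  obtain ⟨m, hm⟩ : ∃ m, L = j + m := ⟨L - j, by omega⟩
  induction m generalizing j with
  | zero =>
    rw [hr.eq_iff hj hu hv]
    constructor
    · rintro h i hi hi'
      obtain rfl : i = j := by omega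
      exact h.2
    · intro h
      exact ⟨fun hl => by omega, h j le_rfl hj⟩
  | succ m ih =>
    rw [hr.eq_iff hj hu hv, ih (by omega) (by omega)]
    constructor
    · rintro h i hi hi'
      obtain rfl | hi := hi.eq_or_lt
      · exact h.2
      · exact h.1 (by omega) i hi hi'
    · intro h
      exact ⟨fun _ i hi hi' => h i (by omega) hi', h j le_rfl hj⟩

/-- The partition of level `0` is discrete, which makes `rep 0` the identity: routes start and end
at the vertices themselves. -/
theorem IsRep.isHierarchy (hr : IsRep n L X rep) (hX0 : ∀ v < n, X 0 v = v)
    (diam : ∀ i, 1 ≤ i → i ≤ L → ∀ u v : Fin n, X i u = X i v →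
      D i u v ≠ 0 ∧ D i u v ≤ ρ * (2 ^ i * h) + 1)
    (padded : ∀ i, 1 ≤ i → i ≤ L → ∀ u v : Fin n, unp i u = 0 → D i u v ≠ 0 →
      D i u v ≤ 4 * (2 ^ i * h) + 1 → X i u = X i v) :
    IsHierarchy G h L ρ D X unp rep where
  diam := diam
  padded := padded
  rep_zero u := by
    have h1 := hr.spec (Nat.zero_le L) u.2
    have h2 := h1.2.2
    rwa [hX0 _ h1.1, hX0 _ u.2] at h2
  rep_lt j hj u := (hr.spec hj u.2).1
  rep_eq j hj u v := hr.eq_iff_forall hj u.2 v.2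
  rep_mem i hi u j hj := by
    have h1 := hr.spec (hj.trans hi) u.2
    exact (hr.eq_iff_forall (hj.trans hi) h1.1 u.2).1
      ((hr.eq_iff (hj.trans hi) h1.1 u.2).2 h1.2) i hj hi

/-- The classes are nested, although the partitions `X i` themselves need not be: fewer partitions
have a coarser common refinement. -/
theorem IsHierarchy.rep_mono (hX : IsHierarchy G h L ρ D X unp rep) {i j : ℕ} (hij : i ≤ j)
    (hj : j ≤ L) {u v : Fin n} (huv : rep i u = rep i v) : rep j u = rep j v := by
  rw [hX.rep_eq j hj]
  rw [hX.rep_eq i (hij.trans hj)] at huv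
  exact fun k hk hkL => huv k (hij.trans hk) hkL

/-- The distance of consecutive representatives. -/
theorem IsHierarchy.dist_rep (hX : IsHierarchy G h L ρ D X unp rep) {j : ℕ} (hj : j < L)
    (u : Fin n) : (D (j + 1) (rep j u) (rep (j + 1) u) ≠ 0 ∧
      D (j + 1) (rep j u) (rep (j + 1) u) ≤ ρ * (2 ^ (j + 1) * h) + 1) ∧
    D (j + 1) (rep (j + 1) u) (rep j u) ≠ 0 ∧
      D (j + 1) (rep (j + 1) u) (rep j u) ≤ ρ * (2 ^ (j + 1) * h) + 1 := by
  have h1 := hX.rep_mem (j + 1) hj u j (by omega)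
  have h2 := hX.rep_mem (j + 1) hj u (j + 1) le_rfl
  exact ⟨hX.diam (j + 1) (by omega) hj ⟨_, hX.rep_lt j hj.le u⟩ ⟨_, hX.rep_lt (j + 1) hj u⟩
      (h1.trans h2.symm),
    hX.diam (j + 1) (by omega) hj ⟨_, hX.rep_lt (j + 1) hj u⟩ ⟨_, hX.rep_lt j hj.le u⟩
      (h2.trans h1.symm)⟩

/-- Unmarked vertices that few hops connect lie in the same cluster of the top level. -/
theorem IsHierarchy.rep_top_eq (hX : IsHierarchy G h L ρ D X unp rep) (hL : 1 ≤ L)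
    (hD : IsDist G (levelLength w h L) (D L)) {a : ℕ} (hw : ∀ e ∈ G.edgeSet, w e ≤ n ^ a)
    (hna : n ^ (a + 1) ≤ 2 ^ L) {s t : Fin n} (hs : marks unp L s = 0) (p : G.Walk s t)
    (hp : p.length ≤ h) : rep L s = rep L t := by
  rw [hX.rep_eq L le_rfl]
  intro i hi hi'
  obtain rfl : i = L := by omega
  have hs0 : unp i s = 0 := by
    rw [marks, Finset.card_eq_zero, Finset.filter_eq_empty_iff] at hs
    exact not_not.1 (hs (Finset.mem_Icc.2 ⟨hL, le_rfl⟩))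
  -- After bypassing, the walk has at most `h` and fewer than `n` edges. The first fact bounds the
  -- hop part of its length, the second the weight part, by `h * n ^ (a + 1)`.
  have hq := (hD s t).2 p.bypass
  have hlen : p.bypass.length ≤ h := p.length_bypass_le_length.trans hp
  have hlt : p.bypass.length < n := by simpa using p.bypass_isPath.length_lt
  have hsum : ∀ l : List (Sym2 (Fin n)), (∀ e ∈ l, e ∈ G.edgeSet) →
      (l.map (levelLength w h i)).sum ≤ l.length * (h * n ^ a + 2 ^ i) := by
    intro l hl
    refine (List.sum_le_card_nsmul _ (h * n ^ a + 2 ^ i) ?_).trans_eq (by simp)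
    intro x hx
    obtain ⟨e, he, rfl⟩ := List.mem_map.1 hx
    exact Nat.add_le_add_right (Nat.mul_le_mul_left _ (hw e (hl e he))) _
  have h1 := hsum p.bypass.edges fun e he => p.bypass.edges_subset_edgeSet he
  rw [SimpleGraph.Walk.length_edges] at h1
  refine hX.padded i hL le_rfl s t hs0 hq.1 (hq.2.trans (Nat.add_le_add_right (h1.trans ?_) 1))
  calc p.bypass.length * (h * n ^ a + 2 ^ i)
      = p.bypass.length * (h * n ^ a) + p.bypass.length * 2 ^ i := by ring
    _ ≤ n * (h * n ^ a) + h * 2 ^ i :=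
      Nat.add_le_add (Nat.mul_le_mul_right _ hlt.le) (Nat.mul_le_mul_right _ hlen)
    _ = h * n ^ (a + 1) + h * 2 ^ i := by ring
    _ ≤ h * 2 ^ i + h * 2 ^ i := by gcongr
    _ ≤ 4 * (2 ^ i * h) := by rw [mul_comm h]; omega

/-- The steps from `x` to `y` on the path of the hierarchy from `s` to `t`. -/
def RouteStep (n : ℕ) (W : ℕ → ℕ) (h L : ℕ) (D : ℕ → ℕ → ℕ → ℕ) (rep : ℕ → ℕ → ℕ)
    (s t x y : ℕ) : Prop :=
  (∃ j < L, rep j s ≠ rep j t ∧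
    (HopStep n W h (j + 1) (D (j + 1)) (rep j s) (rep (j + 1) s) x y ∨
      HopStep n W h (j + 1) (D (j + 1)) (rep (j + 1) t) (rep j t) x y)) ∨
  (rep L s ≠ rep L t ∧ HopStep n W h L (D L) (rep L s) (rep L t) x y)

open Classical in
theorem cost_le_sum {K : SimpleGraph (Fin n)} {ι : Type*} (I : Finset ι)
    (E : ι → Finset (Sym2 (Fin n))) (hK : ∀ e ∈ K.edgeSet, ∃ i ∈ I, e ∈ E i) :
    cost w K ≤ ∑ i ∈ I, ∑ e ∈ E i, w e := by
  rw [Finset.sum_sigma', cost]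
  refine le_trans ?_ (Finset.sum_image_le_of_nonneg
    (g := fun a : (_ : ι) × Sym2 (Fin n) => a.2) (f := w) fun _ _ => Nat.zero_le _)
  refine Finset.sum_le_sum_of_subset fun e he => ?_
  obtain ⟨i, hi, hei⟩ := hK e (by simpa using he)
  exact Finset.mem_image.2 ⟨⟨i, e⟩, by simp [hi, hei], rfl⟩

/-- The cost of a graph all of whose edges lie on paths, in one of `τ` hierarchies, of demand pairs
that are unmarked in this hierarchy. -/
theorem cost_le_of_hierarchies {τ a : ℕ} {X unp rep : ℕ → ℕ → ℕ → ℕ}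
    (hX : ∀ T < τ, IsHierarchy G h L ρ D (X T) (unp T) (rep T))
    (hD : ∀ i, 1 ≤ i → i ≤ L → IsDist G (levelLength w h i) (D i)) (hL : 1 ≤ L) (hh : 1 ≤ h)
    (hw : ∀ e ∈ G.edgeSet, 1 ≤ w e ∧ w e ≤ n ^ a) (hna : n ^ (a + 1) ≤ 2 ^ L)
    (hmarks : ∀ v : Fin n, ∑ T ∈ Finset.range τ, marks (unp T) L v ≤ τ)
    {Δ : Set (Fin n × Fin n)} (hH : IsFeasible G h Δ H) {K : SimpleGraph (Fin n)}
    (hK : ∀ x y, K.Adj x y → ∃ T < τ, ∃ p ∈ Δ, marks (unp T) L p.1 = 0 ∧ marks (unp T) L p.2 = 0 ∧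
      (RouteStep n (weightMatrix G w) h L D (rep T) p.1 p.2 x y ∨
        RouteStep n (weightMatrix G w) h L D (rep T) p.1 p.2 y x)) :
    cost w K ≤ 48 * ρ * τ * cost w H := by
  classical
  have hw1 : ∀ e ∈ G.edgeSet, 1 ≤ w e := fun e he => (hw e he).1
  have hwalk : ∀ p ∈ Δ, ∃ q : H.Walk p.1 p.2, q.length ≤ h := by
    intro p hp
    have h1 := hH.2 p hp
    obtain ⟨q, hq⟩ := SimpleGraph.exists_walk_of_edist_ne_top
      (ne_top_of_le_ne_top (ENat.natCast_ne_top h) h1)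
    rw [← hq] at h1
    exact ⟨q, by exact_mod_cast h1⟩
  -- `Q T j` contains every class of level `j` out of which at most `h` hops of `H` lead from an
  -- unmarked vertex, whether or not the pair is a demand.
  let Q : ℕ → ℕ → Finset ℕ := fun T j => (Finset.range n).filter fun q => ∃ s t : Fin n,
    (∃ p : H.Walk s t, p.length ≤ h) ∧ marks (unp T) L s = 0 ∧ rep T j s = q ∧
      rep T j s ≠ rep T j t
  have hQ : ∀ T < τ, ∑ j ∈ Finset.range L, 2 ^ j * (Q T j).card ≤
      2 * ∑ x : Fin n, ∑ y with H.Adj x y, w s(x, y) * (2 + marks (unp T) L x) :=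
    fun T hT => (hX T hT).sum_card_le hD hH.1 hw1 (Q T)
      fun j _ q hq => (Finset.mem_filter.1 hq).2
  -- The edges of the legs, in both directions, between the representatives of a class and of its
  -- parent. The set depends on the class alone and serves all demands; its weight is at most twice
  -- `ρ * 2 ^ (j + 1)`.
  have hEex : ∀ T < τ, ∀ j < L, ∀ q < n, ∃ E : Finset (Sym2 (Fin n)),
      (∀ s : Fin n, rep T j s = q → ∀ x y : Fin n,
        (HopStep n (weightMatrix G w) h (j + 1) (D (j + 1)) (rep T j s) (rep T (j + 1) s) x y ∨
          HopStep n (weightMatrix G w) h (j + 1) (D (j + 1)) (rep T (j + 1) s) (rep T j s) x y) →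
        s(x, y) ∈ E) ∧ ∑ e ∈ E, w e ≤ 4 * ρ * 2 ^ j := by
    intro T hT j hj q hq
    by_cases hs : ∃ s : Fin n, rep T j s = q
    · obtain ⟨s, hs⟩ := hs
      have hd := (hX T hT).dist_rep hj s
      let u : Fin n := ⟨rep T j s, (hX T hT).rep_lt j hj.le s⟩
      let v : Fin n := ⟨rep T (j + 1) s, (hX T hT).rep_lt (j + 1) hj s⟩
      obtain ⟨E, hE, hEw⟩ := exists_hopStep_edges (hD (j + 1) (by omega) hj) hw1 (u := u) (t := v)
        hd.1.1 hh hd.1.2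
      obtain ⟨E', hE', hEw'⟩ := exists_hopStep_edges (hD (j + 1) (by omega) hj) hw1 (u := v)
        (t := u) hd.2.1 hh hd.2.2
      refine ⟨E ∪ E', ?_, ?_⟩
      · intro s' hs' x y hxy
        have e1 : rep T j s' = u := hs'.trans hs.symm
        have e2 : rep T (j + 1) s' = v := (hX T hT).rep_mono (i := j) (by omega) hj e1
        rw [e1, e2] at hxy
        rw [Finset.mem_union]
        exact hxy.imp (hE x y) (hE' x y)
      · have : ∑ e ∈ E ∪ E', w e ≤ ∑ e ∈ E, w e + ∑ e ∈ E', w e := by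
          rw [← Finset.sum_union_inter]; omega
        refine this.trans ?_
        rw [pow_succ] at hEw hEw'
        calc _ ≤ ρ * (2 ^ j * 2) + ρ * (2 ^ j * 2) := Nat.add_le_add hEw hEw'
          _ = _ := by ring
    · exact ⟨∅, fun s hs' => absurd ⟨s, hs'⟩ hs, by simp⟩
  choose! E hE hEw using hEex
  have hroute : ∀ T < τ, ∀ p ∈ Δ, marks (unp T) L p.1 = 0 → marks (unp T) L p.2 = 0 →
      ∀ x y : Fin n, RouteStep n (weightMatrix G w) h L D (rep T) p.1 p.2 x y →
      ∃ j < L, ∃ q ∈ Q T j, s(x, y) ∈ E T j q := by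
    intro T hT p hp h1 h2 x y hxy
    obtain ⟨q, hq⟩ := hwalk p hp
    -- The ends of a demand share the top class, so its route never crosses at the top level.
    have htop := (hX T hT).rep_top_eq hL (hD L hL le_rfl) (fun e he => (hw e he).2) hna h1
      (q.mapLe hH.1) (by simpa using hq)
    rcases hxy with ⟨j, hj, hne, hxy⟩ | ⟨hne, -⟩
    swap
    · exact absurd htop hne
    rcases hxy with hxy | hxy
    · exact ⟨j, hj, rep T j p.1, Finset.mem_filter.2 ⟨Finset.mem_range.2
        ((hX T hT).rep_lt j hj.le _), p.1, p.2, ⟨q, hq⟩, h1, rfl, hne⟩,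
        hE T hT j hj _ ((hX T hT).rep_lt j hj.le _) p.1 rfl x y (.inl hxy)⟩
    · exact ⟨j, hj, rep T j p.2, Finset.mem_filter.2 ⟨Finset.mem_range.2
        ((hX T hT).rep_lt j hj.le _), p.2, p.1, ⟨q.reverse, by simpa using hq⟩, h2, rfl, hne.symm⟩,
        hE T hT j hj _ ((hX T hT).rep_lt j hj.le _) p.2 rfl x y (.inr hxy)⟩
  have hcost : cost w K ≤ ∑ a ∈ (Finset.range τ).sigma fun T => (Finset.range L).sigma fun j =>
      Q T j, ∑ e ∈ E a.1 a.2.1 a.2.2, w e := by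
    refine cost_le_sum _ (fun a : (_ : ℕ) × (_ : ℕ) × ℕ => E a.1 a.2.1 a.2.2) fun e he => ?_
    induction e with | _ x y => ?_
    obtain ⟨T, hT, p, hp, h1, h2, hxy⟩ := hK x y he
    obtain ⟨j, hj, q, hq, hmem⟩ : ∃ j < L, ∃ q ∈ Q T j, s(x, y) ∈ E T j q := by
      rcases hxy with hxy | hxy
      · exact hroute T hT p hp h1 h2 x y hxy
      · rw [Sym2.eq_swap]; exact hroute T hT p hp h1 h2 y x hxy
    exact ⟨⟨T, j, q⟩, by simp only [Finset.mem_sigma, Finset.mem_range]; exact ⟨hT, hj, hq⟩, hmem⟩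
  refine hcost.trans ?_
  rw [Finset.sum_sigma]
  calc _ ≤ ∑ T ∈ Finset.range τ, 4 * ρ *
        (2 * ∑ x : Fin n, ∑ y with H.Adj x y, w s(x, y) * (2 + marks (unp T) L x)) := by
        refine Finset.sum_le_sum fun T hT => ?_
        have hT := Finset.mem_range.1 hT
        refine le_trans ?_ (Nat.mul_le_mul_left _ (hQ T hT))
        rw [Finset.sum_sigma, Finset.mul_sum]
        refine Finset.sum_le_sum fun j hj => ?_
        calc _ ≤ ∑ q ∈ Q T j, 4 * ρ * 2 ^ j := Finset.sum_le_sum fun q hq =>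
              hEw T hT j (Finset.mem_range.1 hj) q
                (Finset.mem_range.1 (Finset.mem_filter.1 hq).1)
          _ = _ := by rw [Finset.sum_const, smul_eq_mul]; ring
    _ = 8 * ρ * ∑ x : Fin n, ∑ y with H.Adj x y,
        w s(x, y) * (2 * τ + ∑ T ∈ Finset.range τ, marks (unp T) L x) := by
        rw [← Finset.mul_sum, ← Finset.mul_sum, ← mul_assoc, Finset.sum_comm]
        congr 1
        · ring
        refine Finset.sum_congr rfl fun x _ => ?_
        rw [Finset.sum_comm]
        refine Finset.sum_congr rfl fun y _ => ?_
        rw [← Finset.mul_sum, Finset.sum_add_distrib]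
        simp [mul_comm]
    -- Here the hierarchies are averaged: each vertex has at most `τ` marks in all of them together.
    _ ≤ 8 * ρ * ∑ x : Fin n, ∑ y with H.Adj x y, w s(x, y) * (3 * τ) := by
        refine Nat.mul_le_mul_left _ (Finset.sum_le_sum fun x _ => Finset.sum_le_sum fun y _ =>
          Nat.mul_le_mul_left _ ?_)
        have := hmarks x
        omega
    _ = 8 * ρ * (3 * τ) * ∑ x : Fin n, ∑ y with H.Adj x y, w s(x, y) := by
        simp_rw [← Finset.sum_mul]; ring
    _ ≤ 8 * ρ * (3 * τ) * (2 * cost w H) := Nat.mul_le_mul_left _ (sum_darts_le w H)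
    _ = _ := by ring

end Hierarchy

/-! ### Reasoning about loop programs -/

section Simp

variable (s : Store)

@[simp] theorem Store.setReg_reg (x v y : ℕ) :
    (s.setReg x v).reg y = if y = x then v else s.reg y := by
  simp [Store.setReg, Function.update_apply]

@[simp] theorem Store.setReg_arr (x v : ℕ) : (s.setReg x v).arr = s.arr := rfl

@[simp] theorem Store.setArr_reg (a i v : ℕ) : (s.setArr a i v).reg = s.reg := rfl

@[simp] theorem Store.setArr_arr (a i v b : ℕ) :
    (s.setArr a i v).arr b = if b = a then Function.update (s.arr a) i v else s.arr b := by
  simp [Store.setArr, Function.update_apply]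

instance : Add Expr := ⟨.bin .add⟩
instance : Sub Expr := ⟨.bin .sub⟩
instance : Mul Expr := ⟨.bin .mul⟩
instance : Div Expr := ⟨.bin .div⟩
instance (k : ℕ) : OfNat Expr k := ⟨.lit k⟩

/-- Comparisons, with value one or zero. -/
infix:50 " <ₑ " => Expr.bin Op.lt
infix:50 " =ₑ " => Expr.bin Op.eq
infixr:40 " ;; " => Cmd.seq

/-- The content of a register. -/
abbrev V (x : ℕ) : Expr := .reg x

@[simp] theorem Expr.eval_add (e f : Expr) : (e + f).eval s = e.eval s + f.eval s := rfl
@[simp] theorem Expr.eval_sub (e f : Expr) : (e - f).eval s = e.eval s - f.eval s := rfl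
@[simp] theorem Expr.eval_mul (e f : Expr) : (e * f).eval s = e.eval s * f.eval s := rfl
@[simp] theorem Expr.eval_div (e f : Expr) : (e / f).eval s = e.eval s / f.eval s := rfl
@[simp] theorem Expr.eval_lt (e f : Expr) :
    (e <ₑ f).eval s = if e.eval s < f.eval s then 1 else 0 := rfl
@[simp] theorem Expr.eval_eq (e f : Expr) :
    (e =ₑ f).eval s = if e.eval s = f.eval s then 1 else 0 := rfl
@[simp] theorem Expr.eval_ofNat (k : ℕ) : (ofNat(k) : Expr).eval s = OfNat.ofNat k := rfl
@[simp] theorem Expr.eval_zero : (0 : Expr).eval s = 0 := rfl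
@[simp] theorem Expr.eval_one : (1 : Expr).eval s = 1 := rfl
@[simp] theorem Expr.eval_lit (k : ℕ) : (Expr.lit k).eval s = k := rfl
@[simp] theorem Expr.eval_reg (x : ℕ) : (Expr.reg x).eval s = s.reg x := rfl
@[simp] theorem Expr.eval_arr (a : ℕ) (i : Expr) : (Expr.arr a i).eval s = s.arr a (i.eval s) := rfl

theorem Expr.mul_ne_zero (e f : Expr) :
    (e * f).eval s ≠ 0 ↔ e.eval s ≠ 0 ∧ f.eval s ≠ 0 := Nat.mul_ne_zero_iff
theorem Expr.add_ne_zero (e f : Expr) :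
    (e + f).eval s ≠ 0 ↔ e.eval s ≠ 0 ∨ f.eval s ≠ 0 := by rw [Expr.eval_add]; omega
theorem Expr.lt_ne_zero (e f : Expr) : (e <ₑ f).eval s ≠ 0 ↔ e.eval s < f.eval s := by simp
theorem Expr.eq_ne_zero (e f : Expr) : (e =ₑ f).eval s ≠ 0 ↔ e.eval s = f.eval s := by simp

@[simp] theorem Expr.safe_add (e f : Expr) : (e + f).safe = (e.safe && f.safe) := rfl
@[simp] theorem Expr.safe_sub (e f : Expr) : (e - f).safe = (e.safe && f.safe) := rfl
@[simp] theorem Expr.safe_mul (e f : Expr) :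
    (e * f).safe = (e.safe && f.safe && f.small) := rfl
@[simp] theorem Expr.safe_div (e f : Expr) : (e / f).safe = (e.safe && f.safe) := rfl
@[simp] theorem Expr.safe_lt (e f : Expr) : (e <ₑ f).safe = (e.safe && f.safe) := rfl
@[simp] theorem Expr.safe_eq (e f : Expr) : (e =ₑ f).safe = (e.safe && f.safe) := rfl
@[simp] theorem Expr.safe_ofNat (k : ℕ) : (ofNat(k) : Expr).safe = true := rfl
@[simp] theorem Expr.safe_lit (k : ℕ) : (Expr.lit k).safe = true := rfl
@[simp] theorem Expr.safe_reg (x : ℕ) : (Expr.reg x).safe = true := rfl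
@[simp] theorem Expr.safe_arr (a : ℕ) (i : Expr) : (Expr.arr a i).safe = i.safe := rfl
@[simp] theorem Expr.small_lt (e f : Expr) : (e <ₑ f).small = true := rfl
@[simp] theorem Expr.small_eq (e f : Expr) : (e =ₑ f).small = true := rfl
@[simp] theorem Expr.small_ofNat (k : ℕ) : (ofNat(k) : Expr).small = true := rfl
@[simp] theorem Expr.small_lit (k : ℕ) : (Expr.lit k).small = true := rfl
@[simp] theorem Expr.small_reg (x : ℕ) : (Expr.reg x).small = decide (x ≤ 1) := rfl

@[simp] theorem Cmd.run_skip : Cmd.skip.run s = s := rfl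
@[simp] theorem Cmd.run_set (x : ℕ) (e : Expr) : (Cmd.set x e).run s = s.setReg x (e.eval s) := rfl
@[simp] theorem Cmd.run_put (a : ℕ) (i e : Expr) :
    (Cmd.put a i e).run s = s.setArr a (i.eval s) (e.eval s) := rfl
@[simp] theorem Cmd.run_seq (p q : Cmd) : (p ;; q).run s = q.run (p.run s) := rfl
theorem Cmd.run_ite (b : Expr) (p q : Cmd) :
    (Cmd.ite b p q).run s = if b.eval s ≠ 0 then p.run s else q.run s := rfl

theorem Cmd.run_ite_of {b : Expr} {P : Prop} [Decidable P] (h : b.eval s ≠ 0 ↔ P) (p q : Cmd) :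
    (Cmd.ite b p q).run s = if P then p.run s else q.run s := by
  simp only [Cmd.run_ite, h]

end Simp

/-- The invariant rule for loops. -/
theorem Cmd.rep_induct {p : Cmd} {x k : ℕ} {s : Store} (I : ℕ → Store → Prop) {N : ℕ}
    (hN : k * s.reg 0 = N) (hI : ∀ m s' y, I m s' → I m (s'.setReg x y)) (h0 : I 0 s)
    (step : ∀ m < N, ∀ s', s.AgreeOff (x :: p.regs) p.arrs s' → s'.reg x = m → I m s' →
      I (m + 1) (p.run s')) : I N ((Cmd.rep x k p).run s) := by
  have key : ∀ m ≤ N, I m (Store.iter x p.run s m) := by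
    intro m
    induction m with
    | zero => exact fun _ => h0
    | succ m ih =>
      intro hm
      refine step m hm _ ⟨fun y hy => ?_, fun a ha => ?_⟩ (by simp) (hI _ _ _ (ih (by omega)))
      · rw [Store.setReg_reg, if_neg (fun h => hy (by simp [h]))]
        exact (Store.iter_agreeOff p x s m).1 y hy
      · exact (Store.iter_agreeOff p x s m).2 a ha
  subst hN
  exact hI _ _ _ (key _ le_rfl)

/-- A loop that respects a preorder on array contents and achieves, in every round, a goal that
persists. -/
theorem Cmd.rep_mono {p : Cmd} {x k : ℕ} {s : Store} (R : (ℕ → ℕ → ℕ) → (ℕ → ℕ → ℕ) → Prop)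
    (Q : ℕ → (ℕ → ℕ → ℕ) → Prop) {N : ℕ} (hN : k * s.reg 0 = N) (refl : ∀ A, R A A)
    (trans : ∀ A B C, R A B → R B C → R A C) (hQ : ∀ m A B, R A B → Q m A → Q m B)
    (step : ∀ m < N, ∀ s', s.AgreeOff (x :: p.regs) p.arrs s' → s'.reg x = m → R s.arr s'.arr →
      R s'.arr (p.run s').arr ∧ Q m (p.run s').arr) :
    R s.arr ((Cmd.rep x k p).run s).arr ∧ ∀ m < N, Q m ((Cmd.rep x k p).run s).arr := by
  refine Cmd.rep_induct (I := fun m s' => R s.arr s'.arr ∧ ∀ m' < m, Q m' s'.arr) hN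
    (fun _ _ _ h => h) ⟨refl _, by simp⟩ fun m hm s' hs' hx ⟨h1, h2⟩ => ?_
  obtain ⟨h3, h4⟩ := step m hm s' hs' hx h1
  refine ⟨trans _ _ _ h1 h3, fun m' hm' => ?_⟩
  obtain h | rfl : m' < m ∨ m' = m := by omega
  · exact hQ _ _ _ h3 (h2 m' h)
  · exact h4

/-- A loop that fills consecutive cells of an array. -/
theorem Cmd.rep_fill {p : Cmd} {x a : ℕ} {s : Store} (base : ℕ) (f : ℕ → ℕ) {n : ℕ}
    (hn : s.reg 0 = n)
    (step : ∀ m < n, ∀ s', s.AgreeOff (x :: p.regs) p.arrs s' → s'.reg x = m →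
      (∀ j, (∀ m' < m, j ≠ base + m') → s'.arr a j = s.arr a j) →
      (p.run s').arr a = Function.update (s'.arr a) (base + m) (f m)) :
    (∀ m < n, ((Cmd.rep x 1 p).run s).arr a (base + m) = f m) ∧
      ∀ j, (∀ m < n, j ≠ base + m) → ((Cmd.rep x 1 p).run s).arr a j = s.arr a j := by
  refine Cmd.rep_induct (I := fun m s' => (∀ m' < m, s'.arr a (base + m') = f m') ∧
    ∀ j, (∀ m' < m, j ≠ base + m') → s'.arr a j = s.arr a j) (by simpa using hn)
    (fun _ _ _ h => h) ⟨by simp, by simp⟩ fun m hm s' hs' hx ⟨h1, h2⟩ => ?_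
  rw [step m hm s' hs' hx h2]
  refine ⟨fun m' hm' => ?_, fun j hj => ?_⟩
  · rw [Function.update_apply]
    split_ifs with h
    · rw [show m' = m by omega]
    · exact h1 m' (by omega)
  · rw [Function.update_of_ne (hj m (by omega))]
    exact h2 j fun m' hm' => hj m' (by omega)

/-- Linear search for the last value of register `x` below `n` that satisfies the condition `b`. -/
def Cmd.search (r x : ℕ) (b : Expr) : Cmd :=
  .set r 0 ;; .rep x 1 (.ite b (.set r (V x)) .skip)

theorem Cmd.search_run {r x : ℕ} {b : Expr} {s : Store} {n : ℕ} (hn : s.reg 0 = n) (hr : r ≠ 0)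
    (hrx : r ≠ x) (P : ℕ → Prop) [DecidablePred P]
    (hb : ∀ m < n, ∀ s', s.AgreeOff [r, x] [] s' → s'.reg x = m → (b.eval s' ≠ 0 ↔ P m)) :
    s.AgreeOff [r, x] [] ((Cmd.search r x b).run s) ∧
      ((Cmd.search r x b).run s).reg r = lastSat P n := by
  refine ⟨?_, ?_⟩
  · have := (Cmd.search r x b).run_agreeOff s
    refine ⟨fun y hy => this.1 y fun h => hy ?_, fun a ha => this.2 a (by
      simp [Cmd.search, Cmd.arrs])⟩
    simp only [Cmd.search, Cmd.regs, List.mem_append, List.mem_cons, List.not_mem_nil,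
      or_false] at h ⊢
    tauto
  · refine Cmd.rep_induct (I := fun m s' => s'.reg r = lastSat P m) (s := (Cmd.set r 0).run s)
      (by simpa [hr.symm] using hn) (fun m s' y h => ?_) (by simp [lastSat])
      fun m hm s' hs' hx h => ?_
    · simpa [hrx] using h
    · have hag : s.AgreeOff [r, x] [] s' := by
        refine ⟨fun y hy => ?_, fun a ha => ?_⟩
        · simp only [List.mem_cons, List.not_mem_nil, or_false, not_or] at hy
          rw [hs'.1 y (by simp [Cmd.regs, hy.1, hy.2])]
          simp [hy.1]
        · rw [hs'.2 a (by simp [Cmd.arrs])]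
          rfl
      rw [Cmd.run_ite_of _ (hb m hm s' hag hx), lastSat]
      split_ifs
      · simp [hx]
      · exact h

/-- Row-major addresses are unambiguous while columns stay below `n`; this separates writes to
different table entries. -/
theorem cell_inj {n i j u v : ℕ} (hu : u < n) (hv : v < n) :
    i * n + u = j * n + v ↔ i = j ∧ u = v := by
  constructor
  · intro h
    have key : ∀ i j u v : ℕ, v < n → i * n + u = j * n + v → i ≤ j := by
      intro i j u v hv h
      by_contra hlt
      have : (j + 1) * n ≤ i * n := Nat.mul_le_mul_right _ (by omega)
      rw [add_mul, one_mul] at this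
      omega
    have hij : i = j := le_antisymm (key i j u v hv h) (key j i v u hu h.symm)
    subst hij
    exact ⟨rfl, by omega⟩
  · rintro ⟨rfl, rfl⟩
    rfl

/-! ### Parameters and distances -/

/-- Registers `2`, `5`, `6`, `7` get the bit length `k` of `n`, the number `(a + 1) * k` of levels,
eight times this number, and the number `4 * k` of hierarchies. -/
def paramCmd (a : ℕ) : Cmd :=
  .set 2 0 ;; .set 3 1 ;;
  .rep 4 1 (.ite (V 3 <ₑ V 0 + 1) (.set 2 (V 2 + 1) ;; .set 3 (V 3 + V 3)) .skip) ;;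
  .set 5 (V 2 * .lit (a + 1)) ;; .set 6 (V 5 * 8) ;; .set 7 (V 2 * 4)

theorem paramCmd_run (a : ℕ) {s : Store} {n : ℕ} (hn : s.reg 0 = n) :
    ((paramCmd a).run s).arr = s.arr ∧ ((paramCmd a).run s).reg 0 = n ∧
      ((paramCmd a).run s).reg 1 = s.reg 1 ∧
      ((paramCmd a).run s).reg 2 = Nat.size n ∧
      ((paramCmd a).run s).reg 5 = Nat.size n * (a + 1) ∧
      ((paramCmd a).run s).reg 6 = Nat.size n * (a + 1) * 8 ∧
      ((paramCmd a).run s).reg 7 = Nat.size n * 4 := by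
  have hfr := (paramCmd a).run_agreeOff s
  simp only [paramCmd, Cmd.regs, Cmd.arrs] at hfr
  have key : ∀ s1 : Store, s1.reg 0 = n → s1.reg 2 = 0 → s1.reg 3 = 1 →
      ((Cmd.rep 4 1 (.ite (V 3 <ₑ V 0 + 1) (.set 2 (V 2 + 1) ;; .set 3 (V 3 + V 3))
        .skip)).run s1).reg 2 = Nat.size n := by
    intro s1 h0 h2 h3
    -- Register `3` is doubled until it exceeds `n`, which happens after `Nat.size n` steps; `n`
    -- rounds are enough for that.
    have := Cmd.rep_induct (p := .ite (V 3 <ₑ V 0 + 1) (.set 2 (V 2 + 1) ;; .set 3 (V 3 + V 3))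
      .skip) (x := 4) (k := 1) (s := s1) (N := n)
      (I := fun m s' => s'.reg 2 = min m (Nat.size n) ∧ s'.reg 3 = 2 ^ s'.reg 2)
      (by simpa using h0) (fun m s' y h => by simpa using h) (by simp [h2, h3])
      fun m hm s' hs' hx ⟨hI2, hI3⟩ => by
        have e0 : s'.reg 0 = n := (hs'.1 0 (by simp [Cmd.regs])).trans h0
        rw [Cmd.run_ite_of (P := s'.reg 2 < Nat.size n)]
        · split_ifs with hlt
          · simp only [Cmd.run_seq, Cmd.run_set, Store.setReg_reg]
            simp [hI3, pow_succ]
            omega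
          · rw [Cmd.run_skip]; exact ⟨by omega, hI3⟩
        · rw [Nat.lt_size]
          simp [e0, hI3]
    rw [this.1]
    exact min_eq_right (size_le_self n)
  have h2 := key ((s.setReg 2 0).setReg 3 1) (by simp [hn]) (by simp) (by simp)
  refine ⟨funext fun a => hfr.2 a (by simp), (hfr.1 0 (by simp)).trans hn, hfr.1 1 (by simp),
    ?_, ?_, ?_, ?_⟩ <;>
  simp [paramCmd, h2]

/-- Try to shorten the path from `u` to `v` by a path with first edge `ux`. -/
def relaxCmd : Cmd :=
  .set 13 (.arr 0 (V 9 * V 0 + V 12)) ;;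
  .set 14 (.arr 6 (((V 8 + 1) * V 0 + V 12) * V 0 + V 11)) ;;
  .set 15 (.arr 6 (((V 8 + 1) * V 0 + V 9) * V 0 + V 11)) ;;
  .set 16 (V 14 + (V 13 * V 1 + V 3)) ;;
  .ite ((0 <ₑ V 13) * (0 <ₑ V 14) * (0 <ₑ (V 15 =ₑ 0) + (V 16 <ₑ V 15)))
    (.put 6 (((V 8 + 1) * V 0 + V 9) * V 0 + V 11) (V 16)) .skip

/-- The distances at one level, by the algorithm of Bellman and Ford. -/
def levelDistCmd : Cmd :=
  .set 3 (V 3 + V 3) ;; .put 13 (V 8 + 1) (V 3) ;;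
  .rep 9 1 (.put 6 (((V 8 + 1) * V 0 + V 9) * V 0 + V 9) 1) ;;
  .rep 10 1 (.rep 9 1 (.rep 11 1 (.rep 12 1 relaxCmd)))

/-- The distances at all levels. -/
def distCmd (a : ℕ) : Cmd := .set 3 1 ;; .rep 8 (a + 1) levelDistCmd

/-- The distance table at level `i`. -/
def distTable (n : ℕ) (A : ℕ → ℕ → ℕ) (i u v : ℕ) : ℕ := A 6 ((i * n + u) * n + v)

/-! ### Correctness of the Bellman-Ford relaxations. -/

section Relax

variable {n : ℕ} {G : SimpleGraph (Fin n)} {w : Sym2 (Fin n) → ℕ} {h i : ℕ}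

/-- Tentative distances are lengths of walks. -/
def SoundDist (G : SimpleGraph (Fin n)) (w : Sym2 (Fin n) → ℕ) (h i : ℕ) (A : ℕ → ℕ → ℕ) : Prop :=
  ∀ u v : Fin n, distTable n A i u v ≠ 0 →
    ∃ p : G.Walk u v, (p.edges.map (levelLength w h i)).sum + 1 = distTable n A i u v

/-- Tentative distances at level `i` are improved, the other levels are left alone. -/
def Improves (G : SimpleGraph (Fin n)) (w : Sym2 (Fin n) → ℕ) (h i : ℕ) (A B : ℕ → ℕ → ℕ) : Prop :=
  (SoundDist G w h i A → SoundDist G w h i B) ∧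
  (∀ u v : Fin n, distTable n A i u v ≠ 0 →
    distTable n B i u v ≠ 0 ∧ distTable n B i u v ≤ distTable n A i u v) ∧
  ∀ i' ≠ i, ∀ u v : Fin n, distTable n B i' u v = distTable n A i' u v

theorem Improves.refl (A : ℕ → ℕ → ℕ) : Improves G w h i A A :=
  ⟨fun h => h, fun _ _ h => ⟨h, le_rfl⟩, fun _ _ _ _ => rfl⟩

theorem Improves.trans {A B C : ℕ → ℕ → ℕ} (h1 : Improves G w h i A B)
    (h2 : Improves G w h i B C) : Improves G w h i A C :=
  ⟨fun h => h2.1 (h1.1 h), fun u v hA => by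
    have hB := h1.2.1 u v hA
    have hC := h2.2.1 u v hB.1
    exact ⟨hC.1, hC.2.trans hB.2⟩, fun i' hi u v => (h2.2.2 i' hi u v).trans (h1.2.2 i' hi u v)⟩

theorem distTable_update {A : ℕ → ℕ → ℕ} {B : ℕ → ℕ → ℕ} {i i' c : ℕ} {u v u' v' : Fin n}
    (hB : B 6 = Function.update (A 6) ((i * n + u) * n + v) c) :
    distTable n B i' u' v' = if i' = i ∧ u' = u ∧ v' = v then c else distTable n A i' u' v' := by
  simp only [distTable, hB, Function.update_apply]
  refine if_congr ?_ rfl rfl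
  rw [cell_inj v'.2 v.2, cell_inj u'.2 u.2, and_assoc, Fin.val_inj, Fin.val_inj]

/-- A new entry is the length of the edge `ux` followed by a walk, so soundness persists. The
inequality for this edge holds after either branch: the update enforces it, and a failed test means
that it held already. -/
theorem relaxCmd_run (hw : ∀ e ∈ G.edgeSet, 1 ≤ w e) {s : Store} (hn : s.reg 0 = n)
    (hh : s.reg 1 = h) (hi : s.reg 8 + 1 = i)
    (hpw : s.reg 3 = 2 ^ i) (hW : s.arr 0 = weightMatrix G w) {u v x : Fin n} (hu : s.reg 9 = u)
    (hv : s.reg 11 = v) (hx : s.reg 12 = x) :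
    Improves G w h i s.arr (relaxCmd.run s).arr ∧
      (G.Adj u x → distTable n s.arr i x v ≠ 0 → distTable n (relaxCmd.run s).arr i u v ≠ 0 ∧
        distTable n (relaxCmd.run s).arr i u v ≤
          distTable n s.arr i x v + levelLength w h i s(u, x)) := by
  classical
  set W := weightMatrix G w (u * n + x) with hWdef
  set d := distTable n s.arr i x v with hd
  set d' := distTable n s.arr i u v with hd'
  have hWux := weightMatrix_apply G w u x
  rw [← hWdef] at hWux
  have hrun : (relaxCmd.run s).arr 6 = if 0 < W ∧ 0 < d ∧ (d' = 0 ∨ d + (W * h + 2 ^ i) < d') then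
      Function.update (s.arr 6) ((i * n + u) * n + v) (d + (W * h + 2 ^ i)) else s.arr 6 := by
    simp only [relaxCmd, Cmd.run_seq, Cmd.run_set]
    rw [Cmd.run_ite_of (P := 0 < W ∧ 0 < d ∧ (d' = 0 ∨ d + (W * h + 2 ^ i) < d'))]
    · split_ifs
      · simp [hn, hh, hi, hpw, hW, hu, hv, hx, hWdef, hd, distTable]
      · simp
    · simp only [Expr.mul_ne_zero, Expr.lt_ne_zero, Expr.eval_zero, pos_iff_ne_zero,
        Expr.add_ne_zero, Expr.eq_ne_zero, and_assoc]
      simp [hn, hh, hi, hpw, hW, hu, hv, hx, hWdef, hd, hd', distTable]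
  by_cases hc : 0 < W ∧ 0 < d ∧ (d' = 0 ∨ d + (W * h + 2 ^ i) < d')
  · rw [if_pos hc] at hrun
    have hadj : G.Adj u x := by
      by_contra hna
      rw [if_neg hna] at hWux
      omega
    rw [if_pos hadj] at hWux
    have hlen : W * h + 2 ^ i = levelLength w h i s(u, x) := by rw [hWux, levelLength, mul_comm]
    rw [hlen] at hrun hc
    refine ⟨⟨fun hs u' v' hne => ?_, fun u' v' hne => ?_, fun i' hi' u' v' => ?_⟩,
      fun _ _ => ?_⟩
    · rw [distTable_update hrun] at hne ⊢
      split_ifs at hne ⊢ with hcase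
      · obtain ⟨-, rfl, rfl⟩ := hcase
        obtain ⟨p, hp⟩ := hs x v' (by omega)
        exact ⟨.cons hadj p, by simp; omega⟩
      · exact hs u' v' hne
    · rw [distTable_update hrun]
      split_ifs with hcase
      · obtain ⟨-, rfl, rfl⟩ := hcase
        omega
      · exact ⟨hne, le_rfl⟩
    · rw [distTable_update hrun, if_neg (by tauto)]
    · rw [distTable_update hrun, if_pos ⟨rfl, rfl, rfl⟩]
      omega
  · rw [if_neg hc] at hrun
    have hsame : ∀ i' u' v', distTable n (relaxCmd.run s).arr i' u' v' =
      distTable n s.arr i' u' v' := fun i' u' v' => by simp only [distTable, hrun]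
    refine ⟨⟨fun hs u' v' => by rw [hsame]; exact hs u' v', fun u' v' hne => by
      rw [hsame]; exact ⟨hne, le_rfl⟩, fun i' _ u' v' => hsame i' u' v'⟩, fun hadj hne => ?_⟩
    rw [if_pos hadj] at hWux
    have hlen : W * h + 2 ^ i = levelLength w h i s(u, x) := by rw [hWux, levelLength, mul_comm]
    rw [hlen] at hc
    rw [hsame, ← hd']
    have hW1 : 1 ≤ w s(u, x) := hw s(u, x) hadj
    omega

/-- Bypassing only deletes edges; therefore walks with fewer than `n` edges determine the distances.
-/
theorem sum_edges_bypass_le (f : Sym2 (Fin n) → ℕ) {u v : Fin n} (p : G.Walk u v) :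
    (p.bypass.edges.map f).sum ≤ (p.edges.map f).sum := by
  induction p with
  | nil => simp [SimpleGraph.Walk.bypass]
  | @cons u x v hux p ih =>
    simp only [SimpleGraph.Walk.bypass]
    split_ifs with hs
    · have := congrArg (fun q => (q.edges.map f).sum) (p.bypass.take_spec hs)
      simp only [SimpleGraph.Walk.edges_append, List.map_append, List.sum_append] at this
      simp only [SimpleGraph.Walk.edges_cons, List.map_cons, List.sum_cons]
      omega
    · simp only [SimpleGraph.Walk.edges_cons, List.map_cons, List.sum_cons]
      omega

/-- A round of relaxations. -/
theorem relaxRound_run (hw : ∀ e ∈ G.edgeSet, 1 ≤ w e) {s : Store} (hn : s.reg 0 = n)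
    (hh : s.reg 1 = h) (hi : s.reg 8 + 1 = i) (hpw : s.reg 3 = 2 ^ i)
    (hW : s.arr 0 = weightMatrix G w) :
    let B := ((Cmd.rep 9 1 (.rep 11 1 (.rep 12 1 relaxCmd))).run s).arr
    Improves G w h i s.arr B ∧ ∀ u v x : Fin n, G.Adj u x → distTable n s.arr i x v ≠ 0 →
      distTable n B i u v ≠ 0 ∧
        distTable n B i u v ≤ distTable n s.arr i x v + levelLength w h i s(u, x) := by
  let Q : Fin n → Fin n → Fin n → (ℕ → ℕ → ℕ) → Prop := fun u v x B =>
    G.Adj u x → distTable n s.arr i x v ≠ 0 → distTable n B i u v ≠ 0 ∧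
      distTable n B i u v ≤ distTable n s.arr i x v + levelLength w h i s(u, x)
  have hQ : ∀ u v x A B, Improves G w h i A B → Q u v x A → Q u v x B := by
    intro u v x A B hAB hA hadj hne
    have h1 := hA hadj hne
    have h2 := hAB.2.1 u v h1.1
    exact ⟨h2.1, h2.2.trans h1.2⟩
  have main := Cmd.rep_mono (p := .rep 11 1 (.rep 12 1 relaxCmd)) (x := 9) (k := 1) (s := s)
    (N := n) (Improves G w h i) (fun m B => ∀ hm : m < n, ∀ v x, Q ⟨m, hm⟩ v x B)
    (by simpa using hn) Improves.refl (fun _ _ _ => Improves.trans)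
    (fun m A B hAB hA hm v x => hQ _ _ _ _ _ hAB (hA hm v x))
  have main := main fun m hm s1 hs1 hx1 hR1 => by
    have := Cmd.rep_mono (p := .rep 12 1 relaxCmd) (x := 11) (k := 1) (s := s1)
      (N := n) (Improves G w h i) (fun m' B => ∀ hm' : m' < n, ∀ x, Q ⟨m, hm⟩ ⟨m', hm'⟩ x B)
      (by simpa [hs1.1 0 (by simp [Cmd.regs, relaxCmd])] using hn)
      Improves.refl (fun _ _ _ => Improves.trans)
      (fun m' A B hAB hA hm' x => hQ _ _ _ _ _ hAB (hA hm' x)) fun m' hm' s2 hs2 hx2 hR2 => by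
        have := Cmd.rep_mono (p := relaxCmd) (x := 12) (k := 1) (s := s2)
          (N := n) (Improves G w h i)
          (fun m'' B => ∀ hm'' : m'' < n, Q ⟨m, hm⟩ ⟨m', hm'⟩ ⟨m'', hm''⟩ B)
          (by simpa [hs2.1 0 (by simp [Cmd.regs, relaxCmd]),
            hs1.1 0 (by simp [Cmd.regs, relaxCmd])] using hn)
          Improves.refl (fun _ _ _ => Improves.trans)
          (fun m'' A B hAB hA hm'' => hQ _ _ _ _ _ hAB (hA hm'')) fun m'' hm'' s3 hs3 hx3 hR3 => by
            have hreg : ∀ y, y ∉ [9, 11, 12, 13, 14, 15, 16] → s3.reg y = s.reg y := by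
              intro y hy
              simp only [List.mem_cons, List.not_mem_nil, or_false, not_or] at hy
              rw [hs3.1 y (by simp [Cmd.regs, relaxCmd, hy]),
                hs2.1 y (by simp [Cmd.regs, relaxCmd, hy]),
                hs1.1 y (by simp [Cmd.regs, relaxCmd, hy])]
            have harr : s3.arr 0 = s.arr 0 := by
              rw [hs3.2 0 (by simp [Cmd.arrs, relaxCmd]), hs2.2 0 (by simp [Cmd.arrs, relaxCmd]),
                hs1.2 0 (by simp [Cmd.arrs, relaxCmd])]
            have hr := relaxCmd_run (i := i) hw ((hreg 0 (by simp)).trans hn)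
              ((hreg 1 (by simp)).trans hh) (by rw [hreg 8 (by simp), hi])
              ((hreg 3 (by simp)).trans hpw) (harr.trans hW) (u := ⟨m, hm⟩) (v := ⟨m', hm'⟩)
              (x := ⟨m'', hm''⟩)
              (by rw [hs3.1 9 (by simp [Cmd.regs, relaxCmd]),
                hs2.1 9 (by simp [Cmd.regs, relaxCmd]), hx1])
              (by rw [hs3.1 11 (by simp [Cmd.regs, relaxCmd]), hx2]) hx3
            refine ⟨hr.1, fun _ hadj hne => ?_⟩
            -- Earlier relaxations of the round may have lowered the entry of the pair from `x`
            -- already; the goal uses its value before the round, which is no smaller.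
            have h3 := ((hR1.trans hR2).trans hR3).2.1 _ _ hne
            have h4 := hr.2 hadj h3.1
            exact ⟨h4.1, h4.2.trans (Nat.add_le_add_right h3.2 _)⟩
        exact ⟨this.1, fun hm' x => this.2 x x.2 x.2⟩
    exact ⟨this.1, fun hm v x => this.2 v v.2 v.2 x⟩
  exact ⟨main.1, fun u v x => main.2 u u.2 u.2 v x⟩

/-- After `m` rounds the table is below the length of every walk with at most `m` edges, and `n`
rounds suffice because a bypassed walk has fewer than `n` edges. -/
theorem levelDistCmd_run (hw : ∀ e ∈ G.edgeSet, 1 ≤ w e) {s : Store} (hn : s.reg 0 = n)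
    (hh : s.reg 1 = h) (hi : s.reg 8 + 1 = i) (hpw : s.reg 3 + s.reg 3 = 2 ^ i)
    (hW : s.arr 0 = weightMatrix G w) (h0 : ∀ u v : Fin n, distTable n s.arr i u v = 0) :
    let s' := levelDistCmd.run s
    IsDist G (levelLength w h i) (distTable n s'.arr i) ∧ s'.reg 3 = 2 ^ i ∧
      s'.arr 13 = Function.update (s.arr 13) i (2 ^ i) ∧
      ∀ i' ≠ i, ∀ u v : Fin n, distTable n s'.arr i' u v = distTable n s.arr i' u v := by
  let s1 := (Cmd.set 3 (V 3 + V 3) ;; .put 13 (V 8 + 1) (V 3)).run s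
  let p2 := Cmd.rep 9 1 (.put 6 (((V 8 + 1) * V 0 + V 9) * V 0 + V 9) 1)
  let p3 := Cmd.rep 10 1 (Cmd.rep 9 1 (.rep 11 1 (.rep 12 1 relaxCmd)))
  let s2 := p2.run s1
  have hf2 : s1.AgreeOff [9] [6] s2 := p2.run_agreeOff s1
  have hf3 : s2.AgreeOff [10, 9, 11, 12, 13, 14, 15, 16] [6] (p3.run s2) := p3.run_agreeOff s2
  have e1 : ∀ i' u' v', distTable n s1.arr i' u' v' = distTable n s.arr i' u' v' := by
    intro i' u' v'; simp [s1, distTable]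
  have hdiag : (∀ u v : Fin n, distTable n s2.arr i u v = if u = v then 1 else 0) ∧
      ∀ i' ≠ i, ∀ u v : Fin n, distTable n s2.arr i' u v = distTable n s.arr i' u v := by
    have := Cmd.rep_induct (p := .put 6 (((V 8 + 1) * V 0 + V 9) * V 0 + V 9) 1) (x := 9) (k := 1)
      (s := s1) (N := n) (I := fun m s' =>
        (∀ u v : Fin n, distTable n s'.arr i u v = if u = v ∧ u < m then 1 else 0) ∧
        ∀ i' ≠ i, ∀ u v : Fin n, distTable n s'.arr i' u v = distTable n s.arr i' u v)
      (by simpa [s1] using hn) (fun _ _ _ h => h) ⟨by simp [e1, h0], by simp [e1]⟩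
      fun m hm s' hs' hx ⟨hI1, hI2⟩ => by
        have a0 : s'.reg 0 = n := (hs'.1 0 (by simp [Cmd.regs])).trans (by simpa [s1] using hn)
        have a8 : s'.reg 8 + 1 = i := by
          rw [hs'.1 8 (by simp [Cmd.regs])]; simpa [s1] using hi
        have hu : ((Cmd.put 6 (((V 8 + 1) * V 0 + V 9) * V 0 + V 9) 1).run s').arr 6 =
            Function.update (s'.arr 6) ((i * n + (⟨m, hm⟩ : Fin n)) * n + (⟨m, hm⟩ : Fin n)) 1 := by
          simp [a0, a8, hx]
        refine ⟨fun u v => ?_, fun i' hi' u v => ?_⟩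
        · rw [distTable_update hu, hI1]
          by_cases huv : u = v
          · subst huv
            by_cases hum : u = ⟨m, hm⟩
            · simp [hum]
            · have : (u : ℕ) ≠ m := fun hc => hum (Fin.ext hc)
              simp only [hum, and_self, and_false, if_false, true_and]
              exact if_congr (by omega) rfl rfl
          · rw [if_neg, if_neg (by tauto), if_neg (by tauto)]
            rintro ⟨-, rfl, rfl⟩
            exact huv rfl
        · rw [distTable_update hu, if_neg (by tauto)]
          exact hI2 i' hi' u v
    exact ⟨fun u v => by rw [this.1]; simp, this.2⟩
  have g0 : s2.reg 0 = n := (hf2.1 0 (by simp)).trans (by simpa [s1] using hn)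
  have g1 : s2.reg 1 = h := (hf2.1 1 (by simp)).trans (by simpa [s1] using hh)
  have g3 : s2.reg 3 = 2 ^ i := (hf2.1 3 (by simp)).trans (by simpa [s1] using hpw)
  have g8 : s2.reg 8 + 1 = i := by rw [hf2.1 8 (by simp)]; simpa [s1] using hi
  have gW : s2.arr 0 = weightMatrix G w := (hf2.2 0 (by simp)).trans (by simpa [s1] using hW)
  have hround := Cmd.rep_induct (p := Cmd.rep 9 1 (.rep 11 1 (.rep 12 1 relaxCmd))) (x := 10)
    (k := 1) (s := s2) (N := n) (I := fun m s' => Improves G w h i s2.arr s'.arr ∧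
      ∀ u v : Fin n, ∀ p : G.Walk u v, p.length ≤ m → distTable n s'.arr i u v ≠ 0 ∧
        distTable n s'.arr i u v ≤ (p.edges.map (levelLength w h i)).sum + 1)
    (by simpa using g0) (fun _ _ _ h => h) ⟨.refl _, fun u v p hp => by
      cases p with
      | nil => simp [hdiag.1]
      | cons _ _ => simp at hp⟩
    fun m hm s' hs' hx ⟨hI1, hI2⟩ => by
      have hreg : ∀ y, y ∉ [9, 10, 11, 12, 13, 14, 15, 16] → s'.reg y = s2.reg y := by
        intro y hy
        simp only [List.mem_cons, List.not_mem_nil, or_false, not_or] at hy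
        exact hs'.1 y (by simp [Cmd.regs, relaxCmd, hy])
      have hr := relaxRound_run (i := i) hw ((hreg 0 (by simp)).trans g0)
        ((hreg 1 (by simp)).trans g1) (by rw [hreg 8 (by simp), g8])
        ((hreg 3 (by simp)).trans g3) ((hs'.2 0 (by simp [Cmd.arrs, relaxCmd])).trans gW)
      refine ⟨hI1.trans hr.1, fun u v p hp => ?_⟩
      cases p with
      | nil =>
        have h1 := hI2 u u .nil (by simp)
        have h2 := hr.1.2.1 u u h1.1
        exact ⟨h2.1, h2.2.trans h1.2⟩
      | @cons _ x _ hux q =>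
        have h1 := hI2 x v q (by simpa using hp)
        have h2 := hr.2 u v x hux h1.1
        refine ⟨h2.1, h2.2.trans ?_⟩
        simp only [SimpleGraph.Walk.edges_cons, List.map_cons, List.sum_cons]
        omega
  have hrun : levelDistCmd.run s = p3.run s2 := rfl
  rw [hrun]
  refine ⟨fun u v => ⟨hround.1.1 (fun u v hne => ?_) u v, fun p => ?_⟩,
    (hf3.1 3 (by simp)).trans g3, ?_, fun i' hi' u v => ?_⟩
  · rw [hdiag.1] at hne ⊢
    split_ifs at hne ⊢ with huv
    · subst huv; exact ⟨.nil, by simp⟩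
    · exact absurd rfl hne
  · have hlt : p.bypass.length < n := by simpa using p.bypass_isPath.length_lt
    have := hround.2 u v p.bypass hlt.le
    have h2 := sum_edges_bypass_le (levelLength w h i) p
    exact ⟨this.1, this.2.trans (by omega)⟩
  · rw [hf3.2 13 (by simp), hf2.2 13 (by simp)]
    simp [s1, hi, hpw]
  · rw [hround.1.2.2 i' hi' u v, hdiag.2 i' hi' u v]

/-- Loop lengths are multiples of `n`, so tables are computed for `(a + 1) * n` levels, of which
only the first `L` are used. -/
theorem distCmd_run (a : ℕ) (hw : ∀ e ∈ G.edgeSet, 1 ≤ w e) {s : Store} (hn : s.reg 0 = n)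
    (hh : s.reg 1 = h) (hW : s.arr 0 = weightMatrix G w) (h0 : s.arr 6 = 0) :
    ∀ i, 1 ≤ i → i ≤ (a + 1) * n →
      IsDist G (levelLength w h i) (distTable n ((distCmd a).run s).arr i) ∧
        ((distCmd a).run s).arr 13 i = 2 ^ i := by
  have := Cmd.rep_induct (p := levelDistCmd) (x := 8) (k := a + 1) (s := (Cmd.set 3 1).run s)
    (N := (a + 1) * n) (I := fun m s' => s'.reg 3 = 2 ^ m ∧
      (∀ i, 1 ≤ i → i ≤ m → IsDist G (levelLength w h i) (distTable n s'.arr i) ∧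
        s'.arr 13 i = 2 ^ i) ∧
      ∀ i, m < i → ∀ u v : Fin n, distTable n s'.arr i u v = 0)
    (by simp [hn]) (fun m s' y h => by simpa using h)
    ⟨by simp, fun i h1 h2 => by omega, fun i _ u v => by simp [distTable, h0]⟩
    fun m hm s' hs' hx ⟨hI1, hI2, hI3⟩ => by
      have hregs : ∀ y, y < 2 → s'.reg y = s.reg y := by
        intro y hy
        rw [hs'.1 y]
        · have h8 : y ≠ 8 := by omega
          have h3 : y ≠ 3 := by omega
          simp [h3]
        · interval_cases y <;> simp [levelDistCmd, relaxCmd, Cmd.regs]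
      have hr := levelDistCmd_run (i := m + 1) hw ((hregs 0 (by omega)).trans hn)
        ((hregs 1 (by omega)).trans hh) (by rw [hx]) (by rw [hI1, pow_succ]; ring)
        ((hs'.2 0 (by simp [levelDistCmd, relaxCmd, Cmd.arrs])).trans hW) (hI3 (m + 1) (by omega))
      refine ⟨hr.2.1, fun i h1 h2 => ?_, fun i hi u v => ?_⟩
      · obtain rfl | hne := eq_or_ne i (m + 1)
        · exact ⟨hr.1, by rw [hr.2.2.1]; simp⟩
        · have h3 := hI2 i h1 (by omega)
          refine ⟨fun u v => ?_, by rw [hr.2.2.1, Function.update_of_ne hne]; exact h3.2⟩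
          rw [hr.2.2.2 i hne u v]
          exact h3.1 u v
      · rw [hr.2.2.2 i (by omega) u v]
        exact hI3 i (by omega) u v
  exact this.2.1

end Relax

/-! ### Region growing -/

/-- The mass of the free vertices at distance at most `r`, where `d` holds the distances from the
center and `x` vanishes at the free vertices. -/
def ballMass (n : ℕ) (d x μ : ℕ → ℕ) (r : ℕ) : ℕ :=
  ∑ v ∈ (Finset.range n).filter (fun v => x v = 0 ∧ 0 < d v ∧ d v ≤ r), μ v

/-- The state of region growing with padding `4 * U` and radii at most `R` after the centers below
`m`: `x` assigns clusters and `z` marks vertices near cluster boundaries. -/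
structure RegionInv (n : ℕ) (d : ℕ → ℕ → ℕ) (μ : ℕ → ℕ) (q U R m : ℕ) (x z : ℕ → ℕ) : Prop where
  center : ∀ v : Fin n, x v ≠ 0 → ∃ c : Fin n, x v = c + 1 ∧ d c v ≠ 0 ∧ d c v ≤ R + 1
  covered : ∀ c < m, x c ≠ 0
  mass : q * ∑ v ∈ (Finset.range n).filter (fun v => z v ≠ 0), μ v ≤
    ∑ v ∈ (Finset.range n).filter (fun v => x v ≠ 0), μ v
  padded : ∀ v u : Fin n, x v ≠ 0 → z v = 0 → d v u ≠ 0 → d v u ≤ 4 * U + 1 → x u = x v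
  far : ∀ v u : Fin n, x v = 0 → z v = 0 → x u ≠ 0 → d v u ≠ 0 → 4 * U + 1 < d v u

theorem sum_union_le {ι : Type*} [DecidableEq ι] (s t : Finset ι) (f : ι → ℕ) :
    ∑ i ∈ s ∪ t, f i ≤ ∑ i ∈ s, f i + ∑ i ∈ t, f i := by
  rw [← Finset.sum_union_inter]
  exact Nat.le_add_right _ _

section Region

variable {n : ℕ} {G : SimpleGraph (Fin n)} {f : Sym2 (Fin n) → ℕ} {d : ℕ → ℕ → ℕ} {μ : ℕ → ℕ}
  {q U R m : ℕ} {x z : ℕ → ℕ}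

theorem RegionInv.zero (hx : ∀ v < n, x v = 0) (hz : ∀ v < n, z v = 0) :
    RegionInv n d μ q U R 0 x z where
  center v hv := absurd (hx v v.2) hv
  covered c hc := absurd hc (by omega)
  mass := by
    rw [Finset.filter_false_of_mem fun v hv => by simp [hz v (Finset.mem_range.1 hv)]]
    simp
  padded v u hv := absurd (hx v v.2) hv
  far v u _ _ hu := absurd (hx u u.2) hu

theorem RegionInv.skip (hI : RegionInv n d μ q U R m x z) (hm : x m ≠ 0) :
    RegionInv n d μ q U R (m + 1) x z :=
  { hI with
    covered := fun c hc => by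
      obtain h | rfl : c < m ∨ c = m := by omega
      · exact hI.covered c h
      · exact hm }

/-- Cutting out a ball around the center `c`. -/
theorem RegionInv.step (hd : IsDist G f d) (hI : RegionInv n d μ q U R m x z) (hm : m < n)
    {r : ℕ} (hr : 1 ≤ r) (hrR : r + 4 * U ≤ R + 1) (hxm : x m = 0)
    (hmass : q * (ballMass n (d m) x μ (r + 8 * U) - ballMass n (d m) x μ r) ≤
      ballMass n (d m) x μ r) {x' z' : ℕ → ℕ}
    (hx' : ∀ v < n, x' v = if x v = 0 ∧ 0 < d m v ∧ d m v ≤ r + 4 * U then m + 1 else x v)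
    (hz' : ∀ v < n, z' v = if x v = 0 ∧ r < d m v ∧ d m v ≤ r + 8 * U then 1 else z v) :
    RegionInv n d μ q U R (m + 1) x' z' where
  center v hv := by
    rw [hx' v v.2] at hv ⊢
    split_ifs at hv ⊢ with hc
    · exact ⟨⟨m, hm⟩, rfl, by simpa using by omega, by simpa using by omega⟩
    · exact hI.center v hv
  covered c hc := by
    have hcn : c < n := by omega
    rw [hx' c hcn]
    split_ifs with hcase
    · omega
    · obtain h | rfl : c < m ∨ c = m := by omega
      · exact hI.covered c h
      · have := hd.self ⟨c, hm⟩
        simp only at this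
        exact fun _ => hcase ⟨hxm, by omega, by omega⟩
  mass := by
    classical
    -- New marks appear only in the shell of free vertices beyond `r` and up to `r + 8 * U`, whose
    -- mass is the difference of two ball masses.
    have h1 : ∑ v ∈ (Finset.range n).filter (fun v => z' v ≠ 0), μ v ≤
        ∑ v ∈ (Finset.range n).filter (fun v => z v ≠ 0), μ v +
          (ballMass n (d m) x μ (r + 8 * U) - ballMass n (d m) x μ r) := by
      have h2 : ballMass n (d m) x μ (r + 8 * U) - ballMass n (d m) x μ r =
          ∑ v ∈ (Finset.range n).filter (fun v => x v = 0 ∧ r < d m v ∧ d m v ≤ r + 8 * U),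
            μ v := by
        unfold ballMass
        rw [Nat.sub_eq_iff_eq_add (Finset.sum_le_sum_of_subset fun v hv => by
          simp only [Finset.mem_filter] at hv ⊢
          exact ⟨hv.1, hv.2.1, hv.2.2.1, by omega⟩), ← Finset.sum_union]
        · refine Finset.sum_congr ?_ fun _ _ => rfl
          ext v
          simp only [Finset.mem_filter, Finset.mem_union, Finset.mem_range]
          constructor
          · rintro ⟨h1, h2, h3, h4⟩
            by_cases h5 : d m v ≤ r
            · exact .inr ⟨h1, h2, h3, h5⟩
            · exact .inl ⟨h1, h2, by omega, h4⟩
          · rintro (⟨h1, h2, h3, h4⟩ | ⟨h1, h2, h3, h4⟩) <;> exact ⟨h1, h2, by omega, by omega⟩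
        · rw [Finset.disjoint_filter]
          intro v _ h1 h2
          omega
      rw [h2]
      refine le_trans (Finset.sum_le_sum_of_subset ?_) (sum_union_le
        ((Finset.range n).filter fun v => z v ≠ 0)
        ((Finset.range n).filter fun v => x v = 0 ∧ r < d m v ∧ d m v ≤ r + 8 * U) μ)
      intro v hv
      simp only [Finset.mem_filter, Finset.mem_union] at hv ⊢
      rw [hz' v (Finset.mem_range.1 hv.1)] at hv
      split_ifs at hv with hc
      · exact .inr ⟨hv.1, hc⟩
      · exact .inl hv
    -- The inner ball consists of newly assigned vertices, so its mass is available to pay for the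
    -- new marks.
    have h3 : ∑ v ∈ (Finset.range n).filter (fun v => x v ≠ 0), μ v + ballMass n (d m) x μ r ≤
        ∑ v ∈ (Finset.range n).filter (fun v => x' v ≠ 0), μ v := by
      unfold ballMass
      rw [← Finset.sum_union]
      · refine Finset.sum_le_sum_of_subset fun v hv => ?_
        simp only [Finset.mem_filter, Finset.mem_union] at hv ⊢
        refine ⟨by tauto, ?_⟩
        rw [hx' v (Finset.mem_range.1 (by tauto))]
        split_ifs with hc
        · omega
        · rcases hv with hv | hv
          · exact hv.2
          · exact absurd ⟨hv.2.1, hv.2.2.1, by omega⟩ hc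
      · rw [Finset.disjoint_filter]
        intro v _ h1 h2
        exact h1 h2.1
    calc _ ≤ q * (∑ v ∈ (Finset.range n).filter (fun v => z v ≠ 0), μ v +
          (ballMass n (d m) x μ (r + 8 * U) - ballMass n (d m) x μ r)) := Nat.mul_le_mul_left _ h1
      _ ≤ _ := by
        rw [mul_add]
        exact (Nat.add_le_add hI.mass hmass).trans h3
  padded v u hv hz hvu hle := by
    rw [hz' v v.2] at hz
    rw [hx' v v.2] at hv
    rw [hx' u u.2, hx' v v.2]
    split_ifs at hz with hzc
    -- A newly assigned vertex without a mark lies within `r` of the center, so its free neighbours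
    -- within `4 * U` lie in the same cluster; by `far` no vertex assigned earlier is that close.
    by_cases hv0 : x v = 0
    · have hvc : x v = 0 ∧ 0 < d m v ∧ d m v ≤ r + 4 * U := by
        by_contra hc
        rw [if_neg hc] at hv
        exact hv hv0
      rw [if_pos hvc]
      have hu0 : x u = 0 := by
        by_contra hu0
        have := hI.far v u hv0 hz hu0 hvu
        omega
      have hvr : d m v ≤ r := by
        by_contra hc
        exact hzc ⟨hv0, by omega, by omega⟩
      have htri := hd.triangle (u := ⟨m, hm⟩) (v := v) (x := u) (by simpa using by omega) hvu
      simp only at htri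
      rw [if_pos ⟨hu0, by omega, by omega⟩]
    · have hu := hI.padded v u hv0 hz hvu hle
      rw [if_neg (by rw [hu]; tauto), if_neg (by tauto), hu]
  far v u hv hz hu hvu := by
    rw [hz' v v.2] at hz
    rw [hx' v v.2] at hv
    rw [hx' u u.2] at hu
    split_ifs at hz hv with hzc hvc
    by_contra hle
    split_ifs at hu with huc
    -- If `u` is new and `v` is free within `4 * U` of it, then `v` lies outside the cluster but
    -- within `r + 8 * U`, hence in the marked shell.
    · have huv : d u v ≠ 0 := by rw [hd.symm]; exact hvu
      have hsym := hd.symm u v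
      have htri := hd.triangle (u := ⟨m, hm⟩) (v := u) (x := v) (by simpa using by omega) huv
      simp only at htri
      have h1 : ¬ d m v ≤ r + 4 * U := fun hc => hvc ⟨hv, by omega, hc⟩
      exact hzc ⟨hv, by omega, by omega⟩
    · exact hle (hI.far v u hv hz hu hvu)

theorem RegionInv.diam (hd : IsDist G f d) (hI : RegionInv n d μ q U R m x z) {u v : Fin n}
    (hu : x u ≠ 0) (huv : x u = x v) : d u v ≠ 0 ∧ d u v ≤ 2 * R + 1 := by
  obtain ⟨c, hc, hcu, hcuR⟩ := hI.center u hu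
  obtain ⟨c', hc', hcv, hcvR⟩ := hI.center v (huv ▸ hu)
  obtain rfl : c = c' := Fin.ext (by omega)
  have hs := hd.symm u c
  have := hd.triangle (u := u) (v := c) (x := v) (by omega) hcv
  exact ⟨this.1, by omega⟩

/-- A growing ball that does not yet meet the stopping condition grows by a constant factor. -/
theorem ballMass_grow {d x μ : ℕ → ℕ} {q r r' k : ℕ} (hq : 1 ≤ q) (hrr : r ≤ r')
    (hk : (q + 1) ^ k ≤ q ^ k * ballMass n d x μ r)
    (hcard : k + 1 ≤
      ((Finset.range n).filter fun v => x v = 0 ∧ 0 < d v ∧ d v ≤ r).card)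
    (hlt : ballMass n d x μ r / q < ballMass n d x μ r' - ballMass n d x μ r) :
    (q + 1) ^ (k + 1) ≤ q ^ (k + 1) * ballMass n d x μ r' ∧
      k + 2 ≤ ((Finset.range n).filter fun v => x v = 0 ∧ 0 < d v ∧ d v ≤ r').card := by
  -- The test of the program divides by `q`, since `q` is not a factor that `Expr.small` admits.
  rw [Nat.div_lt_iff_lt_mul (by omega)] at hlt
  constructor
  · have h1 : (q + 1) * ballMass n d x μ r ≤ q * ballMass n d x μ r' := by
      rw [Nat.sub_mul] at hlt
      rw [add_mul, one_mul, mul_comm q, mul_comm q]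
      omega
    calc (q + 1) ^ (k + 1) = (q + 1) * (q + 1) ^ k := by ring
      _ ≤ (q + 1) * (q ^ k * ballMass n d x μ r) := Nat.mul_le_mul_left _ hk
      _ = q ^ k * ((q + 1) * ballMass n d x μ r) := by ring
      _ ≤ q ^ k * (q * ballMass n d x μ r') := Nat.mul_le_mul_left _ h1
      _ = _ := by ring
  -- A heavier ball has more vertices, which limits the number of growth steps by `n` whatever the
  -- masses are.
  · have hsub : ((Finset.range n).filter fun v => x v = 0 ∧ 0 < d v ∧ d v ≤ r) ⊆
        (Finset.range n).filter fun v => x v = 0 ∧ 0 < d v ∧ d v ≤ r' := fun v hv => by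
      simp only [Finset.mem_filter] at hv ⊢
      exact ⟨hv.1, hv.2.1, hv.2.2.1, by omega⟩
    have hne : ((Finset.range n).filter fun v => x v = 0 ∧ 0 < d v ∧ d v ≤ r) ≠
        (Finset.range n).filter fun v => x v = 0 ∧ 0 < d v ∧ d v ≤ r' := by
      intro heq
      have : ballMass n d x μ r = ballMass n d x μ r' := by unfold ballMass; rw [heq]
      rw [this] at hlt
      simp at hlt
    have := Finset.card_lt_card (Finset.ssubset_iff_subset_ne.2 ⟨hsub, hne⟩)
    omega

end Region

/-- The cell of the current vertex in the row of the current level. -/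
abbrev levelCell : Expr := (V 8 + 1) * V 0 + V 11

/-- The distance from the current center to the current vertex. -/
abbrev centerDist : Expr := .arr 6 (((V 8 + 1) * V 0 + V 19) * V 0 + V 11)

/-- Add the mass of the current vertex to the masses of the balls that contain it. -/
def sumCmd : Cmd :=
  .set 14 centerDist ;;
  .ite ((.arr 7 levelCell =ₑ 0) * (0 <ₑ V 14) * (V 14 <ₑ V 20 + 1))
    (.set 21 (V 21 + .arr 9 (V 11))) .skip ;;
  .ite ((.arr 7 levelCell =ₑ 0) * (0 <ₑ V 14) * (V 14 <ₑ V 20 + V 18 * 8 + 1))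
    (.set 22 (V 22 + .arr 9 (V 11))) .skip

/-- Increase the radius if the next shell is heavy. -/
def growCmd : Cmd :=
  .set 21 0 ;; .set 22 0 ;; .rep 11 1 sumCmd ;;
  .ite (V 21 / V 6 <ₑ V 22 - V 21) (.set 20 (V 20 + V 18 * 8)) .skip

/-- Mark the current vertex if it is near the boundary of the ball. -/
def markCmd : Cmd :=
  .set 14 centerDist ;;
  .ite ((.arr 7 levelCell =ₑ 0) * (V 20 <ₑ V 14) * (V 14 <ₑ V 20 + V 18 * 8 + 1))
    (.put 11 levelCell 1) .skip

/-- Put the current vertex into the cluster if it lies in the ball. -/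
def assignCmd : Cmd :=
  .set 14 centerDist ;;
  .ite ((.arr 7 levelCell =ₑ 0) * (0 <ₑ V 14) * (V 14 <ₑ V 20 + V 18 * 4 + 1))
    (.put 7 levelCell (V 19 + 1)) .skip

/-- Cut out a ball around the current vertex if it is free. -/
def centerCmd : Cmd :=
  .ite (.arr 7 ((V 8 + 1) * V 0 + V 19) =ₑ 0)
    (.set 20 1 ;; .rep 10 1 growCmd ;; .rep 11 1 markCmd ;; .rep 11 1 assignCmd) .skip

/-- The partition at one level; the masses of the marked vertices are doubled. -/
def regionCmd : Cmd :=
  .set 18 (.arr 13 (V 8 + 1) * V 1) ;; .rep 11 1 (.put 7 levelCell 0) ;;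
  .rep 11 1 (.put 11 levelCell 0) ;; .rep 19 1 centerCmd ;;
  .rep 11 1 (.ite (0 <ₑ .arr 11 levelCell) (.put 9 (V 11) (.arr 9 (V 11) + .arr 9 (V 11))) .skip) ;;
  .rep 11 1 (.ite (0 <ₑ .arr 11 levelCell) (.put 10 (V 11) 1) .skip)

theorem ballMass_succ (n : ℕ) (d x μ : ℕ → ℕ) (r : ℕ) : ballMass (n + 1) d x μ r =
    ballMass n d x μ r + if x n = 0 ∧ 0 < d n ∧ d n ≤ r then μ n else 0 := by
  simp only [ballMass, Finset.sum_filter, Finset.sum_range_succ]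

/-! ### The region growing program maintains the combinatorial invariant. -/

section RegionRun

variable {n i c U q : ℕ} {s : Store}

theorem sumCmd_run {r : ℕ} (hn : s.reg 0 = n) (hi : s.reg 8 + 1 = i) (hU : s.reg 18 = U)
    (hc : s.reg 19 = c) (hr : s.reg 20 = r) (h21 : s.reg 21 = 0) (h22 : s.reg 22 = 0) :
    ((Cmd.rep 11 1 sumCmd).run s).reg 21 =
        ballMass n (distTable n s.arr i c) (fun v => s.arr 7 (i * n + v)) (s.arr 9) r ∧
      ((Cmd.rep 11 1 sumCmd).run s).reg 22 =
        ballMass n (distTable n s.arr i c) (fun v => s.arr 7 (i * n + v)) (s.arr 9)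
          (r + 8 * U) := by
  refine Cmd.rep_induct (I := fun m s' => s'.reg 21 =
        ballMass m (distTable n s.arr i c) (fun v => s.arr 7 (i * n + v)) (s.arr 9) r ∧
      s'.reg 22 = ballMass m (distTable n s.arr i c) (fun v => s.arr 7 (i * n + v)) (s.arr 9)
          (r + 8 * U)) (by simpa using hn) (fun m s' y h => by simpa using h)
    (by simp [ballMass, h21, h22]) fun m hm s' hs' hx ⟨h1, h2⟩ => ?_
  have hreg : ∀ y, y ∉ [11, 14, 21, 22] → s'.reg y = s.reg y := fun y hy =>
    hs'.1 y (by simpa [sumCmd, Cmd.regs] using hy)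
  have harr : s'.arr = s.arr := funext fun a => hs'.2 a (by simp [sumCmd, Cmd.arrs])
  have e0 := (hreg 0 (by simp)).trans hn
  have e8 : s'.reg 8 + 1 = i := by rw [hreg 8 (by simp), hi]
  have e18 := (hreg 18 (by simp)).trans hU
  have e19 := (hreg 19 (by simp)).trans hc
  have e20 := (hreg 20 (by simp)).trans hr
  rw [ballMass_succ, ballMass_succ]
  simp only [sumCmd, Cmd.run_seq, Cmd.run_set]
  rw [Cmd.run_ite_of (P := s.arr 7 (i * n + m) = 0 ∧ 0 < distTable n s.arr i c m ∧
    distTable n s.arr i c m ≤ r + 8 * U)]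
  · rw [Cmd.run_ite_of (P := s.arr 7 (i * n + m) = 0 ∧ 0 < distTable n s.arr i c m ∧
      distTable n s.arr i c m ≤ r)]
    · split_ifs <;> simp [h1, h2, harr, hx]
    · simp only [Expr.mul_ne_zero, Expr.lt_ne_zero, Expr.eq_ne_zero, and_assoc]
      simp [distTable, harr, e0, e8, e19, e20, hx]
  · simp only [Expr.mul_ne_zero, Expr.lt_ne_zero, Expr.eq_ne_zero, and_assoc, Cmd.run_ite]
    split_ifs <;> simp [distTable, harr, e0, e8, e18, e19, e20, hx, mul_comm U]

/-- The radii are `8 * U * k + 1`, as stored distances are increased by one. The ball gains a vertex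
whenever it grows, so the test holds after `n` rounds, and once it holds the radius stays fixed. The
power inequality is kept as well: through the total mass it gives the much better bound on `k` that
the diameter needs. -/
theorem growCmd_run {G : SimpleGraph (Fin n)} {f : Sym2 (Fin n) → ℕ} (hn : s.reg 0 = n)
    (hi : s.reg 8 + 1 = i) (hU : s.reg 18 = U) (hq : s.reg 6 = q) (hq1 : 1 ≤ q)
    (hc : s.reg 19 = c) (hcn : c < n) (hr : s.reg 20 = 1)
    (hd : IsDist G f (distTable n s.arr i)) (hxc : s.arr 7 (i * n + c) = 0)
    (hμ : 1 ≤ s.arr 9 c) :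
    let B := ballMass n (distTable n s.arr i c) (fun v => s.arr 7 (i * n + v)) (s.arr 9)
    ∃ k, ((Cmd.rep 10 1 growCmd).run s).reg 20 = 8 * U * k + 1 ∧
      (q + 1) ^ k ≤ q ^ k * B (8 * U * k + 1) ∧
      q * (B (8 * U * k + 1 + 8 * U) - B (8 * U * k + 1)) ≤ B (8 * U * k + 1) := by
  intro B
  let S : ℕ → Finset ℕ := fun r => (Finset.range n).filter fun v =>
    s.arr 7 (i * n + v) = 0 ∧ 0 < distTable n s.arr i c v ∧ distTable n s.arr i c v ≤ r
  have hcS : c ∈ S 1 := by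
    have := hd.self ⟨c, hcn⟩
    simp only at this
    simp [S, hcn, hxc, this]
  have := Cmd.rep_induct (p := growCmd) (x := 10) (k := 1) (s := s) (N := n)
    (I := fun m s' => ∃ k, s'.reg 20 = 8 * U * k + 1 ∧
      (q + 1) ^ k ≤ q ^ k * B (8 * U * k + 1) ∧ k + 1 ≤ (S (8 * U * k + 1)).card ∧
      (q * (B (8 * U * k + 1 + 8 * U) - B (8 * U * k + 1)) ≤ B (8 * U * k + 1) ∨ k = m))
    (by simpa using hn) (fun m s' y h => by simpa using h)
    ⟨0, by simpa using hr, by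
      have h1 : s.arr 9 c ≤ B 1 := Finset.single_le_sum (f := s.arr 9)
        (fun _ _ => Nat.zero_le _) hcS
      simpa using hμ.trans h1, by simpa using Finset.card_pos.2 ⟨c, hcS⟩, .inr rfl⟩
    fun m hm s' hs' hx ⟨k, h1, h2, h3, h4⟩ => by
      have hreg : ∀ y, y ∉ [10, 11, 14, 20, 21, 22] → s'.reg y = s.reg y := fun y hy =>
        hs'.1 y (by
          simp only [List.mem_cons, List.not_mem_nil, or_false, not_or] at hy
          simp [growCmd, sumCmd, Cmd.regs, hy])
      have harr : s'.arr = s.arr :=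
        funext fun a => hs'.2 a (by simp [growCmd, sumCmd, Cmd.arrs])
      let s1 := (Cmd.set 21 0 ;; .set 22 0).run s'
      have hsum := sumCmd_run (s := s1) (n := n) (i := i) (U := U) (c := c) (r := 8 * U * k + 1)
        (by simp [s1, hreg, hn]) (by simp [s1, hreg, hi]) (by simp [s1, hreg, hU])
        (by simp [s1, hreg, hc]) (by simp [s1, h1]) (by simp [s1]) (by simp [s1])
      rw [show s1.arr = s.arr from harr] at hsum
      have hfr := (Cmd.rep 11 1 sumCmd).run_agreeOff s1
      simp only [sumCmd, Cmd.regs, Cmd.arrs] at hfr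
      have e6 : ((Cmd.rep 11 1 sumCmd).run s1).reg 6 = q := by
        rw [sumCmd, hfr.1 6 (by simp)]; simp [s1, hreg, hq]
      have e18 : ((Cmd.rep 11 1 sumCmd).run s1).reg 18 = U := by
        rw [sumCmd, hfr.1 18 (by simp)]; simp [s1, hreg, hU]
      have e20 : ((Cmd.rep 11 1 sumCmd).run s1).reg 20 = 8 * U * k + 1 := by
        rw [sumCmd, hfr.1 20 (by simp)]; simp [s1, h1]
      have hrun : growCmd.run s' = if B (8 * U * k + 1) / q <
          B (8 * U * k + 1 + 8 * U) - B (8 * U * k + 1) then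
          ((Cmd.rep 11 1 sumCmd).run s1).setReg 20 (8 * U * (k + 1) + 1)
          else (Cmd.rep 11 1 sumCmd).run s1 := by
        have : growCmd.run s' = (Cmd.ite (V 21 / V 6 <ₑ V 22 - V 21)
          (.set 20 (V 20 + V 18 * 8)) .skip).run ((Cmd.rep 11 1 sumCmd).run s1) := rfl
        rw [this, Cmd.run_ite_of (P := B (8 * U * k + 1) / q <
          B (8 * U * k + 1 + 8 * U) - B (8 * U * k + 1))]
        · split_ifs
          · rw [Cmd.run_set]
            congr 1
            simp [e18, e20]
            ring
          · rfl
        · rw [Expr.lt_ne_zero]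
          simp [hsum, e6, B]
      rw [hrun]
      split_ifs with hlt
      · have hg := ballMass_grow hq1 (Nat.le_add_right _ (8 * U)) h2 h3 hlt
        rw [show 8 * U * k + 1 + 8 * U = 8 * U * (k + 1) + 1 by ring] at hg
        refine ⟨k + 1, by simp, hg.1, hg.2, .inr ?_⟩
        rcases h4 with h4 | h4
        · exfalso
          rw [Nat.div_lt_iff_lt_mul (by omega)] at hlt
          exact (hlt.trans_eq (Nat.mul_comm _ _)).not_ge h4
        · omega
      · refine ⟨k, e20, h2, h3, .inl ?_⟩
        rw [not_lt, Nat.le_div_iff_mul_le (by omega)] at hlt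
        exact (Nat.mul_comm _ _).trans_le hlt
  obtain ⟨k, h1, h2, h3, h4⟩ := this
  refine ⟨k, h1, h2, h4.resolve_right fun hk => ?_⟩
  have : (S (8 * U * k + 1)).card ≤ n := (Finset.card_filter_le _ _).trans (by simp)
  omega

theorem markCmd_run {r : ℕ} (hn : s.reg 0 = n) (hi : s.reg 8 + 1 = i) (hU : s.reg 18 = U)
    (hc : s.reg 19 = c) (hr : s.reg 20 = r) :
    let s' := (Cmd.rep 11 1 markCmd).run s
    (∀ v < n, s'.arr 11 (i * n + v) = if s.arr 7 (i * n + v) = 0 ∧ r < distTable n s.arr i c v ∧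
      distTable n s.arr i c v ≤ r + 8 * U then 1 else s.arr 11 (i * n + v)) ∧
    ∀ j, (∀ v < n, j ≠ i * n + v) → s'.arr 11 j = s.arr 11 j := by
  refine Cmd.rep_fill (i * n) _ hn fun m hm s' hs' hx hj => ?_
  have hreg : ∀ y, y ∉ [11, 14] → s'.reg y = s.reg y := fun y hy =>
    hs'.1 y (by simpa [markCmd, Cmd.regs] using hy)
  have harr : ∀ a ≠ 11, s'.arr a = s.arr a := fun a ha => hs'.2 a (by simpa [markCmd, Cmd.arrs])
  simp only [markCmd, Cmd.run_seq, Cmd.run_set]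
  rw [Cmd.run_ite_of (P := s.arr 7 (i * n + m) = 0 ∧ r < distTable n s.arr i c m ∧
    distTable n s.arr i c m ≤ r + 8 * U)]
  · split_ifs
    · simp [hreg, hn, hi, hx]
    · rw [← hj _ fun m' hm' => by omega, Function.update_eq_self]; rfl
  · simp only [Expr.mul_ne_zero, Expr.lt_ne_zero, Expr.eq_ne_zero, and_assoc]
    simp [distTable, harr, hreg, hn, hi, hU, hc, hr, hx, mul_comm U]

theorem assignCmd_run {r : ℕ} (hn : s.reg 0 = n) (hi : s.reg 8 + 1 = i) (hU : s.reg 18 = U)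
    (hc : s.reg 19 = c) (hr : s.reg 20 = r) :
    let s' := (Cmd.rep 11 1 assignCmd).run s
    (∀ v < n, s'.arr 7 (i * n + v) = if s.arr 7 (i * n + v) = 0 ∧ 0 < distTable n s.arr i c v ∧
      distTable n s.arr i c v ≤ r + 4 * U then c + 1 else s.arr 7 (i * n + v)) ∧
    ∀ j, (∀ v < n, j ≠ i * n + v) → s'.arr 7 j = s.arr 7 j := by
  refine Cmd.rep_fill (i * n) _ hn fun m hm s' hs' hx hj => ?_
  have hreg : ∀ y, y ∉ [11, 14] → s'.reg y = s.reg y := fun y hy =>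
    hs'.1 y (by simpa [assignCmd, Cmd.regs] using hy)
  have harr : ∀ a ≠ 7, s'.arr a = s.arr a := fun a ha => hs'.2 a (by simpa [assignCmd, Cmd.arrs])
  have e7 := hj (i * n + m) fun m' hm' => by omega
  simp only [assignCmd, Cmd.run_seq, Cmd.run_set]
  rw [Cmd.run_ite_of (P := s.arr 7 (i * n + m) = 0 ∧ 0 < distTable n s.arr i c m ∧
    distTable n s.arr i c m ≤ r + 4 * U)]
  · split_ifs
    · simp [hreg, hn, hi, hc, hx]
    · rw [← e7, Function.update_eq_self]; rfl
  · simp only [Expr.mul_ne_zero, Expr.lt_ne_zero, Expr.eq_ne_zero, and_assoc]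
    simp [distTable, harr, hreg, hn, hi, e7, hU, hc, hr, hx, mul_comm U]

/-- The mass of the ball is at most the total, so `hK` gives `k ≤ K` and the cluster radius fits
into `8 * U * K + 4 * U`. Marking precedes assignment because both refer to the vertices that are
free beforehand. -/
theorem centerCmd_run {G : SimpleGraph (Fin n)} {f : Sym2 (Fin n) → ℕ} {K m : ℕ}
    (hn : s.reg 0 = n) (hi : s.reg 8 + 1 = i) (hU : s.reg 18 = U) (hq : s.reg 6 = q) (hq1 : 1 ≤ q)
    (hc : s.reg 19 = m) (hm : m < n) (hd : IsDist G f (distTable n s.arr i))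
    (hμ : ∀ v < n, 1 ≤ s.arr 9 v)
    (hK : ∀ k, (q + 1) ^ k ≤ q ^ k * ∑ v ∈ Finset.range n, s.arr 9 v → k ≤ K)
    (hI : RegionInv n (distTable n s.arr i) (s.arr 9) q U (8 * U * K + 4 * U) m
      (fun v => s.arr 7 (i * n + v)) (fun v => s.arr 11 (i * n + v))) :
    let s' := centerCmd.run s
    RegionInv n (distTable n s.arr i) (s.arr 9) q U (8 * U * K + 4 * U) (m + 1)
      (fun v => s'.arr 7 (i * n + v)) (fun v => s'.arr 11 (i * n + v)) ∧
    (∀ j, (∀ v < n, j ≠ i * n + v) → s'.arr 7 j = s.arr 7 j) ∧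
    ∀ j, (∀ v < n, j ≠ i * n + v) → s'.arr 11 j = s.arr 11 j := by
  intro s'
  have hs' : s' = if s.arr 7 (i * n + m) = 0 then (Cmd.set 20 1 ;; .rep 10 1 growCmd ;;
      .rep 11 1 markCmd ;; .rep 11 1 assignCmd).run s else s := by
    rw [show s' = centerCmd.run s from rfl, centerCmd,
      Cmd.run_ite_of (P := s.arr 7 (i * n + m) = 0)]
    · rfl
    · rw [Expr.eq_ne_zero]; simp [hn, hi, hc]
  split_ifs at hs' with hx
  swap
  · rw [hs']
    exact ⟨hI.skip hx, fun _ _ => rfl, fun _ _ => rfl⟩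
  let s1 := (Cmd.set 20 1).run s
  let s2 := (Cmd.rep 10 1 growCmd).run s1
  let s3 := (Cmd.rep 11 1 markCmd).run s2
  have hf2 : s1.AgreeOff (Cmd.rep 10 1 growCmd).regs _ s2 := (Cmd.rep 10 1 growCmd).run_agreeOff s1
  have hf3 : s2.AgreeOff (Cmd.rep 11 1 markCmd).regs _ s3 := (Cmd.rep 11 1 markCmd).run_agreeOff s2
  have hr2 : ∀ y, y ∉ [10, 11, 14, 20, 21, 22] → s2.reg y = s.reg y := fun y hy => by
    simp only [List.mem_cons, List.not_mem_nil, or_false, not_or] at hy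
    rw [hf2.1 y (by simp [growCmd, sumCmd, Cmd.regs, hy])]
    simp [s1, hy]
  have hr3 : ∀ y, y ∉ [11, 14] → s3.reg y = s2.reg y := fun y hy =>
    hf3.1 y (by simpa [markCmd, Cmd.regs] using hy)
  have ha2 : s2.arr = s.arr := funext fun a => hf2.2 a (by simp [growCmd, sumCmd, Cmd.arrs])
  have ha3 : ∀ a ≠ 11, s3.arr a = s.arr a := fun a ha => by
    rw [hf3.2 a (by simpa [markCmd, Cmd.arrs] using ha), ha2]
  have hg : ∃ k, s2.reg 20 = 8 * U * k + 1 ∧ _ := growCmd_run (s := s1) (n := n) (i := i) (U := U)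
    (q := q) (c := m) (G := G) (f := f) (by simp [s1, hn]) (by simp [s1, hi]) (by simp [s1, hU])
    (by simp [s1, hq]) hq1 (by simp [s1, hc]) hm (by simp [s1]) hd hx (hμ m hm)
  obtain ⟨k, hg1, hg2, hg3⟩ := hg
  rw [show s1.arr = s.arr from rfl] at hg2 hg3
  have hkK : k ≤ K := hK k (hg2.trans (Nat.mul_le_mul_left _
    (Finset.sum_le_sum_of_subset (Finset.filter_subset _ _))))
  have hmk := markCmd_run (s := s2) (n := n) (i := i) (U := U) (c := m) (by simp [hr2, hn])
    (by simp [hr2, hi]) (by simp [hr2, hU]) (by simp [hr2, hc]) hg1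
  rw [ha2] at hmk
  have has := assignCmd_run (s := s3) (n := n) (i := i) (U := U) (c := m) (by simp [hr3, hr2, hn])
    (by simp [hr3, hr2, hi]) (by simp [hr3, hr2, hU]) (by simp [hr3, hr2, hc])
    ((hr3 20 (by simp)).trans hg1)
  have hd3 : distTable n s3.arr i m = distTable n s.arr i m := by
    funext v; simp [distTable, ha3]
  rw [hd3, ha3 7 (by simp)] at has
  have he : s' = (Cmd.rep 11 1 assignCmd).run s3 := hs'
  have h11 : s'.arr 11 = s3.arr 11 := by
    rw [he]
    exact ((Cmd.rep 11 1 assignCmd).run_agreeOff s3).2 11 (by simp [assignCmd, Cmd.arrs])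
  rw [h11, he]
  refine ⟨hI.step hd hm (r := 8 * U * k + 1) (by omega) ?_ hx hg3 has.1 hmk.1, has.2, hmk.2⟩
  have : 8 * U * k ≤ 8 * U * K := Nat.mul_le_mul_left _ hkK
  omega

/-- Masses are doubled only after all balls are cut out, so the bound on the marked mass refers to
the old masses. The diameter is twice the radius bound, `2 * (8 * U * K + 4 * U)` with `U = 2 ^ i *
h`. -/
theorem regionCmd_run {G : SimpleGraph (Fin n)} {f : Sym2 (Fin n) → ℕ} {K h : ℕ}
    (hn : s.reg 0 = n) (hh : s.reg 1 = h) (hi : s.reg 8 + 1 = i) (hq : s.reg 6 = q) (hq1 : 1 ≤ q)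
    (hpw : s.arr 13 i = 2 ^ i) (hd : IsDist G f (distTable n s.arr i))
    (hμ : ∀ v < n, 1 ≤ s.arr 9 v)
    (hK : ∀ k, (q + 1) ^ k ≤ q ^ k * ∑ v ∈ Finset.range n, s.arr 9 v → k ≤ K) :
    let s' := regionCmd.run s
    (∀ u v : Fin n, s'.arr 7 (i * n + u) = s'.arr 7 (i * n + v) → distTable n s.arr i u v ≠ 0 ∧
      distTable n s.arr i u v ≤ (16 * K + 8) * (2 ^ i * h) + 1) ∧
    (∀ u v : Fin n, s'.arr 11 (i * n + u) = 0 → distTable n s.arr i u v ≠ 0 →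
      distTable n s.arr i u v ≤ 4 * (2 ^ i * h) + 1 →
      s'.arr 7 (i * n + u) = s'.arr 7 (i * n + v)) ∧
    (∀ v < n, s'.arr 9 v = if s'.arr 11 (i * n + v) ≠ 0 then s.arr 9 v + s.arr 9 v
      else s.arr 9 v) ∧
    (∀ v < n, s'.arr 10 v = if s'.arr 11 (i * n + v) ≠ 0 then 1 else s.arr 10 v) ∧
    q * ∑ v ∈ (Finset.range n).filter (fun v => s'.arr 11 (i * n + v) ≠ 0), s.arr 9 v ≤
      ∑ v ∈ Finset.range n, s.arr 9 v ∧
    (∀ j, (∀ v < n, j ≠ i * n + v) → s'.arr 7 j = s.arr 7 j) ∧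
    ∀ j, (∀ v < n, j ≠ i * n + v) → s'.arr 11 j = s.arr 11 j := by
  intro s'
  set U := 2 ^ i * h with hUdef
  let s1 := (Cmd.set 18 (.arr 13 (V 8 + 1) * V 1)).run s
  let p2 := Cmd.rep 11 1 (.put 7 levelCell 0)
  let p3 := Cmd.rep 11 1 (.put 11 levelCell 0)
  let p5 := Cmd.rep 11 1 (.ite (0 <ₑ .arr 11 levelCell)
    (.put 9 (V 11) (.arr 9 (V 11) + .arr 9 (V 11))) .skip)
  let p6 := Cmd.rep 11 1 (.ite (0 <ₑ .arr 11 levelCell) (.put 10 (V 11) 1) .skip)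
  let s2 := p2.run s1
  let s3 := p3.run s2
  let s4 := (Cmd.rep 19 1 centerCmd).run s3
  let s5 := p5.run s4
  have hf2 : s1.AgreeOff [11] [7] s2 := p2.run_agreeOff s1
  have hf3 : s2.AgreeOff [11] [11] s3 := p3.run_agreeOff s2
  have hf4 : s3.AgreeOff (Cmd.rep 19 1 centerCmd).regs _ s4 := Cmd.run_agreeOff _ s3
  have hf5 : s4.AgreeOff [11] [9] s5 := p5.run_agreeOff s4
  have hf6 : s5.AgreeOff [11] [10] s' := p6.run_agreeOff s5
  have hr3 : ∀ y, y ∉ [11, 18] → s3.reg y = s.reg y := fun y hy => by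
    simp only [List.mem_cons, List.not_mem_nil, or_false, not_or] at hy
    rw [hf3.1 y (by simp [hy]), hf2.1 y (by simp [hy])]
    simp [s1, hy]
  have hr4 : ∀ y, y ∉ [10, 11, 14, 19, 20, 21, 22] → s4.reg y = s3.reg y := fun y hy => by
    simp only [List.mem_cons, List.not_mem_nil, or_false, not_or] at hy
    exact hf4.1 y (by simp [centerCmd, growCmd, sumCmd, markCmd, assignCmd, Cmd.regs, hy])
  have ha3 : ∀ a, a ∉ [7, 11] → s3.arr a = s.arr a := fun a ha => by
    simp only [List.mem_cons, List.not_mem_nil, or_false, not_or] at ha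
    rw [hf3.2 a (by simp [ha]), hf2.2 a (by simp [ha])]
    rfl
  have ha4 : ∀ a, a ∉ [7, 11] → s4.arr a = s3.arr a := fun a ha => by
    simp only [List.mem_cons, List.not_mem_nil, or_false, not_or] at ha
    exact hf4.2 a (by simp [centerCmd, growCmd, sumCmd, markCmd, assignCmd, Cmd.arrs, ha])
  have hd3 : distTable n s3.arr i = distTable n s.arr i := by
    funext u v; simp [distTable, ha3]
  have e18 : s3.reg 18 = U := by
    rw [hf3.1 18 (by simp), hf2.1 18 (by simp)]
    simp [s1, hi, hpw, hh, hUdef]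
  have c2 := Cmd.rep_fill (p := .put 7 levelCell 0) (x := 11) (a := 7) (s := s1) (i * n)
    (fun _ => 0) (n := n) (by simp [s1, hn]) fun m hm t ht hx _ => by
      have e0 : t.reg 0 = n := (ht.1 0 (by simp [Cmd.regs])).trans (by simp [s1, hn])
      have e8 : t.reg 8 + 1 = i := by rw [ht.1 8 (by simp [Cmd.regs])]; simp [s1, hi]
      simp [e0, e8, hx]
  have c3 := Cmd.rep_fill (p := .put 11 levelCell 0) (x := 11) (a := 11) (s := s2) (i * n)
    (fun _ => 0) (n := n) (by rw [hf2.1 0 (by simp)]; simp [s1, hn]) fun m hm t ht hx _ => by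
      have e0 : t.reg 0 = n := (ht.1 0 (by simp [Cmd.regs])).trans
        (by rw [hf2.1 0 (by simp)]; simp [s1, hn])
      have e8 : t.reg 8 + 1 = i := by
        rw [ht.1 8 (by simp [Cmd.regs]), hf2.1 8 (by simp)]; simp [s1, hi]
      simp [e0, e8, hx]
  have c4 := Cmd.rep_induct (p := centerCmd) (x := 19) (k := 1) (s := s3) (N := n)
    (I := fun m t => RegionInv n (distTable n s.arr i) (s.arr 9) q U (8 * U * K + 4 * U) m
        (fun v => t.arr 7 (i * n + v)) (fun v => t.arr 11 (i * n + v)) ∧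
      (∀ j, (∀ v < n, j ≠ i * n + v) → t.arr 7 j = s.arr 7 j) ∧
      ∀ j, (∀ v < n, j ≠ i * n + v) → t.arr 11 j = s.arr 11 j)
    (by simp [hr3, hn]) (fun _ _ _ h => h)
    ⟨.zero (fun v hv => by rw [hf3.2 7 (by simp)]; exact c2.1 v hv) c3.1,
      fun j hj => by rw [hf3.2 7 (by simp)]; exact c2.2 j hj,
      fun j hj => (c3.2 j hj).trans (by rw [hf2.2 11 (by simp)]; rfl)⟩
    fun m hm t ht hx ⟨hI, hI7, hI11⟩ => by
      have hreg : ∀ y, y ∉ [10, 11, 14, 19, 20, 21, 22] → t.reg y = s3.reg y := fun y hy => by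
        simp only [List.mem_cons, List.not_mem_nil, or_false, not_or] at hy
        exact ht.1 y (by simp [centerCmd, growCmd, sumCmd, markCmd, assignCmd, Cmd.regs, hy])
      have harr : ∀ a, a ∉ [7, 11] → t.arr a = s.arr a := fun a ha => by
        rw [← ha3 a ha]
        simp only [List.mem_cons, List.not_mem_nil, or_false, not_or] at ha
        exact ht.2 a (by simp [centerCmd, growCmd, sumCmd, markCmd, assignCmd, Cmd.arrs, ha])
      have hdt : distTable n t.arr i = distTable n s.arr i := by
        funext u v; simp [distTable, harr]
      have := centerCmd_run (s := t) (n := n) (i := i) (U := U) (q := q) (G := G) (f := f) (K := K)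
        (m := m) (by simp [hreg, hr3, hn]) (by simp [hreg, hr3, hi]) (by simp [hreg, e18])
        (by simp [hreg, hr3, hq]) hq1 hx hm (by rw [hdt]; exact hd)
        (by rw [harr 9 (by simp)]; exact hμ) (by rw [harr 9 (by simp)]; exact hK)
        (by rw [hdt, harr 9 (by simp)]; exact hI)
      rw [hdt, harr 9 (by simp)] at this
      exact ⟨this.1, fun j hj => (this.2.1 j hj).trans (hI7 j hj),
        fun j hj => (this.2.2 j hj).trans (hI11 j hj)⟩
  obtain ⟨hI, c7, c11⟩ := c4
  have g0 : s4.reg 0 = n := by simp [hr4, hr3, hn]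
  have g8 : s4.reg 8 + 1 = i := by simp [hr4, hr3, hi]
  have c5 := Cmd.rep_fill (p := .ite (0 <ₑ .arr 11 levelCell)
      (.put 9 (V 11) (.arr 9 (V 11) + .arr 9 (V 11))) .skip) (x := 11) (a := 9) (s := s4) 0
    (fun v => if s4.arr 11 (i * n + v) ≠ 0 then s.arr 9 v + s.arr 9 v else s.arr 9 v) (n := n)
    g0 fun m hm t ht hx hj => by
      have e0 : t.reg 0 = n := (ht.1 0 (by simp [Cmd.regs])).trans g0
      have e8 : t.reg 8 + 1 = i := by rw [ht.1 8 (by simp [Cmd.regs]), g8]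
      have e11 : t.arr 11 = s4.arr 11 := ht.2 11 (by simp [Cmd.arrs])
      have e9 : t.arr 9 m = s.arr 9 m := by
        rw [hj m fun m' hm' => by omega, ha4 9 (by simp), ha3 9 (by simp)]
      rw [Cmd.run_ite_of (P := s4.arr 11 (i * n + m) ≠ 0)]
      · split_ifs
        · simp [hx, e9]
        · rw [← e9, zero_add, Function.update_eq_self]; rfl
      · rw [Expr.lt_ne_zero, ← pos_iff_ne_zero]; simp [e0, e8, hx, e11]
  have c6 := Cmd.rep_fill (p := .ite (0 <ₑ .arr 11 levelCell) (.put 10 (V 11) 1) .skip) (x := 11)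
    (a := 10) (s := s5) 0 (fun v => if s4.arr 11 (i * n + v) ≠ 0 then 1 else s.arr 10 v) (n := n)
    ((hf5.1 0 (by simp)).trans g0) fun m hm t ht hx hj => by
      have e0 : t.reg 0 = n := by rw [ht.1 0 (by simp [Cmd.regs]), hf5.1 0 (by simp), g0]
      have e8 : t.reg 8 + 1 = i := by rw [ht.1 8 (by simp [Cmd.regs]), hf5.1 8 (by simp), g8]
      have e11 : t.arr 11 = s4.arr 11 := (ht.2 11 (by simp [Cmd.arrs])).trans (hf5.2 11 (by simp))
      have e10 : t.arr 10 m = s.arr 10 m := by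
        rw [hj m fun m' hm' => by omega, hf5.2 10 (by simp), ha4 10 (by simp), ha3 10 (by simp)]
      rw [Cmd.run_ite_of (P := s4.arr 11 (i * n + m) ≠ 0)]
      · split_ifs
        · simp [hx]
        · rw [← e10, zero_add, Function.update_eq_self]; rfl
      · rw [Expr.lt_ne_zero, ← pos_iff_ne_zero]; simp [e0, e8, hx, e11]
  have e7 : s'.arr 7 = s4.arr 7 := (hf6.2 7 (by simp)).trans (hf5.2 7 (by simp))
  have e11 : s'.arr 11 = s4.arr 11 := (hf6.2 11 (by simp)).trans (hf5.2 11 (by simp))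
  have e9 : s'.arr 9 = s5.arr 9 := hf6.2 9 (by simp)
  rw [e7, e11, e9]
  refine ⟨fun u v huv => ?_, fun u v hu huv hle => ?_, fun v hv => by have := c5.1 v hv; rwa [zero_add] at this,
    fun v hv => by have := c6.1 v hv; rwa [zero_add] at this, ?_, c7, c11⟩
  · have := hI.diam hd (hI.covered u u.2) huv
    refine ⟨this.1, this.2.trans (le_of_eq ?_)⟩
    ring
  · exact (hI.padded u v (hI.covered u u.2) hu huv hle).symm
  · exact hI.mass.trans (Finset.sum_le_sum_of_subset (Finset.filter_subset _ _))

end RegionRun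

/-! ### Hierarchies -/

/-- The representatives of the clusters at the level in register `23`. -/
def repRowCmd : Cmd :=
  .rep 11 1 (.search 27 12
      ((0 <ₑ (V 5 <ₑ V 23 + 1) +
        (.arr 8 ((V 23 + 1) * V 0 + V 12) =ₑ .arr 8 ((V 23 + 1) * V 0 + V 11))) *
      (.arr 7 (V 23 * V 0 + V 12) =ₑ .arr 7 (V 23 * V 0 + V 11))) ;;
    .put 8 (V 23 * V 0 + V 11) (V 27))

/-- The representatives at all levels, from the top level down. -/
def repCmd (a : ℕ) : Cmd :=
  .rep 8 (a + 2) (.ite (V 8 <ₑ V 5 + 1) (.set 23 (V 5 - V 8) ;; repRowCmd) .skip)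

/-- One hierarchy. -/
def hierarchyCmd (a : ℕ) : Cmd :=
  .rep 9 1 (.put 10 (V 9) 0) ;; .rep 8 (a + 1) (.ite (V 8 <ₑ V 5) regionCmd .skip) ;;
  .rep 9 1 (.put 7 (V 9) (V 9)) ;; repCmd a

/-- The rows of a table with `n` columns. -/
def rows (n : ℕ) (A : ℕ → ℕ) (i v : ℕ) : ℕ := A (i * n + v)

theorem repRowCmd_run {n L j : ℕ} {s : Store} (hn : s.reg 0 = n) (hL : s.reg 5 = L)
    (hj : s.reg 23 = j) :
    let s' := repRowCmd.run s
    (∀ v < n, rows n (s'.arr 8) j v = lastSat (fun u =>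
      (j < L → rows n (s.arr 8) (j + 1) u = rows n (s.arr 8) (j + 1) v) ∧
        rows n (s.arr 7) j u = rows n (s.arr 7) j v) n) ∧
    ∀ i, (∀ v < n, i ≠ j * n + v) → s'.arr 8 i = s.arr 8 i := by
  refine Cmd.rep_fill (j * n) _ hn fun m hm s' hs' hx hi => ?_
  have hreg : ∀ y, y ∉ [11, 12, 27] → s'.reg y = s.reg y := fun y hy => by
    simp only [List.mem_cons, List.not_mem_nil, or_false, not_or] at hy
    exact hs'.1 y (by simp [Cmd.search, Cmd.regs, hy])
  have ha7 : s'.arr 7 = s.arr 7 := hs'.2 7 (by simp [Cmd.search, Cmd.arrs])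
  have hrow : ∀ v < n, s'.arr 8 ((j + 1) * n + v) = s.arr 8 ((j + 1) * n + v) := fun v hv =>
    hi _ fun m' hm' => by
      rw [Ne, cell_inj hv (by omega)]; omega
  rw [Cmd.run_seq]
  obtain ⟨h1, h2⟩ := Cmd.search_run (r := 27) (x := 12)
    (b := (0 <ₑ (V 5 <ₑ V 23 + 1) +
        (.arr 8 ((V 23 + 1) * V 0 + V 12) =ₑ .arr 8 ((V 23 + 1) * V 0 + V 11))) *
      (.arr 7 (V 23 * V 0 + V 12) =ₑ .arr 7 (V 23 * V 0 + V 11))) (s := s') (n := n)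
    ((hreg 0 (by simp)).trans hn) (by simp) (by simp)
    (fun u => (j < L → rows n (s.arr 8) (j + 1) u = rows n (s.arr 8) (j + 1) m) ∧
        rows n (s.arr 7) j u = rows n (s.arr 7) j m) fun u hu t ht hxt => by
      have hregt : ∀ y, y ∉ [11, 12, 27] → t.reg y = s.reg y := fun y hy => by
        rw [← hreg y hy]
        simp only [List.mem_cons, List.not_mem_nil, or_false, not_or] at hy
        exact ht.1 y (by simp [hy])
      have e11 : t.reg 11 = m := (ht.1 11 (by simp)).trans hx
      have e7 : t.arr 7 = s.arr 7 := (ht.2 7 (by simp)).trans ha7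
      have e8 : t.arr 8 = s'.arr 8 := ht.2 8 (by simp)
      simp only [Expr.mul_ne_zero, Expr.lt_ne_zero, Expr.eq_ne_zero, Expr.eval_zero,
        pos_iff_ne_zero, Expr.add_ne_zero]
      simp only [Expr.eval_arr, Expr.eval_add, Expr.eval_mul, Expr.eval_reg, Expr.eval_one, e7, e8,
        hregt 0 (by simp), hregt 5 (by simp), hregt 23 (by simp), hn, hL, hj, e11, hxt,
        hrow u hu, hrow m hm, rows]
      -- The program expresses the implication of `IsRep` by a sum of two indicators: no level
      -- above, or equality in the row above.
      refine and_congr_left' ?_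
      constructor
      · rintro (h | h) hjl
        · omega
        · exact h
      · intro h
        by_cases hjl : j < L
        · exact .inr (h hjl)
        · exact .inl (by omega)
  rw [Cmd.run_put, Store.setArr_arr, if_pos rfl, h1.2 8 (by simp)]
  congr 1
  · simp [h1.1, hreg, hn, hj, hx]

/-- Rows are filled from the top level down, and writing one row leaves the others alone. There are
`L + 1` rows because level `0` counts, hence the factor `a + 2`. -/
theorem repCmd_run {a n L : ℕ} {s : Store} (hn : s.reg 0 = n) (hL : s.reg 5 = L)
    (hLn : L + 1 ≤ (a + 2) * n) :
    IsRep n L (rows n (s.arr 7)) (rows n (((repCmd a).run s).arr 8)) := by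
  have := Cmd.rep_induct (p := .ite (V 8 <ₑ V 5 + 1) (.set 23 (V 5 - V 8) ;; repRowCmd) .skip)
    (x := 8) (k := a + 2) (s := s) (N := (a + 2) * n)
    (I := fun m s' => ∀ j ≤ L, L - j < m → ∀ v < n, rows n (s'.arr 8) j v = lastSat (fun u =>
      (j < L → rows n (s'.arr 8) (j + 1) u = rows n (s'.arr 8) (j + 1) v) ∧
        rows n (s.arr 7) j u = rows n (s.arr 7) j v) n) (by rw [hn]) (fun _ _ _ h => h)
    (fun j _ hj => by omega) fun m hm s' hs' hx hI => by
      have hreg : ∀ y, y ∉ [8, 11, 12, 23, 27] → s'.reg y = s.reg y := fun y hy => by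
        simp only [List.mem_cons, List.not_mem_nil, or_false, not_or] at hy
        exact hs'.1 y (by simp [repRowCmd, Cmd.search, Cmd.regs, hy])
      have ha7 : s'.arr 7 = s.arr 7 := hs'.2 7 (by simp [repRowCmd, Cmd.search, Cmd.arrs])
      rw [Cmd.run_ite_of (P := m ≤ L)]
      · split_ifs with hmL
        · have hr := repRowCmd_run (s := s'.setReg 23 (L - m)) (n := n) (L := L) (j := L - m)
            (by simp [hreg, hn]) (by simp [hreg, hL]) (by simp)
          simp only [Store.setReg_arr, ha7] at hr
          have hrun : (Cmd.set 23 (V 5 - V 8) ;; repRowCmd).run s' =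
              repRowCmd.run (s'.setReg 23 (L - m)) := by
            simp [hreg, hL, hx]
          rw [hrun]
          have hkeep : ∀ j, j ≠ L - m → ∀ v < n,
              rows n ((repRowCmd.run (s'.setReg 23 (L - m))).arr 8) j v =
                rows n (s'.arr 8) j v := fun j hj v hv =>
            hr.2 _ fun v' hv' => by rw [Ne, cell_inj hv hv']; tauto
          intro j hj hjm v hv
          have hnext : ∀ u < n, rows n ((repRowCmd.run (s'.setReg 23 (L - m))).arr 8) (j + 1) u =
              rows n (s'.arr 8) (j + 1) u := fun u hu => hkeep (j + 1) (by omega) u hu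
          have hcur : rows n ((repRowCmd.run (s'.setReg 23 (L - m))).arr 8) j v =
              lastSat (fun u =>
                (j < L → rows n (s'.arr 8) (j + 1) u = rows n (s'.arr 8) (j + 1) v) ∧
                rows n (s.arr 7) j u = rows n (s.arr 7) j v) n := by
            by_cases hjm' : j = L - m
            · subst hjm'
              exact hr.1 v hv
            · rw [hkeep j hjm' v hv]
              exact hI j hj (by omega) v hv
          rw [hcur]
          exact lastSat_congr fun u hu => by rw [hnext u hu, hnext v hv]
        · intro j hj _ v hv
          exact hI j hj (by omega) v hv
      · rw [Expr.lt_ne_zero]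
        simp [hreg, hL, hx]
  exact fun j hj v hv => this j hj (by omega) v hv

theorem marks_succ (unp : ℕ → ℕ → ℕ) (m v : ℕ) :
    marks unp (m + 1) v = marks unp m v + if unp (m + 1) v ≠ 0 then 1 else 0 := by
  unfold marks
  rw [← Finset.insert_Icc_right_eq_Icc_add_one (by omega), Finset.filter_insert]
  split_ifs with h
  · rw [Finset.card_insert_of_notMem (by simp)]
  · simp

theorem marks_congr {unp unp' : ℕ → ℕ → ℕ} {m v : ℕ}
    (h : ∀ i, 1 ≤ i → i ≤ m → unp i v = unp' i v) : marks unp m v = marks unp' m v := by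
  unfold marks
  rw [Finset.filter_congr fun i hi => by rw [h i (Finset.mem_Icc.1 hi).1 (Finset.mem_Icc.1 hi).2]]

/-- The potential after doubling the masses of a set of small mass. -/
theorem potential_step {n q t c : ℕ} {μ μ' z : ℕ → ℕ}
    (hΦ : q ^ t * ∑ v ∈ Finset.range n, μ v ≤ (q + 1) ^ t * c)
    (hz : q * ∑ v ∈ (Finset.range n).filter (fun v => z v ≠ 0), μ v ≤ ∑ v ∈ Finset.range n, μ v)
    (hμ : ∀ v < n, μ' v = if z v ≠ 0 then μ v + μ v else μ v) :
    q ^ (t + 1) * ∑ v ∈ Finset.range n, μ' v ≤ (q + 1) ^ (t + 1) * c := by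
  have h1 : ∑ v ∈ Finset.range n, μ' v = ∑ v ∈ Finset.range n, μ v +
      ∑ v ∈ (Finset.range n).filter (fun v => z v ≠ 0), μ v := by
    rw [Finset.sum_filter, ← Finset.sum_add_distrib]
    refine Finset.sum_congr rfl fun v hv => ?_
    rw [hμ v (Finset.mem_range.1 hv)]
    split_ifs <;> simp
  rw [h1]
  calc _ = q ^ t * (q * ∑ v ∈ Finset.range n, μ v +
        q * ∑ v ∈ (Finset.range n).filter (fun v => z v ≠ 0), μ v) := by ring
    _ ≤ q ^ t * (q * ∑ v ∈ Finset.range n, μ v + ∑ v ∈ Finset.range n, μ v) := by gcongr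
    _ = (q + 1) * (q ^ t * ∑ v ∈ Finset.range n, μ v) := by ring
    _ ≤ (q + 1) * ((q + 1) ^ t * c) := Nat.mul_le_mul_left _ hΦ
    _ = _ := by ring

/-- The input, the parameters and the distances are in place. -/
structure Ready {n : ℕ} (G : SimpleGraph (Fin n)) (w : Sym2 (Fin n) → ℕ) (h L q : ℕ)
    (D : ℕ → ℕ → ℕ → ℕ) (s : Store) : Prop where
  size : s.reg 0 = n
  bound : s.reg 1 = h
  levels : s.reg 5 = L
  factor : s.reg 6 = q
  weight : s.arr 0 = weightMatrix G w
  dist : distTable n s.arr = D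
  pow : ∀ i, 1 ≤ i → i ≤ L → s.arr 13 i = 2 ^ i

theorem Ready.congr {n : ℕ} {G : SimpleGraph (Fin n)} {w : Sym2 (Fin n) → ℕ} {h L q : ℕ}
    {D : ℕ → ℕ → ℕ → ℕ} {s s' : Store} (hs : Ready G w h L q D s)
    (hr : ∀ x ∈ [0, 1, 5, 6], s'.reg x = s.reg x) (ha : ∀ x ∈ [0, 6, 13], s'.arr x = s.arr x) :
    Ready G w h L q D s' where
  size := (hr 0 (by simp)).trans hs.size
  bound := (hr 1 (by simp)).trans hs.bound
  levels := (hr 5 (by simp)).trans hs.levels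
  factor := (hr 6 (by simp)).trans hs.factor
  weight := (ha 0 (by simp)).trans hs.weight
  dist := by rw [← hs.dist]; funext i u v; simp [distTable, ha 6 (by simp)]
  pow := by rw [ha 13 (by simp)]; exact hs.pow

theorem Ready.of_agreeOff {n : ℕ} {G : SimpleGraph (Fin n)} {w : Sym2 (Fin n) → ℕ} {h L q : ℕ}
    {D : ℕ → ℕ → ℕ → ℕ} {s s' : Store} {X A : List ℕ} (hs : Ready G w h L q D s)
    (hf : s.AgreeOff X A s') (hX : ∀ x ∈ [0, 1, 5, 6], x ∉ X) (hA : ∀ x ∈ [0, 6, 13], x ∉ A) :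
    Ready G w h L q D s' :=
  hs.congr (fun x hx => hf.1 x (hX x hx)) fun x hx => hf.2 x (hA x hx)

/-- `t` counts the partitions formed in earlier hierarchies. The potential bound passes from level
to level by `potential_step`, and `hK` converts it at each level into the bound `K` on growth steps.
The mass of a vertex records its marks as a power of two. -/
theorem hierarchyCmd_run {a n h L q K N t : ℕ} {G : SimpleGraph (Fin n)} {w : Sym2 (Fin n) → ℕ}
    {D : ℕ → ℕ → ℕ → ℕ} {s : Store} (hs : Ready G w h L q D s)
    (hD : ∀ i, 1 ≤ i → i ≤ L → IsDist G (levelLength w h i) (D i)) (hq : 1 ≤ q) (hn : 1 ≤ n)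
    (hLn : L ≤ (a + 1) * n) (hμ : ∀ v < n, 1 ≤ s.arr 9 v) (htN : t + L ≤ N)
    (hK : ∀ t ≤ N, ∀ M, q ^ t * M ≤ (q + 1) ^ t * n → ∀ k, (q + 1) ^ k ≤ q ^ k * M → k ≤ K)
    (hΦ : q ^ t * ∑ v ∈ Finset.range n, s.arr 9 v ≤ (q + 1) ^ t * n) :
    let s' := (hierarchyCmd a).run s
    Ready G w h L q D s' ∧
    IsHierarchy G h L (16 * K + 8) D (rows n (s'.arr 7)) (rows n (s'.arr 11))
      (rows n (s'.arr 8)) ∧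
    (∀ v < n, s'.arr 9 v = s.arr 9 v * 2 ^ marks (rows n (s'.arr 11)) L v) ∧
    (∀ v < n, s'.arr 10 v = 0 ↔ marks (rows n (s'.arr 11)) L v = 0) ∧
    q ^ (t + L) * ∑ v ∈ Finset.range n, s'.arr 9 v ≤ (q + 1) ^ (t + L) * n := by
  intro s'
  let p1 := Cmd.rep 9 1 (.put 10 (V 9) 0)
  let p2 := Cmd.rep 8 (a + 1) (.ite (V 8 <ₑ V 5) regionCmd .skip)
  let p3 := Cmd.rep 9 1 (.put 7 (V 9) (V 9))
  let s1 := p1.run s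
  let s2 := p2.run s1
  let s3 := p3.run s2
  have hf1 : s.AgreeOff [9] [10] s1 := p1.run_agreeOff s
  have hf2 : s1.AgreeOff p2.regs p2.arrs s2 := p2.run_agreeOff s1
  have hf3 : s2.AgreeOff [9] [7] s3 := p3.run_agreeOff s2
  have hf4 : s3.AgreeOff (repCmd a).regs (repCmd a).arrs s' := (repCmd a).run_agreeOff s3
  simp only [p2, regionCmd, centerCmd, growCmd, sumCmd, markCmd, assignCmd, Cmd.regs, Cmd.arrs]
    at hf2
  simp only [repCmd, repRowCmd, Cmd.search, Cmd.regs, Cmd.arrs] at hf4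
  have R1 : Ready G w h L q D s1 := hs.of_agreeOff hf1 (by simp) (by simp)
  have R2 : Ready G w h L q D s2 := R1.of_agreeOff hf2 (by simp) (by simp)
  have R3 : Ready G w h L q D s3 := R2.of_agreeOff hf3 (by simp) (by simp)
  have R4 : Ready G w h L q D s' := R3.of_agreeOff hf4 (by simp) (by simp)
  have c1 := Cmd.rep_fill (p := .put 10 (V 9) 0) (x := 9) (a := 10) (s := s) 0 (fun _ => 0)
    hs.size fun m hm t ht hx _ => by simp [hx]
  have c2 := Cmd.rep_induct (p := .ite (V 8 <ₑ V 5) regionCmd .skip) (x := 8) (k := a + 1)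
    (s := s1) (N := (a + 1) * n) (I := fun m s' =>
      (∀ i, 1 ≤ i → i ≤ min m L → ∀ u v : Fin n,
        rows n (s'.arr 7) i u = rows n (s'.arr 7) i v →
        D i u v ≠ 0 ∧ D i u v ≤ (16 * K + 8) * (2 ^ i * h) + 1) ∧
      (∀ i, 1 ≤ i → i ≤ min m L → ∀ u v : Fin n, rows n (s'.arr 11) i u = 0 → D i u v ≠ 0 →
        D i u v ≤ 4 * (2 ^ i * h) + 1 → rows n (s'.arr 7) i u = rows n (s'.arr 7) i v) ∧
      (∀ v < n, s'.arr 9 v = s.arr 9 v * 2 ^ marks (rows n (s'.arr 11)) (min m L) v) ∧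
      (∀ v < n, s'.arr 10 v = 0 ↔ marks (rows n (s'.arr 11)) (min m L) v = 0) ∧
      q ^ (t + min m L) * ∑ v ∈ Finset.range n, s'.arr 9 v ≤ (q + 1) ^ (t + min m L) * n)
    (by rw [R1.size]) (fun _ _ _ h => h)
    ⟨by omega, by omega, fun v hv => by simp [marks, hf1.2 9], fun v hv => by
      have := c1.1 v hv
      rw [zero_add] at this
      simp [marks, s1, p1, this], by simpa [hf1.2 9] using hΦ⟩
    fun m hm s' hs' hx ⟨hI1, hI2, hI3, hI4, hI5⟩ => by
      have RI : Ready G w h L q D s' := R1.of_agreeOff hs'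
        (by simp [regionCmd, centerCmd, growCmd, sumCmd, markCmd, assignCmd, Cmd.regs])
        (by simp [regionCmd, centerCmd, growCmd, sumCmd, markCmd, assignCmd, Cmd.arrs])
      rw [Cmd.run_ite_of (P := m < L)]
      · split_ifs with hmL
        swap
        · rw [Cmd.run_skip, show min (m + 1) L = min m L by omega]
          exact ⟨hI1, hI2, hI3, hI4, hI5⟩
        rw [show min m L = m by omega] at hI1 hI2 hI3 hI4 hI5
        rw [show min (m + 1) L = m + 1 by omega]
        obtain ⟨g1, g2, g3, g4, g5, g6, g7⟩ := regionCmd_run (s := s') (i := m + 1) (q := q)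
          (G := G) (f := levelLength w h (m + 1)) (K := K) (h := h) RI.size RI.bound (by rw [hx])
          RI.factor hq (RI.pow (m + 1) (by omega) hmL)
          (by rw [RI.dist]; exact hD (m + 1) (by omega) hmL)
          (fun v hv => by rw [hI3 v hv]; exact Nat.mul_pos (hμ v hv) (by positivity))
          (hK (t + m) (by omega) _ hI5)
        rw [RI.dist] at g1 g2
        set s4 := regionCmd.run s' with hs4
        have k7 : ∀ i ≠ m + 1, ∀ v < n, rows n (s4.arr 7) i v = rows n (s'.arr 7) i v :=
          fun i hi v hv => g6 _ fun v' hv' => by rw [Ne, cell_inj hv hv']; tauto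
        have k11 : ∀ i ≠ m + 1, ∀ v < n, rows n (s4.arr 11) i v = rows n (s'.arr 11) i v :=
          fun i hi v hv => g7 _ fun v' hv' => by rw [Ne, cell_inj hv hv']; tauto
        have hmk : ∀ v < n, marks (rows n (s4.arr 11)) (m + 1) v =
            marks (rows n (s'.arr 11)) m v + if s4.arr 11 ((m + 1) * n + v) ≠ 0 then 1 else 0 := by
          intro v hv
          rw [marks_succ, marks_congr fun i _ hi' => k11 i (by omega) v hv]
          rfl
        refine ⟨fun i h1 h2 u v huv => ?_, fun i h1 h2 u v hu huv hle => ?_, fun v hv => ?_,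
          fun v hv => ?_, ?_⟩
        · obtain rfl | hne := eq_or_ne i (m + 1)
          · exact g1 u v huv
          · rw [k7 i hne u u.2, k7 i hne v v.2] at huv
            exact hI1 i h1 (by omega) u v huv
        · obtain rfl | hne := eq_or_ne i (m + 1)
          · exact g2 u v hu huv hle
          · rw [k7 i hne u u.2, k7 i hne v v.2]
            rw [k11 i hne u u.2] at hu
            exact hI2 i h1 (by omega) u v hu huv hle
        · rw [g3 v hv, hmk v hv, hI3 v hv]
          split_ifs <;> ring
        · rw [g4 v hv, hmk v hv]
          split_ifs
          · simp
          · simpa using hI4 v hv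
        · exact potential_step hI5 g5 g3
      · rw [Expr.lt_ne_zero]
        simp [RI.levels, hx]
  rw [show min ((a + 1) * n) L = L by omega] at c2
  obtain ⟨c2a, c2b, c2c, c2d, c2e⟩ := c2
  have c3 := Cmd.rep_fill (p := .put 7 (V 9) (V 9)) (x := 9) (a := 7) (s := s2) 0 (fun m => m)
    R2.size fun m hm t ht hx _ => by simp [hx]
  have k7 : ∀ i, 1 ≤ i → ∀ v < n, rows n (s3.arr 7) i v = rows n (s2.arr 7) i v :=
    fun i hi v hv => c3.2 _ fun v' hv' => by
      have := Nat.le_mul_of_pos_left n hi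
      omega
  have c4 := repCmd_run (a := a) R3.size R3.levels (by nlinarith)
  have e7 : s'.arr 7 = s3.arr 7 := hf4.2 7 (by simp)
  have e11 : s'.arr 11 = s2.arr 11 := (hf4.2 11 (by simp)).trans (hf3.2 11 (by simp))
  have e9 : s'.arr 9 = s2.arr 9 := (hf4.2 9 (by simp)).trans (hf3.2 9 (by simp))
  have e10 : s'.arr 10 = s2.arr 10 := (hf4.2 10 (by simp)).trans (hf3.2 10 (by simp))
  rw [e9, e10, e11]
  refine ⟨R4, ?_, c2c, c2d, c2e⟩
  rw [e7]
  refine IsRep.isHierarchy c4 (fun v hv => ?_) (fun i h1 h2 u v huv => ?_)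
    fun i h1 h2 u v hu huv hle => ?_
  · have := c3.1 v hv
    rw [zero_add] at this
    simpa [rows] using this
  · rw [k7 i h1 u u.2, k7 i h1 v v.2] at huv
    exact c2a i h1 h2 u v huv
  · rw [k7 i h1 u u.2, k7 i h1 v v.2]
    exact c2b i h1 h2 u v hu huv hle

/-! ### Paths -/

/-- One hop from the vertex in register `25` towards the vertex in register `26`, for the distances
at the level in register `23`. -/
def hopCmd : Cmd :=
  .search 27 12 ((0 <ₑ .arr 0 (V 25 * V 0 + V 12)) *
    (.arr 6 ((V 23 * V 0 + V 25) * V 0 + V 26) =ₑ .arr 6 ((V 23 * V 0 + V 12) * V 0 + V 26) +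
      (.arr 0 (V 25 * V 0 + V 12) * V 1 + .arr 13 (V 23)))) ;;
  .set 24 (V 24 + 1) ;; .put 5 (V 24) (V 27) ;; .set 25 (V 27)

/-- All hops from the vertex in register `25` to the vertex in register `26`. -/
def walkCmd : Cmd := .rep 10 1 (.ite (V 25 =ₑ V 26) .skip hopCmd)

/-- The vertices of a path from `x` with steps in `Q` stand in the cells of array `5` from `off` to
the one in register `24`; the cells before `off` are as in `A`. -/
structure Trail (Q : ℕ → ℕ → Prop) (A : ℕ → ℕ) (off x : ℕ) (s : Store) : Prop where
  le : off ≤ s.reg 24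
  start : s.arr 5 off = x
  last : s.arr 5 (s.reg 24) = s.reg 25
  step : ∀ k, off ≤ k → k < s.reg 24 → Q (s.arr 5 k) (s.arr 5 (k + 1))
  old : ∀ k < off, s.arr 5 k = A k

section Walk

variable {n h L q : ℕ} {G : SimpleGraph (Fin n)} {w : Sym2 (Fin n) → ℕ} {D : ℕ → ℕ → ℕ → ℕ}
  {s : Store} {Q : ℕ → ℕ → Prop} {A : ℕ → ℕ} {off x i : ℕ}

theorem Trail.congr {s' : Store} (hT : Trail Q A off x s) (h5 : s'.arr 5 = s.arr 5)
    (h24 : s'.reg 24 = s.reg 24) (h25 : s'.reg 25 = s.reg 25) : Trail Q A off x s' where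
  le := by rw [h24]; exact hT.le
  start := by rw [h5]; exact hT.start
  last := by rw [h5, h24, h25]; exact hT.last
  step := by rw [h5, h24]; exact hT.step
  old := by rw [h5]; exact hT.old

theorem Trail.extend {s' : Store} {y : ℕ} (hT : Trail Q A off x s)
    (h24 : s'.reg 24 = s.reg 24 + 1) (h25 : s'.reg 25 = y) (hQ : Q (s.reg 25) y)
    (h5 : s'.arr 5 = Function.update (s.arr 5) (s.reg 24 + 1) y) : Trail Q A off x s' where
  le := by have := hT.le; omega
  start := by
    have := hT.le
    rw [h5, Function.update_of_ne (by omega)]; exact hT.start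
  last := by rw [h5, h24, h25]; simp
  step k h1 h2 := by
    rw [h5, Function.update_of_ne (by omega)]
    obtain hk | rfl : k < s.reg 24 ∨ k = s.reg 24 := by omega
    · rw [Function.update_of_ne (by omega)]
      exact hT.step k h1 hk
    · rw [Function.update_self, hT.last]
      exact hQ
  old k hk := by
    have := hT.le
    rw [h5, Function.update_of_ne (by omega)]; exact hT.old k hk

theorem hopCmd_run {u v : ℕ} (hs : Ready G w h L q D s) (hi : s.reg 23 = i) (hi1 : 1 ≤ i)
    (hiL : i ≤ L) (hu : s.reg 25 = u) (hv : s.reg 26 = v) (huv : u ≠ v) :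
    let y := hop n (weightMatrix G w) h i (D i) v u
    (hopCmd.run s).reg 24 = s.reg 24 + 1 ∧ (hopCmd.run s).reg 25 = y ∧
      (hopCmd.run s).arr 5 = Function.update (s.arr 5) (s.reg 24 + 1) y := by
  intro y
  obtain ⟨h1, h2⟩ := Cmd.search_run (r := 27) (x := 12)
    (b := (0 <ₑ .arr 0 (V 25 * V 0 + V 12)) *
    (.arr 6 ((V 23 * V 0 + V 25) * V 0 + V 26) =ₑ .arr 6 ((V 23 * V 0 + V 12) * V 0 + V 26) +
      (.arr 0 (V 25 * V 0 + V 12) * V 1 + .arr 13 (V 23)))) (s := s) (n := n) hs.size (by simp)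
    (by simp) (fun y => weightMatrix G w (u * n + y) ≠ 0 ∧ D i u v = D i y v +
      (h * weightMatrix G w (u * n + y) + 2 ^ i)) fun y hy t ht hx => by
      have Rt : Ready G w h L q D t := hs.of_agreeOff ht (by simp) (by simp)
      have e : ∀ u v, t.arr 6 ((i * n + u) * n + v) = D i u v := fun u v => by
        rw [← Rt.dist, distTable]
      simp only [Expr.mul_ne_zero, Expr.lt_ne_zero, Expr.eq_ne_zero, Expr.eval_zero,
        pos_iff_ne_zero]
      simp [Rt.size, Rt.bound, Rt.weight, Rt.pow i hi1 hiL, ht.1 23, ht.1 25, ht.1 26, hi, hu, hv,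
        hx, e, mul_comm h]
  have hy : lastSat (fun y => weightMatrix G w (u * n + y) ≠ 0 ∧ D i u v = D i y v +
      (h * weightMatrix G w (u * n + y) + 2 ^ i)) n = y := by
    simp only [y, hop]
    rw [if_neg huv]
  rw [hy] at h2
  have e24 := h1.1 24 (by simp)
  have e5 := h1.2 5 (by simp)
  simp [hopCmd, h2, e24, e5]

/-- The loop iterates `hop` exactly `n` times and stands still after the arrival; register `24`
advances only for proper hops. -/
theorem walkCmd_run (hs : Ready G w h L q D s) (hD : IsDist G (levelLength w h i) (D i))
    (hw : ∀ e ∈ G.edgeSet, 1 ≤ w e) (hi : s.reg 23 = i) (hi1 : 1 ≤ i) (hiL : i ≤ L) {u v : Fin n}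
    (hu : s.reg 25 = u) (hv : s.reg 26 = v) (huv : D i u v ≠ 0)
    (hQ : ∀ x y, HopStep n (weightMatrix G w) h i (D i) u v x y → Q x y)
    (hT : Trail Q A off x s) :
    let s' := walkCmd.run s
    Trail Q A off x s' ∧ s'.reg 25 = v ∧
      s'.reg 24 = s.reg 24 + hopCount n (weightMatrix G w) h i (D i) u v n := by
  have := Cmd.rep_induct (p := .ite (V 25 =ₑ V 26) .skip hopCmd) (x := 10) (k := 1) (s := s)
    (N := n) (I := fun m s' => Trail Q A off x s' ∧
      s'.reg 25 = (hop n (weightMatrix G w) h i (D i) v)^[m] u ∧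
      s'.reg 24 = s.reg 24 + hopCount n (weightMatrix G w) h i (D i) u v m)
    (by simp [hs.size]) (fun m s' y h => ⟨h.1.congr rfl (by simp) (by simp), by simpa using h.2⟩)
    ⟨hT, by simpa using hu, by simp [hopCount]⟩ fun m hm s' hs' hx ⟨h1, h2, h3⟩ => by
      have RI : Ready G w h L q D s' := hs.of_agreeOff hs'
        (by simp [hopCmd, Cmd.search, Cmd.regs]) (by simp [hopCmd, Cmd.search, Cmd.arrs])
      have e23 : s'.reg 23 = i := (hs'.1 23 (by simp [hopCmd, Cmd.search, Cmd.regs])).trans hi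
      have e26 : s'.reg 26 = v := (hs'.1 26 (by simp [hopCmd, Cmd.search, Cmd.regs])).trans hv
      have hcount : hopCount n (weightMatrix G w) h i (D i) u v (m + 1) =
          hopCount n (weightMatrix G w) h i (D i) u v m +
            if s'.reg 25 ≠ v then 1 else 0 := by
        simp only [hopCount, Finset.card_filter, Finset.sum_range_succ, h2]
      rw [Cmd.run_ite_of (P := s'.reg 25 = v), hcount, Function.iterate_succ_apply', ← h2]
      · split_ifs with hc hc'
        · exact absurd hc hc'
        · exact ⟨h1, by rw [hc, hop, if_pos rfl]; exact hc, h3⟩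
        · obtain ⟨g1, g2, g3⟩ := hopCmd_run RI e23 hi1 hiL rfl e26 hc
          exact ⟨h1.extend g1 g2 (hQ _ _ ⟨m, hm, h2, by
            rw [Function.iterate_succ_apply', ← h2], hc⟩) g3, g2, by omega⟩
      · rw [Expr.eq_ne_zero]; simp [e26]
  rw [hop_iterate_eq hD hw huv] at this
  exact this

end Walk

/-- Walk on unless the representatives at the level in register `30` agree. -/
def legCmd : Cmd :=
  .ite (.arr 8 (V 30 * V 0 + V 28) =ₑ .arr 8 (V 30 * V 0 + V 29)) .skip walkCmd

/-- Walk along the representatives of the vertex in register `28`. -/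
def upCmd : Cmd :=
  .ite (V 31 <ₑ V 5) (.set 30 (V 31) ;; .set 23 (V 31 + 1) ;;
    .set 26 (.arr 8 ((V 31 + 1) * V 0 + V 28)) ;; legCmd) .skip

/-- Walk between representatives at the top level. -/
def acrossCmd : Cmd :=
  .set 30 (V 5) ;; .set 23 (V 5) ;; .set 26 (.arr 8 (V 5 * V 0 + V 29)) ;; legCmd

/-- Walk back along the representatives of the vertex in register `29`. -/
def downCmd : Cmd :=
  .ite (V 31 <ₑ V 5) (.set 30 (V 5 - (V 31 + 1)) ;; .set 23 (V 30 + 1) ;;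
    .set 26 (.arr 8 (V 30 * V 0 + V 29)) ;; legCmd) .skip

/-- The path of the hierarchy for the vertices in registers `28` and `29`. -/
def pathCmd (a : ℕ) : Cmd :=
  .put 4 (V 28 * V 0 + V 29) (V 24) ;; .put 5 (V 24) (V 28) ;; .set 25 (V 28) ;;
  .rep 31 (a + 1) upCmd ;; acrossCmd ;; .rep 31 (a + 1) downCmd ;;
  .put 3 (V 28 * V 0 + V 29) (V 24 - .arr 4 (V 28 * V 0 + V 29)) ;; .set 24 (V 24 + 1)

/-- The paths of the hierarchy for all reachable pairs of unmarked vertices. -/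
def pathsCmd (a : ℕ) : Cmd :=
  .rep 28 1 (.rep 29 1
    (.ite ((.arr 10 (V 28) =ₑ 0) * (.arr 10 (V 29) =ₑ 0) *
      (0 <ₑ .arr 6 ((V 5 * V 0 + V 28) * V 0 + V 29))) (pathCmd a) .skip))

/-- A path from `u` to `v` with steps in `Q` and a length that satisfies `b` is stored before the
cell `p` of array `5`. -/
structure Stored (n : ℕ) (Q : ℕ → ℕ → Prop) (b : ℕ → Prop) (A : ℕ → ℕ → ℕ) (p u v : ℕ) : Prop where
  lt : A 4 (u * n + v) + A 3 (u * n + v) < p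
  start : A 5 (A 4 (u * n + v)) = u
  last : A 5 (A 4 (u * n + v) + A 3 (u * n + v)) = v
  step : ∀ k < A 3 (u * n + v), Q (A 5 (A 4 (u * n + v) + k)) (A 5 (A 4 (u * n + v) + (k + 1)))
  length : b (A 3 (u * n + v))

theorem Stored.congr {n : ℕ} {Q : ℕ → ℕ → Prop} {b : ℕ → Prop} {A A' : ℕ → ℕ → ℕ} {p p' u v : ℕ}
    (h : Stored n Q b A p u v) (hp : p ≤ p') (h3 : A' 3 (u * n + v) = A 3 (u * n + v))
    (h4 : A' 4 (u * n + v) = A 4 (u * n + v)) (h5 : ∀ k < p, A' 5 k = A 5 k) :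
    Stored n Q b A' p' u v := by
  have hlt := h.lt
  refine ⟨?_, ?_, ?_, fun k hk => ?_, ?_⟩
  · rw [h3, h4]; omega
  · rw [h4, h5 _ (by omega)]; exact h.start
  · rw [h3, h4, h5 _ hlt]; exact h.last
  · rw [h3] at hk
    rw [h4, h5 _ (by omega), h5 _ (by omega)]
    exact h.step k hk
  · rw [h3]; exact h.length

/-! ### Routes that ascend and descend a hierarchy. -/

section Path

variable {a n h L q ρ : ℕ} {G : SimpleGraph (Fin n)} {w : Sym2 (Fin n) → ℕ} {D : ℕ → ℕ → ℕ → ℕ}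
  {X unp : ℕ → ℕ → ℕ} {s₀ : Store} {A : ℕ → ℕ} {off : ℕ}

/-- The state while the path from `x` to `y` is formed: its last vertex is the representative of
`z` at level `c`, where `c` is below `m` only if `x` and `y` agree at level `c`. -/
def OnPath (n h L ρ : ℕ) (W : ℕ → ℕ) (D : ℕ → ℕ → ℕ → ℕ) (rep : ℕ → ℕ → ℕ) (A : ℕ → ℕ)
    (off x y z m k : ℕ) (s : Store) : Prop :=
  Trail (RouteStep n W h L D rep x y) A off x s ∧
  (∃ c ≤ m, s.reg 25 = rep c z ∧ (∀ j < c, rep j x ≠ rep j y) ∧ (c = m ∨ rep c x = rep c y)) ∧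
  s.reg 24 ≤ off + k * n ∧ (rep L x = rep L y → s.reg 24 ≤ off + k * (ρ * h))

theorem OnPath.congr {W : ℕ → ℕ} {rep : ℕ → ℕ → ℕ} {x y z m k : ℕ} {s s' : Store}
    (hT : OnPath n h L ρ W D rep A off x y z m k s) (h5 : s'.arr 5 = s.arr 5)
    (h24 : s'.reg 24 = s.reg 24) (h25 : s'.reg 25 = s.reg 25) :
    OnPath n h L ρ W D rep A off x y z m k s' := by
  refine ⟨hT.1.congr h5 h24 h25, ?_⟩
  rw [h24, h25]
  exact hT.2

/-- One leg, common to ascent, crossing and descent. The count `k` is a budget of legs: each has at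
most `n` hops, and at most `ρ * h` if the ends share the top class. The first bound is for the
running time, the second for the guarantee. -/
theorem legCmd_run {rep : ℕ → ℕ → ℕ} {s : Store} {x y : Fin n} {z z' m m' j i k : ℕ}
    (hs : Ready G w h L q D s) (hD : IsDist G (levelLength w h i) (D i))
    (hw : ∀ e ∈ G.edgeSet, 1 ≤ w e) (hrep : ∀ j ≤ L, rows n (s.arr 8) j x = rep j x ∧
      rows n (s.arr 8) j y = rep j y)
    (hx : s.reg 28 = x) (hy : s.reg 29 = y) (hj : s.reg 30 = j) (hjL : j ≤ L) (hi : s.reg 23 = i)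
    (hi1 : 1 ≤ i) (hiL : i ≤ L)
    (hmerge : rep j x = rep j y → OnPath n h L ρ (weightMatrix G w) D rep A off x y z m k s →
      OnPath n h L ρ (weightMatrix G w) D rep A off x y z' m' k s)
    (hwalk : rep j x ≠ rep j y → OnPath n h L ρ (weightMatrix G w) D rep A off x y z m k s →
      ∃ u v : Fin n, s.reg 25 = u ∧ s.reg 26 = v ∧ D i u v ≠ 0 ∧
        (rep L x = rep L y → D i u v ≤ ρ * (2 ^ i * h) + 1) ∧
        (∀ x' y', HopStep n (weightMatrix G w) h i (D i) u v x' y' →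
          RouteStep n (weightMatrix G w) h L D rep x y x' y') ∧
        ∃ c ≤ m', v = rep c z' ∧ (∀ j < c, rep j x ≠ rep j y) ∧ (c = m' ∨ rep c x = rep c y))
    (hT : OnPath n h L ρ (weightMatrix G w) D rep A off x y z m k s) :
    OnPath n h L ρ (weightMatrix G w) D rep A off x y z' m' (k + 1) (legCmd.run s) := by
  rw [legCmd, Cmd.run_ite_of (P := rep j x = rep j y)]
  · split_ifs with hc
    · obtain ⟨g1, g2, g3, g4⟩ := hmerge hc hT
      refine ⟨g1, g2, ?_, fun hm => ?_⟩
      · rw [Cmd.run_skip, add_mul]; omega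
      · have := g4 hm
        rw [Cmd.run_skip, add_mul]; omega
    · obtain ⟨u, v, hu, hv, huv, hle, hQ, c, hc1, hc2, hc3⟩ := hwalk hc hT
      obtain ⟨g1, g2, g3⟩ := walkCmd_run hs hD hw hi hi1 hiL hu hv huv hQ hT.1
      have b1 := hT.2.2.1
      have b2 := hopCount_le n (weightMatrix G w) h i (D i) u v n
      refine ⟨g1, ⟨c, hc1, g2.trans hc2, hc3⟩, ?_, fun hm => ?_⟩
      · rw [add_mul]; omega
      · have b3 := hT.2.2.2 hm
        have b4 := hopCount_le_of_dist hD hw huv (hle hm)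
        rw [add_mul]; omega
  · have h1 := hrep j hjL
    simp only [rows] at h1
    rw [Expr.eq_ne_zero]
    simp [hs.size, hx, hy, hj, h1]

/-- The ascent halts at the first level where the classes of `x` and `y` agree. Their common
representative belongs to `y` as much as to `x`, so the descent to `y` can start there. If the
classes never agree, a crossing joins the two representatives at the top. -/
theorem pathCmd_run {s : Store} (hs : Ready G w h L q D s)
    (hD : ∀ i, 1 ≤ i → i ≤ L → IsDist G (levelLength w h i) (D i))
    (hw : ∀ e ∈ G.edgeSet, 1 ≤ w e) (hL : 1 ≤ L) (hLn : L ≤ (a + 1) * n)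
    (hX : IsHierarchy G h L ρ D X unp (rows n (s.arr 8))) {x y : Fin n}
    (hx : s.reg 28 = x) (hy : s.reg 29 = y) (hxy : G.Reachable x y) :
    let s' := (pathCmd a).run s
    let rep := rows n (s.arr 8)
    Stored n (RouteStep n (weightMatrix G w) h L D rep x y) (fun l => l ≤ (2 * L + 1) * n ∧
      (rep L x = rep L y → l ≤ (2 * L + 1) * (ρ * h))) s'.arr (s'.reg 24) x y ∧
    s.reg 24 ≤ s'.reg 24 ∧
    (∀ k, k ≠ x * n + y → s'.arr 3 k = s.arr 3 k ∧ s'.arr 4 k = s.arr 4 k) ∧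
    ∀ k < s.reg 24, s'.arr 5 k = s.arr 5 k := by
  intro s' rep
  set off := s.reg 24 with hoff
  set P := OnPath n h L ρ (weightMatrix G w) D rep (s.arr 5) off x y with hP
  let s1 := (Cmd.put 4 (V 28 * V 0 + V 29) (V 24) ;; .put 5 (V 24) (V 28) ;; .set 25 (V 28)).run s
  let s2 := (Cmd.rep 31 (a + 1) upCmd).run s1
  let s3 := acrossCmd.run s2
  let s4 := (Cmd.rep 31 (a + 1) downCmd).run s3
  have hf1 : s.AgreeOff [25] [4, 5] s1 := Cmd.run_agreeOff
    (.put 4 (V 28 * V 0 + V 29) (V 24) ;; .put 5 (V 24) (V 28) ;; .set 25 (V 28)) s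
  have hf2 : s1.AgreeOff (Cmd.rep 31 (a + 1) upCmd).regs _ s2 := Cmd.run_agreeOff _ s1
  have hf3 : s2.AgreeOff acrossCmd.regs _ s3 := Cmd.run_agreeOff _ s2
  have hf4 : s3.AgreeOff (Cmd.rep 31 (a + 1) downCmd).regs _ s4 := Cmd.run_agreeOff _ s3
  simp only [upCmd, acrossCmd, downCmd, legCmd, walkCmd, hopCmd, Cmd.search, Cmd.regs, Cmd.arrs]
    at hf2 hf3 hf4
  have R1 : Ready G w h L q D s1 := hs.of_agreeOff hf1 (by simp) (by simp)
  have R2 : Ready G w h L q D s2 := R1.of_agreeOff hf2 (by simp) (by simp)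
  have R3 : Ready G w h L q D s3 := R2.of_agreeOff hf3 (by simp) (by simp)
  have hmono : ∀ i j, i ≤ j → j ≤ L → rep i x = rep i y → rep j x = rep j y :=
    fun i j hij hj he => hX.rep_mono hij hj he
  have T1 : P x 0 0 s1 := by
    have h24 : s1.reg 24 = off := hf1.1 24 (by simp)
    have h25 : s1.reg 25 = x := by simp [s1, hx]
    have h5 : s1.arr 5 = Function.update (s.arr 5) off x := by simp [s1, hx, hoff]
    refine ⟨⟨h24.ge, by rw [h5]; simp, by rw [h5, h24, h25]; simp, fun k h1 h2 => by omega,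
      fun k hk => by rw [h5, Function.update_of_ne (by omega)]⟩,
      ⟨0, le_rfl, h25.trans (hX.rep_zero x).symm, by simp, .inl rfl⟩, by omega, by omega⟩
  have T2 : P x L L s2 := by
    have := Cmd.rep_induct (p := upCmd) (x := 31) (k := a + 1) (s := s1) (N := (a + 1) * n)
      (I := fun m t => P x (min m L) (min m L) t) (by rw [R1.size])
      (fun m t y h => h.congr rfl (by simp) (by simp)) (by simpa using T1)
      fun m hm t ht hm31 hI => by
        simp only [upCmd, legCmd, walkCmd, hopCmd, Cmd.search, Cmd.regs, Cmd.arrs] at ht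
        have Rt : Ready G w h L q D t := R1.of_agreeOff ht (by simp) (by simp)
        have h28 : t.reg 28 = x := (ht.1 28 (by simp)).trans ((hf1.1 28 (by simp)).trans hx)
        have h29 : t.reg 29 = y := (ht.1 29 (by simp)).trans ((hf1.1 29 (by simp)).trans hy)
        have h8 : t.arr 8 = s.arr 8 := (ht.2 8 (by simp)).trans (hf1.2 8 (by simp))
        rw [upCmd, Cmd.run_ite_of (P := m < L)]
        swap
        · rw [Expr.lt_ne_zero]; simp [Rt.levels, hm31]
        split_ifs with hmL
        swap
        · rw [Cmd.run_skip, show min (m + 1) L = min m L by omega]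
          exact hI
        rw [show min m L = m by omega] at hI
        rw [show min (m + 1) L = m + 1 by omega]
        set t1 := (Cmd.set 30 (V 31) ;; .set 23 (V 31 + 1) ;;
          .set 26 (.arr 8 ((V 31 + 1) * V 0 + V 28))).run t with ht1
        have g1 : t.AgreeOff [30, 23, 26] [] t1 := Cmd.run_agreeOff
          (Cmd.set 30 (V 31) ;; .set 23 (V 31 + 1) ;; .set 26 (.arr 8 ((V 31 + 1) * V 0 + V 28))) t
        have g26 : t1.reg 26 = rep (m + 1) x := by
          simp [ht1, hm31, Rt.size, h28, h8, rep, rows]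
        refine legCmd_run (s := t1) (z := x) (m := m) (j := m) (i := m + 1)
          (Rt.of_agreeOff g1 (by simp) (by simp)) (hD (m + 1) (by omega) hmL) hw
          (by rw [g1.2 8 (by simp), h8]; exact fun _ _ => ⟨rfl, rfl⟩)
          ((g1.1 28 (by simp)).trans h28) ((g1.1 29 (by simp)).trans h29) (by simp [ht1, hm31])
          hmL.le (by simp [ht1, hm31]) (by omega) hmL ?_ ?_
          (hI.congr (g1.2 5 (by simp)) (g1.1 24 (by simp)) (g1.1 25 (by simp)))
        · rintro hc ⟨f1, ⟨c, c1, c2, c3, c4⟩, f2⟩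
          refine ⟨f1, ⟨c, by omega, c2, c3, .inr ?_⟩, f2⟩
          rcases c4 with rfl | c4
          · exact hc
          · exact c4
        · rintro hc ⟨f1, ⟨c, c1, c2, c3, c4⟩, f2⟩
          -- By nesting, classes that had agreed at some `c ≤ m` would agree at level `m`.
          have hcm : c = m := c4.resolve_right fun h => hc (hmono c m c1 hmL.le h)
          subst hcm
          have hd := (hX.dist_rep hmL x).1
          exact ⟨⟨rep c x, hX.rep_lt c hmL.le x⟩, ⟨rep (c + 1) x, hX.rep_lt (c + 1) hmL x⟩, c2,
            g26, hd.1, fun _ => hd.2, fun x' y' hst => .inl ⟨c, hmL, hc, .inl hst⟩, c + 1, le_rfl,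
            rfl, fun j hj he => hc (hmono j c (by omega) hmL.le he), .inl rfl⟩
    rwa [show min ((a + 1) * n) L = L by omega] at this
  have h28 : s2.reg 28 = x := (hf2.1 28 (by simp)).trans ((hf1.1 28 (by simp)).trans hx)
  have h29 : s2.reg 29 = y := (hf2.1 29 (by simp)).trans ((hf1.1 29 (by simp)).trans hy)
  have h8 : s2.arr 8 = s.arr 8 := (hf2.2 8 (by simp)).trans (hf1.2 8 (by simp))
  have T3 : P y L (L + 1) s3 := by
    set t1 := (Cmd.set 30 (V 5) ;; .set 23 (V 5) ;; .set 26 (.arr 8 (V 5 * V 0 + V 29))).run s2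
      with ht1
    have g1 : s2.AgreeOff [30, 23, 26] [] t1 := Cmd.run_agreeOff
      (Cmd.set 30 (V 5) ;; .set 23 (V 5) ;; .set 26 (.arr 8 (V 5 * V 0 + V 29))) s2
    have g26 : t1.reg 26 = rep L y := by
      simp [ht1, R2.levels, R2.size, h29, h8, rep, rows]
    refine legCmd_run (s := t1) (z := x) (m := L) (j := L) (i := L)
      (R2.of_agreeOff g1 (by simp) (by simp)) (hD L hL le_rfl) hw
      (by rw [g1.2 8 (by simp), h8]; exact fun _ _ => ⟨rfl, rfl⟩)
      ((g1.1 28 (by simp)).trans h28) ((g1.1 29 (by simp)).trans h29) (by simp [ht1, R2.levels])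
      le_rfl (by simp [ht1, R2.levels]) hL le_rfl ?_ ?_
      (T2.congr (g1.2 5 (by simp)) (g1.1 24 (by simp)) (g1.1 25 (by simp)))
    -- Nothing moves: the current vertex is reinterpreted as the representative of `y`.
    · rintro hc ⟨f1, ⟨c, c1, c2, c3, c4⟩, f2⟩
      have hcm : rep c x = rep c y := by
        rcases c4 with rfl | c4
        · exact hc
        · exact c4
      exact ⟨f1, ⟨c, c1, c2.trans hcm, c3, c4⟩, f2⟩
    · rintro hc ⟨f1, ⟨c, c1, c2, c3, c4⟩, f2⟩
      have hcm : c = L := c4.resolve_right fun h => hc (hmono c L c1 le_rfl h)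
      subst hcm
      -- Representatives lie in the component of their vertices, so the crossing exists; its length
      -- is not bounded.
      have hdiam : ∀ z : Fin n, G.Reachable ⟨rep c z, hX.rep_lt c le_rfl z⟩ z := fun z =>
        (hD c hL le_rfl).reachable.2 (hX.diam c hL le_rfl ⟨rep c z, hX.rep_lt c le_rfl z⟩ z
          (hX.rep_mem c le_rfl z c le_rfl)).1
      exact ⟨⟨rep c x, hX.rep_lt c le_rfl x⟩, ⟨rep c y, hX.rep_lt c le_rfl y⟩, c2,
        g26, (hD c hL le_rfl).reachable.1 ((hdiam x).trans (hxy.trans (hdiam y).symm)),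
        fun he => absurd he hc, fun x' y' hst => .inr ⟨hc, hst⟩, c, le_rfl,
        rfl, fun j hj he => hc (hmono j c (by omega) le_rfl he), .inl rfl⟩
  have h28' : s3.reg 28 = x := (hf3.1 28 (by simp)).trans h28
  have h29' : s3.reg 29 = y := (hf3.1 29 (by simp)).trans h29
  have h8' : s3.arr 8 = s.arr 8 := (hf3.2 8 (by simp)).trans h8
  have T4 : P y 0 (2 * L + 1) s4 := by
    have := Cmd.rep_induct (p := downCmd) (x := 31) (k := a + 1) (s := s3) (N := (a + 1) * n)
      (I := fun m t => P y (L - m) (L + 1 + min m L) t) (by rw [R3.size])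
      (fun m t y h => h.congr rfl (by simp) (by simp)) (by simpa using T3)
      fun m hm t ht hm31 hI => by
        simp only [downCmd, legCmd, walkCmd, hopCmd, Cmd.search, Cmd.regs, Cmd.arrs] at ht
        have Rt : Ready G w h L q D t := R3.of_agreeOff ht (by simp) (by simp)
        have h28 : t.reg 28 = x := (ht.1 28 (by simp)).trans h28'
        have h29 : t.reg 29 = y := (ht.1 29 (by simp)).trans h29'
        have h8 : t.arr 8 = s.arr 8 := (ht.2 8 (by simp)).trans h8'
        rw [downCmd, Cmd.run_ite_of (P := m < L)]
        swap
        · rw [Expr.lt_ne_zero]; simp [Rt.levels, hm31]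
        split_ifs with hmL
        swap
        · rw [Cmd.run_skip, show min (m + 1) L = min m L by omega,
            show L - (m + 1) = L - m by omega]
          exact hI
        obtain ⟨j, rfl⟩ : ∃ j, L = j + 1 + m := ⟨L - 1 - m, by omega⟩
        rw [show j + 1 + m - m = j + 1 by omega, show min m (j + 1 + m) = m by omega] at hI
        rw [show j + 1 + m - (m + 1) = j by omega,
          show j + 1 + m + 1 + min (m + 1) (j + 1 + m) = j + 1 + m + 1 + m + 1 by omega]
        set t1 := (Cmd.set 30 (V 5 - (V 31 + 1)) ;; .set 23 (V 30 + 1) ;;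
          .set 26 (.arr 8 (V 30 * V 0 + V 29))).run t with ht1
        have g1 : t.AgreeOff [30, 23, 26] [] t1 := Cmd.run_agreeOff
          (Cmd.set 30 (V 5 - (V 31 + 1)) ;; .set 23 (V 30 + 1) ;;
            .set 26 (.arr 8 (V 30 * V 0 + V 29))) t
        have e30 : j + 1 + m - (m + 1) = j := by omega
        have g26 : t1.reg 26 = rep j y := by
          simp [ht1, hm31, Rt.levels, Rt.size, h29, h8, rep, rows, e30]
        refine legCmd_run (s := t1) (z := y) (m := j + 1) (j := j) (i := j + 1)
          (Rt.of_agreeOff g1 (by simp) (by simp)) (hD (j + 1) (by omega) (by omega)) hw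
          (by rw [g1.2 8 (by simp), h8]; exact fun _ _ => ⟨rfl, rfl⟩)
          ((g1.1 28 (by simp)).trans h28) ((g1.1 29 (by simp)).trans h29)
          (by simp [ht1, hm31, Rt.levels, e30]) (by omega) (by simp [ht1, hm31, Rt.levels, e30])
          (by omega) (by omega) ?_ ?_
          (hI.congr (g1.2 5 (by simp)) (g1.1 24 (by simp)) (g1.1 25 (by simp)))
        · rintro hc ⟨f1, ⟨c, c1, c2, c3, c4⟩, f2⟩
          -- The classes differ at all levels below `c`, so agreement at level `j` shows that the
          -- descent has not begun.
          have hcj : c ≤ j := by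
            by_contra hlt
            exact c3 j (by omega) hc
          exact ⟨f1, ⟨c, hcj, c2, c3, .inr (c4.resolve_left (by omega))⟩, f2⟩
        · rintro hc ⟨f1, ⟨c, c1, c2, c3, c4⟩, f2⟩
          have hcm : c = j + 1 := by
            rcases c4 with c4 | c4
            · exact c4
            · by_contra hne
              exact hc (hmono c j (by omega) (by omega) c4)
          subst hcm
          have hd := (hX.dist_rep (j := j) (by omega) y).2
          exact ⟨⟨rep (j + 1) y, hX.rep_lt (j + 1) (by omega) y⟩,
            ⟨rep j y, hX.rep_lt j (by omega) y⟩, c2, g26, hd.1, fun _ => hd.2,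
            fun x' y' hst => .inl ⟨j, by omega, hc, .inr hst⟩, j, le_rfl,
            rfl, fun j hj => c3 j (by omega), .inl rfl⟩
    rwa [show min ((a + 1) * n) L = L by omega, show L - (a + 1) * n = 0 by omega,
      show L + 1 + L = 2 * L + 1 by ring] at this
  have R4 : Ready G w h L q D s4 := R3.of_agreeOff hf4 (by simp) (by simp)
  have k28 : s4.reg 28 = x := (hf4.1 28 (by simp)).trans h28'
  have k29 : s4.reg 29 = y := (hf4.1 29 (by simp)).trans h29'
  have k4 : s4.arr 4 = Function.update (s.arr 4) (x * n + y) off := by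
    rw [hf4.2 4 (by simp), hf3.2 4 (by simp), hf2.2 4 (by simp)]
    simp [s1, hx, hy, hs.size, hoff]
  have k3 : s4.arr 3 = s.arr 3 := by
    rw [hf4.2 3 (by simp), hf3.2 3 (by simp), hf2.2 3 (by simp), hf1.2 3 (by simp)]
  have hrun : s' = (Cmd.put 3 (V 28 * V 0 + V 29) (V 24 - .arr 4 (V 28 * V 0 + V 29)) ;;
    .set 24 (V 24 + 1)).run s4 := rfl
  have m4 : s'.arr 4 = Function.update (s.arr 4) (x * n + y) off := by simp [hrun, k4]
  have m3 : s'.arr 3 = Function.update (s.arr 3) (x * n + y) (s4.reg 24 - off) := by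
    simp [hrun, k28, k29, R4.size, k4, k3]
  have m5 : s'.arr 5 = s4.arr 5 := by simp [hrun]
  have m24 : s'.reg 24 = s4.reg 24 + 1 := by simp [hrun]
  obtain ⟨f1, ⟨c, c1, c2, -⟩, f3, f4⟩ := T4
  obtain rfl : c = 0 := by omega
  have hle := f1.le
  refine ⟨⟨?_, ?_, ?_, ?_, ?_⟩, by omega, fun k hk => ?_, fun k hk => ?_⟩
  · rw [m3, m4, m24]; simp; omega
  · rw [m4, m5]; simpa using f1.start
  · rw [m3, m4, m5, Function.update_self, Function.update_self, Nat.add_sub_cancel' hle, f1.last,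
      c2]
    exact hX.rep_zero y
  · intro k hk
    rw [m3, Function.update_self] at hk
    rw [m4, m5, Function.update_self]
    exact f1.step (off + k) (by omega) (by omega)
  · rw [m3, Function.update_self]
    exact ⟨by omega, fun he => by have := f4 he; omega⟩
  · rw [m3, m4, Function.update_of_ne hk, Function.update_of_ne hk]
    exact ⟨rfl, rfl⟩
  · rw [m5]; exact f1.old k hk

/-- The state of the path construction after the pairs in `P`, of which the pairs in `good` get
paths. -/
structure PathsInv (n : ℕ) (Q : ℕ → ℕ → ℕ → ℕ → Prop) (b : ℕ → ℕ → ℕ → Prop)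
    (good P : Fin n → Fin n → Prop) (s₀ s : Store) : Prop where
  le : s₀.reg 24 ≤ s.reg 24
  new : ∀ u v, P u v → good u v → Stored n (Q u v) (b u v) s.arr (s.reg 24) u v
  old : ∀ u v : Fin n, ¬ (P u v ∧ good u v) → s.arr 3 (u * n + v) = s₀.arr 3 (u * n + v) ∧
    s.arr 4 (u * n + v) = s₀.arr 4 (u * n + v)
  below : ∀ k < s₀.reg 24, s.arr 5 k = s₀.arr 5 k

theorem PathsInv.congr {Q : ℕ → ℕ → ℕ → ℕ → Prop} {b : ℕ → ℕ → ℕ → Prop}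
    {good P P' : Fin n → Fin n → Prop} {s₀ s s' : Store} (hI : PathsInv n Q b good P s₀ s)
    (hP : ∀ u v, good u v → (P' u v ↔ P u v)) (ha : s'.arr = s.arr) (h24 : s'.reg 24 = s.reg 24) :
    PathsInv n Q b good P' s₀ s' where
  le := h24 ▸ hI.le
  new u v h1 h2 := by rw [ha, h24]; exact hI.new u v ((hP u v h2).1 h1) h2
  old u v h := by rw [ha]; exact hI.old u v fun h' => h ⟨(hP u v h'.2).2 h'.1, h'.2⟩
  below := by rw [ha]; exact hI.below

/-- Paths are appended to array `5` and so leave earlier ones intact. A pair with a marked end keeps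
the entry of an earlier hierarchy. -/
theorem pathsCmd_run {s : Store} (hs : Ready G w h L q D s)
    (hD : ∀ i, 1 ≤ i → i ≤ L → IsDist G (levelLength w h i) (D i))
    (hw : ∀ e ∈ G.edgeSet, 1 ≤ w e) (hL : 1 ≤ L) (hLn : L ≤ (a + 1) * n)
    (hX : IsHierarchy G h L ρ D X unp (rows n (s.arr 8))) :
    let rep := rows n (s.arr 8)
    PathsInv n (RouteStep n (weightMatrix G w) h L D rep) (fun x y l => l ≤ (2 * L + 1) * n ∧
      (rep L x = rep L y → l ≤ (2 * L + 1) * (ρ * h)))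
      (fun u v => s.arr 10 u = 0 ∧ s.arr 10 v = 0 ∧ G.Reachable u v) (fun _ _ => True) s
      ((pathsCmd a).run s) := by
  intro rep
  set Inv := PathsInv n (RouteStep n (weightMatrix G w) h L D rep) (fun x y l =>
    l ≤ (2 * L + 1) * n ∧ (rep L x = rep L y → l ≤ (2 * L + 1) * (ρ * h)))
    (fun u v => s.arr 10 u = 0 ∧ s.arr 10 v = 0 ∧ G.Reachable u v) with hInv
  have := Cmd.rep_induct (p := .rep 29 1
    (.ite ((.arr 10 (V 28) =ₑ 0) * (.arr 10 (V 29) =ₑ 0) *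
      (0 <ₑ .arr 6 ((V 5 * V 0 + V 28) * V 0 + V 29))) (pathCmd a) .skip)) (x := 28) (k := 1)
    (s := s) (N := n) (I := fun m t => Inv (fun u _ => (u : ℕ) < m) s t) (by simp [hs.size])
    (fun m t y hI => hI.congr (fun _ _ _ => Iff.rfl) rfl (by simp))
    ⟨le_rfl, by simp, fun _ _ _ => ⟨rfl, rfl⟩, fun _ _ => rfl⟩ fun m hm t ht hmt hI => by
      simp only [pathCmd, upCmd, acrossCmd, downCmd, legCmd, walkCmd, hopCmd, Cmd.search, Cmd.regs,
        Cmd.arrs] at ht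
      have Rt : Ready G w h L q D t := hs.of_agreeOff ht (by simp) (by simp)
      have := Cmd.rep_induct (p :=
        (.ite ((.arr 10 (V 28) =ₑ 0) * (.arr 10 (V 29) =ₑ 0) *
          (0 <ₑ .arr 6 ((V 5 * V 0 + V 28) * V 0 + V 29))) (pathCmd a) .skip)) (x := 29) (k := 1)
        (s := t) (N := n) (I := fun m' t =>
          Inv (fun u v => (u : ℕ) < m ∨ (u : ℕ) = m ∧ (v : ℕ) < m') s t) (by simp [Rt.size])
        (fun m t y hI => hI.congr (fun _ _ _ => Iff.rfl) rfl (by simp))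
        (hI.congr (fun _ _ _ => by simp) rfl rfl) fun m' hm' t' ht' hmt' hI' => by
          simp only [pathCmd, upCmd, acrossCmd, downCmd, legCmd, walkCmd, hopCmd, Cmd.search,
            Cmd.regs, Cmd.arrs] at ht'
          have Rt' : Ready G w h L q D t' := Rt.of_agreeOff ht' (by simp) (by simp)
          have e28 : t'.reg 28 = m := (ht'.1 28 (by simp)).trans hmt
          have e10 : t'.arr 10 = s.arr 10 := (ht'.2 10 (by simp)).trans (ht.2 10 (by simp))
          have e8 : t'.arr 8 = s.arr 8 := (ht'.2 8 (by simp)).trans (ht.2 8 (by simp))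
          have e6 : t'.arr 6 ((L * n + m) * n + m') = D L m m' := by rw [← Rt'.dist, distTable]
          set x : Fin n := ⟨m, hm⟩ with hx
          set y : Fin n := ⟨m', hm'⟩ with hy
          have hreach : G.Reachable x y ↔ D L m m' ≠ 0 := (hD L hL le_rfl).reachable
          classical
          rw [Cmd.run_ite_of (P := s.arr 10 x = 0 ∧ s.arr 10 y = 0 ∧ G.Reachable x y)]
          swap
          · simp only [Expr.mul_ne_zero, Expr.lt_ne_zero, Expr.eq_ne_zero, Expr.eval_zero,
              pos_iff_ne_zero, and_assoc]
            rw [hreach]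
            simp [e28, hmt', e10, Rt'.levels, Rt'.size, e6, hx, hy]
          have hne : ∀ u v : Fin n, ¬ (u = x ∧ v = y) →
              (((u : ℕ) < m ∨ (u : ℕ) = m ∧ (v : ℕ) < m' + 1) ↔
                ((u : ℕ) < m ∨ (u : ℕ) = m ∧ (v : ℕ) < m')) := by
            intro u v huv
            by_cases hum : (u : ℕ) = m
            · have : (v : ℕ) ≠ m' := fun hc => huv ⟨Fin.ext hum, Fin.ext hc⟩
              omega
            · omega
          split_ifs with hc
          · have hr := pathCmd_run (a := a) Rt' hD hw hL hLn (by rw [e8]; exact hX) (x := x)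
              (y := y) e28 hmt' hc.2.2
            rw [e8] at hr
            obtain ⟨r1, r2, r3, r4⟩ := hr
            have hcell : ∀ u v : Fin n, ¬ (u = x ∧ v = y) → (u : ℕ) * n + v ≠ x * n + y := by
              intro u v huv
              rw [Ne, cell_inj v.2 y.2, Fin.val_inj, Fin.val_inj]
              exact huv
            refine ⟨hI'.le.trans r2, fun u v h1 h2 => ?_, fun u v h1 => ?_, fun k hk =>
              (r4 k (hk.trans_le hI'.le)).trans (hI'.below k hk)⟩
            · by_cases huv : u = x ∧ v = y
              · obtain ⟨rfl, rfl⟩ := huv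
                exact r1
              · have h3 := r3 _ (hcell u v huv)
                exact (hI'.new u v ((hne u v huv).1 h1) h2).congr r2 h3.1 h3.2 r4
            · have huv : ¬ (u = x ∧ v = y) := by
                rintro ⟨rfl, rfl⟩
                exact h1 ⟨.inr ⟨rfl, Nat.lt_succ_self _⟩, hc⟩
              have h3 := r3 _ (hcell u v huv)
              have h4 := hI'.old u v fun h => h1 ⟨(hne u v huv).2 h.1, h.2⟩
              exact ⟨h3.1.trans h4.1, h3.2.trans h4.2⟩
          · refine hI'.congr (fun u v hg => ?_) rfl rfl
            refine hne u v ?_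
            rintro ⟨rfl, rfl⟩
            exact hc hg
      refine this.congr (fun u v _ => ?_) rfl rfl
      have := v.2
      omega
  exact this.congr (fun u v _ => by simp) rfl rfl

end Path

/-! ### All hierarchies -/

/-- The paths of all hierarchies; the masses are those that the earlier hierarchies leave. -/
def treesCmd (a : ℕ) : Cmd :=
  .rep 9 1 (.put 9 (V 9) 1) ;;
  .rep 17 4 (.ite (V 17 <ₑ V 7) (hierarchyCmd a ;; pathsCmd a) .skip)

/-- The oblivious algorithm. -/
def forestCmd (a : ℕ) : Cmd := paramCmd a ;; distCmd a ;; treesCmd a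

/-- Put `x = 1 + 1 / q`. The hypothesis says `M ≤ x ^ t * n`, and `x ^ t ≤ exp (t / q) ≤ exp (l / 2)
≤ 2 ^ l` as `q = 8 * L` and `t ≤ 4 * l * L`. By Bernoulli `x ^ q ≥ 2`, so `x ^ k ≤ M < 2 ^ (2 * l)`
limits `k` to `2 * l * q`. -/
theorem potential_lt {k l L n q t M : ℕ} (hn : n < 2 ^ l) (hL : 1 ≤ L) (hq : q = L * 8)
    (ht : t ≤ l * 4 * L) (hM : q ^ t * M ≤ (q + 1) ^ t * n) :
    M < 2 ^ (2 * l) ∧ ((q + 1) ^ k ≤ q ^ k * M → k ≤ 2 * l * q) := by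
  have hq0 : (0 : ℝ) < q := by exact_mod_cast (by omega : 0 < q)
  set x : ℝ := 1 + 1 / q with hx
  have hx1 : 1 ≤ x := by rw [hx]; have := one_div_pos.2 hq0; linarith
  have hqx : ((q : ℝ) + 1) = q * x := by rw [hx]; field_simp
  have hxt : x ^ t ≤ 2 ^ l := by
    have h1 : x ≤ Real.exp (1 / q) := by
      have := Real.add_one_le_exp (1 / (q : ℝ))
      rw [hx]; linarith
    have h2 : Real.exp (1 / 2) ≤ 2 := by
      have h3 : Real.exp (1 / 2) ^ 2 ≤ 2 ^ 2 := by
        rw [← Real.exp_nat_mul]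
        norm_num
        exact (Real.exp_one_lt_d9.trans (by norm_num)).le
      exact le_of_sq_le_sq h3 (by norm_num)
    have h4 : (t : ℝ) * (1 / q) ≤ l * (1 / 2) := by
      rw [mul_one_div, div_le_iff₀ hq0, hq]
      have : (t : ℝ) ≤ l * 4 * L := by exact_mod_cast ht
      push_cast
      linarith
    calc x ^ t ≤ Real.exp (1 / q) ^ t := pow_le_pow_left₀ (by linarith) h1 t
      _ = Real.exp (t * (1 / q)) := by rw [← Real.exp_nat_mul]
      _ ≤ Real.exp (l * (1 / 2)) := Real.exp_le_exp.2 h4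
      _ = Real.exp (1 / 2) ^ l := by rw [← Real.exp_nat_mul]
      _ ≤ 2 ^ l := pow_le_pow_left₀ (Real.exp_pos _).le h2 l
  have hM' : (M : ℝ) ≤ x ^ t * n := by
    have : (q : ℝ) ^ t * M ≤ (q + 1) ^ t * n := by exact_mod_cast hM
    rw [hqx, mul_pow, mul_assoc] at this
    exact le_of_mul_le_mul_left this (by positivity)
  have hlt : (M : ℝ) < 2 ^ (2 * l) := by
    have hn' : (n : ℝ) < 2 ^ l := by exact_mod_cast hn
    calc (M : ℝ) ≤ x ^ t * n := hM'
      _ ≤ 2 ^ l * n := by gcongr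
      _ < 2 ^ l * 2 ^ l := by gcongr
      _ = _ := by ring
  refine ⟨by exact_mod_cast hlt, fun hk => ?_⟩
  have hk' : x ^ k ≤ M := by
    have : ((q : ℝ) + 1) ^ k ≤ q ^ k * M := by exact_mod_cast hk
    rw [hqx, mul_pow] at this
    exact le_of_mul_le_mul_left this (by positivity)
  by_contra hlt'
  have h2 : 2 ≤ x ^ q := by
    have := one_add_mul_le_pow (a := 1 / (q : ℝ)) (by have := one_div_pos.2 hq0; linarith) q
    rw [mul_one_div_cancel hq0.ne'] at this
    rw [hx]; linarith
  have : (2 : ℝ) ^ (2 * l) ≤ x ^ k := calc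
    (2 : ℝ) ^ (2 * l) ≤ (x ^ q) ^ (2 * l) := pow_le_pow_left₀ (by norm_num) h2 _
    _ = x ^ (q * (2 * l)) := (pow_mul x q (2 * l)).symm
    _ ≤ x ^ k := pow_le_pow_right₀ hx1 (by rw [mul_comm]; omega)
  linarith

/-- The hierarchies and the paths that the oblivious algorithm has found after `m` rounds. -/
structure Forest {n : ℕ} (G : SimpleGraph (Fin n)) (w : Sym2 (Fin n) → ℕ) (h L ρ m : ℕ)
    (D : ℕ → ℕ → ℕ → ℕ) (X unp rep : ℕ → ℕ → ℕ → ℕ) (s : Store) : Prop where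
  hierarchy : ∀ T < m, IsHierarchy G h L ρ D (X T) (unp T) (rep T)
  mass : ∀ v < n, s.arr 9 v = 2 ^ ∑ T ∈ Finset.range m, marks (unp T) L v
  stored : ∀ u v : Fin n, G.Reachable u v →
    (∃ T < m, marks (unp T) L u = 0 ∧ marks (unp T) L v = 0) →
    ∃ T < m, marks (unp T) L u = 0 ∧ marks (unp T) L v = 0 ∧
      Stored n (RouteStep n (weightMatrix G w) h L D (rep T) u v) (fun l => l ≤ (2 * L + 1) * n ∧
        (rep T L u = rep T L v → l ≤ (2 * L + 1) * (ρ * h))) s.arr (s.reg 24) u v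

section Trees

variable {a n h L q ρ m : ℕ} {G : SimpleGraph (Fin n)} {w : Sym2 (Fin n) → ℕ} {D : ℕ → ℕ → ℕ → ℕ}
  {X unp rep : ℕ → ℕ → ℕ → ℕ}

theorem Forest.congr {s s' : Store} (hF : Forest G w h L ρ m D X unp rep s) (ha : s'.arr = s.arr)
    (h24 : s'.reg 24 = s.reg 24) : Forest G w h L ρ m D X unp rep s' :=
  ⟨hF.hierarchy, by rw [ha]; exact hF.mass, by rw [ha, h24]; exact hF.stored⟩

theorem treesCmd_run {l K : ℕ} {s : Store} (hs : Ready G w h L q D s)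
    (hD : ∀ i, 1 ≤ i → i ≤ L → IsDist G (levelLength w h i) (D i)) (hn : 1 ≤ n)
    (hw : ∀ e ∈ G.edgeSet, 1 ≤ w e) (hL : 1 ≤ L) (hLn : L ≤ (a + 1) * n) (hq : q = L * 8)
    (hl : n < 2 ^ l) (hln : l ≤ n) (h7 : s.reg 7 = l * 4) (hK : K = 2 * l * q) :
    ∃ X unp rep, Forest G w h L (16 * K + 8) (l * 4) D X unp rep ((treesCmd a).run s) ∧
      ∀ v : Fin n, ∑ T ∈ Finset.range (l * 4), marks (unp T) L v < 2 * l := by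
  let p1 := Cmd.rep 9 1 (.put 9 (V 9) 1)
  let s1 := p1.run s
  have hf1 : s.AgreeOff [9] [9] s1 := p1.run_agreeOff s
  have R1 : Ready G w h L q D s1 := hs.of_agreeOff hf1 (by simp) (by simp)
  have c1 := Cmd.rep_fill (p := .put 9 (V 9) 1) (x := 9) (a := 9) (s := s) 0 (fun _ => 1)
    hs.size fun m hm t ht hx _ => by simp [hx]
  have hμ1 : ∀ v < n, s1.arr 9 v = 1 := fun v hv => by simpa using c1.1 v hv
  have := Cmd.rep_induct (p := .ite (V 17 <ₑ V 7) (hierarchyCmd a ;; pathsCmd a) .skip) (x := 17)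
    (k := 4) (s := s1) (N := 4 * n) (I := fun m t => ∃ X unp rep,
      Forest G w h L (16 * K + 8) (min m (l * 4)) D X unp rep t ∧
      q ^ (min m (l * 4) * L) * ∑ v ∈ Finset.range n, t.arr 9 v ≤
        (q + 1) ^ (min m (l * 4) * L) * n)
    (by rw [R1.size]) (fun m t y ⟨X, unp, rep, h1, h2⟩ =>
      ⟨X, unp, rep, h1.congr rfl (by simp), h2⟩)
    ⟨0, 0, 0, ⟨by simp, fun v hv => by simp [hμ1 v hv], by simp⟩, by
      rw [Finset.sum_congr rfl fun v hv => hμ1 v (Finset.mem_range.1 hv)]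
      simp⟩ fun m hm t ht hmt ⟨X, unp, rep, hF, hΦ⟩ => by
      simp only [hierarchyCmd, regionCmd, centerCmd, growCmd, sumCmd, markCmd, assignCmd,
        repCmd, repRowCmd, pathsCmd, pathCmd, upCmd, acrossCmd, downCmd, legCmd, walkCmd, hopCmd,
        Cmd.search, Cmd.regs, Cmd.arrs] at ht
      have Rt : Ready G w h L q D t := R1.of_agreeOff ht (by simp) (by simp)
      have e7 : t.reg 7 = l * 4 := (ht.1 7 (by simp)).trans ((hf1.1 7 (by simp)).trans h7)
      rw [Cmd.run_ite_of (P := m < l * 4)]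
      swap
      · rw [Expr.lt_ne_zero]; simp [e7, hmt]
      split_ifs with hml
      swap
      · rw [Cmd.run_skip, show min (m + 1) (l * 4) = min m (l * 4) by omega]
        exact ⟨X, unp, rep, hF, hΦ⟩
      rw [show min m (l * 4) = m by omega] at hF hΦ
      rw [show min (m + 1) (l * 4) = m + 1 by omega, Cmd.run_seq]
      set t1 := (hierarchyCmd a).run t with ht1
      obtain ⟨g1, g2, g3, g4, g5⟩ := hierarchyCmd_run (a := a) (K := K) (N := l * 4 * L)
        (t := m * L) Rt hD (by omega) hn hLn
        (fun v hv => by rw [hF.mass v hv]; exact Nat.one_le_two_pow)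
        (by rw [← Nat.succ_mul]; exact Nat.mul_le_mul_right _ hml)
        (fun t ht M hM k hk => hK ▸ (potential_lt hl hL hq ht hM).2 hk) hΦ
      rw [← ht1] at g1 g2 g3 g4 g5
      have hp := pathsCmd_run (a := a) g1 hD hw hL hLn g2
      set t2 := (pathsCmd a).run t1 with ht2
      have f1 : t.AgreeOff (hierarchyCmd a).regs (hierarchyCmd a).arrs t1 :=
        (hierarchyCmd a).run_agreeOff t
      have f2 : t1.AgreeOff (pathsCmd a).regs (pathsCmd a).arrs t2 := (pathsCmd a).run_agreeOff t1
      simp only [hierarchyCmd, regionCmd, centerCmd, growCmd, sumCmd, markCmd, assignCmd,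
        repCmd, repRowCmd, Cmd.search, Cmd.regs, Cmd.arrs] at f1
      simp only [pathsCmd, pathCmd, upCmd, acrossCmd, downCmd, legCmd, walkCmd, hopCmd,
        Cmd.search, Cmd.regs, Cmd.arrs] at f2
      have e9 : t2.arr 9 = t1.arr 9 := f2.2 9 (by simp)
      rw [e9]
      -- The memory holds only the latest hierarchy; the earlier ones survive as functions carried
      -- through the induction.
      refine ⟨fun T => if T = m then rows n (t1.arr 7) else X T,
        fun T => if T = m then rows n (t1.arr 11) else unp T,
        fun T => if T = m then rows n (t1.arr 8) else rep T, ⟨fun T hT => ?_, fun v hv => ?_,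
        fun u v huv hex => ?_⟩, ?_⟩
      · by_cases hTm : T = m
        · subst hTm; simpa using g2
        · simpa [hTm] using hF.hierarchy T (by omega)
      · rw [e9, g3 v hv, hF.mass v hv, Finset.sum_range_succ, pow_add]
        congr 2
        · exact Finset.sum_congr rfl fun T hT => by
            rw [if_neg (Finset.mem_range.1 hT).ne]
        · simp
      · by_cases hgood : t1.arr 10 u = 0 ∧ t1.arr 10 v = 0 ∧ G.Reachable u v
        · refine ⟨m, by omega, ?_⟩
          simp only [if_pos]
          exact ⟨(g4 u u.2).1 hgood.1, (g4 v v.2).1 hgood.2.1, hp.new u v trivial hgood⟩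
        · obtain ⟨T, hT, hTu, hTv⟩ := hex
          have hTm : T ≠ m := by
            rintro rfl
            simp only [if_pos] at hTu hTv
            exact hgood ⟨(g4 u u.2).2 hTu, (g4 v v.2).2 hTv, huv⟩
          rw [if_neg hTm] at hTu hTv
          obtain ⟨T', hT', k1, k2, k3⟩ := hF.stored u v huv ⟨T, by omega, hTu, hTv⟩
          refine ⟨T', by omega, ?_⟩
          simp only [if_neg hT'.ne]
          have ho := hp.old u v fun h => hgood h.2
          have e24 : t1.reg 24 = t.reg 24 := f1.1 24 (by simp)
          have hle := hp.le
          refine ⟨k1, k2, k3.congr (by omega) ?_ ?_ fun k hk => ?_⟩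
          · rw [ho.1, f1.2 3 (by simp)]
          · rw [ho.2, f1.2 4 (by simp)]
          · rw [hp.below k (by omega), f1.2 5 (by simp)]
      · rw [add_mul, one_mul]
        exact g5
  obtain ⟨X, unp, rep, hF, hΦ⟩ := this
  rw [show min (4 * n) (l * 4) = l * 4 by omega] at hF hΦ
  refine ⟨X, unp, rep, hF, fun v => ?_⟩
  have h1 := (potential_lt (k := 0) hl hL hq le_rfl hΦ).1
  have h2 := Finset.single_le_sum
    (f := ((Cmd.rep 17 4 (.ite (V 17 <ₑ V 7) (hierarchyCmd a ;; pathsCmd a) .skip)).run s1).arr 9)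
    (fun _ _ => Nat.zero_le _) (Finset.mem_range.2 v.2)
  rw [hF.mass v v.2] at h2
  exact (Nat.pow_lt_pow_iff_right (by norm_num)).1 (h2.trans_lt h1)

/-- Some hierarchy leaves two given vertices unmarked. -/
theorem exists_unmarked {τ : ℕ} {x y : ℕ → ℕ} (h : ∑ T ∈ Finset.range τ, x T +
    ∑ T ∈ Finset.range τ, y T < τ) : ∃ T < τ, x T = 0 ∧ y T = 0 := by
  by_contra! hc
  rw [← Finset.sum_add_distrib] at h
  have : ∑ T ∈ Finset.range τ, 1 ≤ ∑ T ∈ Finset.range τ, (x T + y T) :=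
    Finset.sum_le_sum fun T hT => by
      have := hc T (Finset.mem_range.1 hT)
      omega
  simp at this
  omega

theorem forestCmd_run {s : Store} (hn : 1 ≤ n) (hw : ∀ e ∈ G.edgeSet, 1 ≤ w e)
    (h0 : s.reg 0 = n) (h1 : s.reg 1 = h) (hW : s.arr 0 = weightMatrix G w) (h6 : s.arr 6 = 0) :
    let l := Nat.size n
    let L := l * (a + 1)
    ∃ D X unp rep, Ready G w h L (L * 8) D ((forestCmd a).run s) ∧
      (∀ i, 1 ≤ i → i ≤ L → IsDist G (levelLength w h i) (D i)) ∧
      Forest G w h L (16 * (2 * l * (L * 8)) + 8) (l * 4) D X unp rep ((forestCmd a).run s) ∧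
      (∀ v : Fin n, ∑ T ∈ Finset.range (l * 4), marks (unp T) L v ≤ l * 4) ∧
      ∀ u v : Fin n, ∃ T < l * 4, marks (unp T) L u = 0 ∧ marks (unp T) L v = 0 := by
  intro l L
  have hl1 : 1 ≤ l := Nat.size_pos.2 hn
  have hln : l ≤ n := size_le_self n
  have hL : 1 ≤ L := Nat.mul_pos hl1 (by omega)
  have hLn : L ≤ (a + 1) * n := by rw [mul_comm (a + 1)]; exact Nat.mul_le_mul_right _ hln
  obtain ⟨g1, g2, g3, g4, g5, g6, g7⟩ := paramCmd_run a h0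
  let s1 := (paramCmd a).run s
  let s2 := (distCmd a).run s1
  have hf2 : s1.AgreeOff (distCmd a).regs (distCmd a).arrs s2 := (distCmd a).run_agreeOff s1
  have hf3 : s2.AgreeOff (treesCmd a).regs (treesCmd a).arrs ((forestCmd a).run s) :=
    (treesCmd a).run_agreeOff s2
  simp only [distCmd, levelDistCmd, relaxCmd, Cmd.regs, Cmd.arrs] at hf2
  simp only [treesCmd, hierarchyCmd, regionCmd, centerCmd, growCmd, sumCmd, markCmd, assignCmd,
    repCmd, repRowCmd, pathsCmd, pathCmd, upCmd, acrossCmd, downCmd, legCmd, walkCmd, hopCmd,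
    Cmd.search, Cmd.regs, Cmd.arrs] at hf3
  have hd := distCmd_run a (h := h) hw g2 (g3.trans h1) (by rw [g1, hW]) (by rw [g1, h6])
  have R2 : Ready G w h L (L * 8) (distTable n s2.arr) s2 :=
    ⟨(hf2.1 0 (by simp)).trans g2, (hf2.1 1 (by simp)).trans (g3.trans h1),
      (hf2.1 5 (by simp)).trans g5, (hf2.1 6 (by simp)).trans g6,
      (hf2.2 0 (by simp)).trans (by rw [← hW]; exact congrFun g1 0), rfl,
      fun i hi1 hi2 => (hd i hi1 (hi2.trans hLn)).2⟩
  have hD : ∀ i, 1 ≤ i → i ≤ L → IsDist G (levelLength w h i) (distTable n s2.arr i) :=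
    fun i hi1 hi2 => (hd i hi1 (hi2.trans hLn)).1
  obtain ⟨X, unp, rep, hF, hmarks⟩ := treesCmd_run (a := a) R2 hD hn hw hL hLn rfl
    (Nat.lt_size_self n) hln ((hf2.1 7 (by simp)).trans g7) rfl
  replace hmarks : ∀ v : Fin n, ∑ T ∈ Finset.range (l * 4), marks (unp T) L v < 2 * l := hmarks
  refine ⟨distTable n s2.arr, X, unp, rep, R2.of_agreeOff hf3 (by simp) (by simp), hD, hF,
    fun v => by have := hmarks v; omega, fun u v => ?_⟩
  -- Together the two vertices have fewer than `4 * l` marks, the number of hierarchies.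
  have hu := hmarks u
  have hv := hmarks v
  exact exists_unmarked (by omega)

end Trees

/-! ### The path system -/

section PathSystem

variable {a n h L ρ : ℕ} {G : SimpleGraph (Fin n)} {w : Sym2 (Fin n) → ℕ} {D : ℕ → ℕ → ℕ → ℕ}
  {X unp rep : ℕ → ℕ → ℕ}

theorem RouteStep.adj (hX : IsHierarchy G h L ρ D X unp rep)
    (hD : ∀ i, 1 ≤ i → i ≤ L → IsDist G (levelLength w h i) (D i))
    (hw : ∀ e ∈ G.edgeSet, 1 ≤ w e) (hL : 1 ≤ L) {s t : Fin n} (hst : G.Reachable s t) {x y : ℕ}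
    (hxy : RouteStep n (weightMatrix G w) h L D rep s t x y) :
    ∃ (hx : x < n) (hy : y < n), G.Adj ⟨x, hx⟩ ⟨y, hy⟩ := by
  rcases hxy with ⟨j, hj, -, hxy | hxy⟩ | ⟨-, hxy⟩
  · exact HopStep.adj (hD (j + 1) (by omega) hj) hw (u := ⟨rep j s, hX.rep_lt j hj.le s⟩)
      (t := ⟨rep (j + 1) s, hX.rep_lt (j + 1) hj s⟩) (hX.dist_rep hj s).1.1 hxy
  · exact HopStep.adj (hD (j + 1) (by omega) hj) hw (u := ⟨rep (j + 1) t, hX.rep_lt (j + 1) hj t⟩)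
      (t := ⟨rep j t, hX.rep_lt j hj.le t⟩) (hX.dist_rep hj t).2.1 hxy
  · have hdiam : ∀ z : Fin n, G.Reachable ⟨rep L z, hX.rep_lt L le_rfl z⟩ z := fun z =>
      (hD L hL le_rfl).reachable.2 (hX.diam L hL le_rfl ⟨rep L z, hX.rep_lt L le_rfl z⟩ z
        (hX.rep_mem L le_rfl z L le_rfl)).1
    exact HopStep.adj (hD L hL le_rfl) hw (u := ⟨rep L s, hX.rep_lt L le_rfl s⟩)
      (t := ⟨rep L t, hX.rep_lt L le_rfl t⟩)
      ((hD L hL le_rfl).reachable.1 ((hdiam s).trans (hst.trans (hdiam t).symm))) hxy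

theorem Stored.exists_walk {Q : ℕ → ℕ → Prop} {b : ℕ → Prop} {A : ℕ → ℕ → ℕ} {p : ℕ} {u v : Fin n}
    (hS : Stored n Q b A p u v)
    (hQ : ∀ x y, Q x y → ∃ (hx : x < n) (hy : y < n), G.Adj ⟨x, hx⟩ ⟨y, hy⟩) :
    ∃ q : G.Walk u v, A 3 (u * n + v) = q.length ∧
      (∀ i ≤ q.length, A 5 (A 4 (u * n + v) + i) = q.getVert i) ∧ b q.length ∧
      ∀ e ∈ q.edges, ∃ x y : Fin n, e = s(x, y) ∧ Q x y := by
  set off := A 4 (u * n + v)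
  set m := A 3 (u * n + v)
  have hlt : ∀ k ≤ m, A 5 (off + k) < n := fun k hk => by
    obtain hk | rfl := hk.lt_or_eq
    · obtain ⟨hx, -, -⟩ := hQ _ _ (hS.step k hk)
      exact hx
    · rw [hS.last]; exact v.2
  -- The default `u` is never met up to position `m`, where all stored numbers are vertices.
  let g : ℕ → Fin n := fun k => if hk : A 5 (off + k) < n then ⟨_, hk⟩ else u
  have hg : ∀ k ≤ m, (g k : ℕ) = A 5 (off + k) := fun k hk => by simp [g, hlt k hk]
  have hadj : ∀ k < m, G.Adj (g k) (g (k + 1)) := fun k hk => by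
    obtain ⟨hx, hy, hxy⟩ := hQ _ _ (hS.step k hk)
    have e1 : g k = ⟨_, hx⟩ := Fin.ext (hg k hk.le)
    have e2 : g (k + 1) = ⟨_, hy⟩ := Fin.ext (hg (k + 1) hk)
    rw [e1, e2]
    exact hxy
  obtain ⟨q, hq1, hq2, hq3⟩ := exists_walk_of_seq g m hadj
  have e0 : g 0 = u := Fin.ext ((hg 0 (Nat.zero_le _)).trans hS.start)
  have em : g m = v := Fin.ext ((hg m le_rfl).trans hS.last)
  refine ⟨q.copy e0 em, by simp [hq1], fun i hi => ?_, ?_, fun e he => ?_⟩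
  · rw [SimpleGraph.Walk.length_copy, hq1] at hi
    rw [SimpleGraph.Walk.getVert_copy, hq2 i hi, hg i hi]
  · rw [SimpleGraph.Walk.length_copy, hq1]; exact hS.length
  · rw [SimpleGraph.Walk.edges_copy, hq3] at he
    obtain ⟨k, hk, rfl⟩ := List.mem_map.1 he
    have hk := List.mem_range.1 hk
    refine ⟨_, _, rfl, ?_⟩
    rw [hg k hk.le, hg (k + 1) hk]
    exact hS.step k hk

theorem PathSystem.induced_le (P : PathSystem G) (Δ : Set (Fin n × Fin n)) : P.induced Δ ≤ G := by
  intro x y hxy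
  rw [PathSystem.induced, SimpleGraph.fromEdgeSet_adj] at hxy
  obtain ⟨⟨p, hp, hr, he⟩, -⟩ := hxy
  exact (P p.1 p.2 hr).edges_subset_edgeSet he

theorem PathSystem.exists_walk (P : PathSystem G) {Δ : Set (Fin n × Fin n)} {p : Fin n × Fin n}
    (hp : p ∈ Δ) (hr : G.Reachable p.1 p.2) :
    ∃ q : (P.induced Δ).Walk p.1 p.2, q.length = (P p.1 p.2 hr).length := by
  have he : ∀ e ∈ (P p.1 p.2 hr).edges, e ∈ (P.induced Δ).edgeSet := by
    intro e he
    rw [PathSystem.induced, SimpleGraph.edgeSet_fromEdgeSet]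
    exact ⟨⟨p, hp, hr, he⟩, fun hd =>
      G.not_isDiag_of_mem_edgeSet ((P p.1 p.2 hr).edges_subset_edgeSet he) hd⟩
  exact ⟨(P p.1 p.2 hr).transfer _ he, SimpleGraph.Walk.length_transfer _ _⟩

theorem IsFeasible.exists_walk {H : SimpleGraph (Fin n)} {Δ : Set (Fin n × Fin n)}
    (hH : IsFeasible G h Δ H) {p : Fin n × Fin n} (hp : p ∈ Δ) :
    ∃ q : G.Walk p.1 p.2, q.length ≤ h := by
  have h1 := hH.2 p hp
  obtain ⟨q, hq⟩ := SimpleGraph.exists_walk_of_edist_ne_top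
    (ne_top_of_le_ne_top (ENat.natCast_ne_top h) h1)
  rw [← hq] at h1
  exact ⟨q.mapLe hH.1, by simpa using by exact_mod_cast h1⟩

/-- The algorithm stores a path system that is good for all demand sets. -/
theorem exists_pathSystem {s : Store} (hn : 1 ≤ n) (hh : 1 ≤ h)
    (hw : ∀ e ∈ G.edgeSet, 1 ≤ w e ∧ w e ≤ n ^ a)
    (h0 : s.reg 0 = n) (h1 : s.reg 1 = h) (hW : s.arr 0 = weightMatrix G w) (h6 : s.arr 6 = 0) :
    ∃ P : PathSystem G, HoldsPaths ((forestCmd a).run s) P ∧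
      (∀ u v huv, (P u v huv).length ≤ (2 * a + 3) * n * n) ∧
      ∀ Δ : Set (Fin n × Fin n), ∀ H, IsFeasible G h Δ H →
        cost w (P.induced Δ) ≤ 50688 * (a + 1) ^ 2 * Nat.size n ^ 3 * cost w H ∧
        ∀ p ∈ Δ, (P.induced Δ).Reachable p.1 p.2 ∧
          (P.induced Δ).dist p.1 p.2 ≤ 50688 * (a + 1) ^ 2 * Nat.size n ^ 3 * h := by
  have hw1 : ∀ e ∈ G.edgeSet, 1 ≤ w e := fun e he => (hw e he).1
  obtain ⟨D, X, unp, rep, hR, hD, hF, hmarks, hun⟩ := forestCmd_run (a := a) hn hw1 h0 h1 hW h6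
  set l := Nat.size n
  set L := l * (a + 1) with hLdef
  set ρ := 16 * (2 * l * (L * 8)) + 8 with hρ
  have hl1 : 1 ≤ l := Nat.size_pos.2 hn
  have hln : l ≤ n := size_le_self n
  have hL : 1 ≤ L := Nat.mul_pos hl1 (by omega)
  have hna : n ^ (a + 1) ≤ 2 ^ L := by
    rw [hLdef, pow_mul]
    exact Nat.pow_le_pow_left (Nat.lt_size_self n).le _
  have hex : ∀ u v (huv : G.Reachable u v), ∃ q : G.Walk u v,
      (((forestCmd a).run s).arr 3 (u * n + v) = q.length ∧ ∀ i ≤ q.length,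
        ((forestCmd a).run s).arr 5 (((forestCmd a).run s).arr 4 (u * n + v) + i) =
          q.getVert i) ∧
      ∃ T < l * 4, marks (unp T) L u = 0 ∧ marks (unp T) L v = 0 ∧
        q.length ≤ (2 * L + 1) * n ∧
        (rep T L u = rep T L v → q.length ≤ (2 * L + 1) * (ρ * h)) ∧
        ∀ e ∈ q.edges, ∃ x y : Fin n, e = s(x, y) ∧
          RouteStep n (weightMatrix G w) h L D (rep T) u v x y := by
    intro u v huv
    obtain ⟨T, hT, hu, hv, hS⟩ := hF.stored u v huv (hun u v)
    obtain ⟨q, q1, q2, q3, q4⟩ := hS.exists_walk (G := G) fun x y hxy =>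
      hxy.adj (hF.hierarchy T hT) hD hw1 hL huv
    exact ⟨q, ⟨q1, q2⟩, T, hT, hu, hv, q3.1, q3.2, q4⟩
  choose P₀ hP1 hP2 using hex
  let P : PathSystem G := P₀
  refine ⟨P, hP1, fun u v huv => ?_, fun Δ H hH => ⟨?_, fun p hp => ?_⟩⟩
  · obtain ⟨T, -, -, -, hlen, -⟩ := hP2 u v huv
    refine hlen.trans (Nat.mul_le_mul_right _ ?_)
    calc 2 * L + 1 ≤ 2 * (n * (a + 1)) + n :=
          Nat.add_le_add (Nat.mul_le_mul_left _ (Nat.mul_le_mul_right _ hln)) hn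
      _ = _ := by ring
  · refine (cost_le_of_hierarchies hF.hierarchy hD hL hh hw hna hmarks hH (K := P.induced Δ)
      fun x y hxy => ?_).trans (Nat.mul_le_mul_right _ ?_)
    · rw [PathSystem.induced, SimpleGraph.fromEdgeSet_adj] at hxy
      obtain ⟨⟨p, hp, hr, he⟩, -⟩ := hxy
      obtain ⟨T, hT, hu, hv, -, -, hst⟩ := hP2 p.1 p.2 hr
      obtain ⟨x', y', hxy', hstep⟩ := hst _ he
      refine ⟨T, hT, p, hp, hu, hv, ?_⟩
      rcases Sym2.eq_iff.1 hxy' with ⟨rfl, rfl⟩ | ⟨rfl, rfl⟩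
      · exact .inl hstep
      · exact .inr hstep
    -- The constant is `50688 = 48 * 264 * 4`, from the cost bound, the bound on `ρ` and the number
    -- `4 * l` of hierarchies.
    · have h2 : ρ ≤ 264 * (a + 1) * l ^ 2 := by
        calc ρ = 256 * (a + 1) * l ^ 2 + 8 * 1 := by rw [hρ, hLdef]; ring
          _ ≤ 256 * (a + 1) * l ^ 2 + 8 * ((a + 1) * l ^ 2) := by
            gcongr; exact Nat.mul_pos (by omega) (by positivity)
          _ = _ := by ring
      calc 48 * ρ * (l * 4) ≤ 48 * (264 * (a + 1) * l ^ 2) * (l * 4) := by gcongr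
        _ = 50688 * (a + 1) * l ^ 3 := by ring
        _ ≤ 50688 * (a + 1) ^ 2 * l ^ 3 := by
          gcongr; exact Nat.le_self_pow (by norm_num) _
  · obtain ⟨q, hq⟩ := hH.exists_walk hp
    obtain ⟨T, hT, hu, hv, -, hlen, -⟩ := hP2 p.1 p.2 q.reachable
    have htop := (hF.hierarchy T hT).rep_top_eq hL (hD L hL le_rfl) (fun e he => (hw e he).2) hna
      hu q hq
    obtain ⟨q', hq'⟩ := P.exists_walk hp q.reachable
    refine ⟨q'.reachable, (SimpleGraph.dist_le q').trans (hq'.trans_le ((hlen htop).trans ?_))⟩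
    have h2 : ρ ≤ 264 * (a + 1) * l ^ 2 := by
      calc ρ = 256 * (a + 1) * l ^ 2 + 8 * 1 := by rw [hρ, hLdef]; ring
        _ ≤ 256 * (a + 1) * l ^ 2 + 8 * ((a + 1) * l ^ 2) := by
          gcongr; exact Nat.mul_pos (by omega) (by positivity)
        _ = _ := by ring
    -- The square of `a + 1` is needed here: `L` and `ρ` both contain this factor.
    calc (2 * L + 1) * (ρ * h) ≤ (3 * L) * (264 * (a + 1) * l ^ 2 * h) := by
          gcongr; omega
      _ = 792 * (a + 1) ^ 2 * l ^ 3 * h := by rw [hLdef]; ring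
      _ ≤ 50688 * (a + 1) ^ 2 * l ^ 3 * h := by gcongr; norm_num

end PathSystem

/-! ### Resources -/

theorem forestCmd_safe (a : ℕ) : (forestCmd a).Safe := by
  simp [forestCmd, paramCmd, distCmd, levelDistCmd, relaxCmd, treesCmd, hierarchyCmd, regionCmd,
    centerCmd, growCmd, sumCmd, markCmd, assignCmd, repCmd, repRowCmd, pathsCmd, pathCmd, upCmd,
    acrossCmd, downCmd, legCmd, walkCmd, hopCmd, Cmd.search, Cmd.Safe, Cmd.regs]

/-- `B = n + Nat.size h` bounds register `0` and the length of `h`, and the input numbers have at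
most `(a + 1) * B` bits, so the bound of `Cmd.exec` is a polynomial in `B`. -/
theorem Cmd.haltsWithin (p : Cmd) (hp : p.Safe) (a : ℕ) : ∃ K, ∀ (n h : ℕ) (s : Store),
    1 ≤ n → s.reg 0 = n → s.reg 1 = h → s.Bits ((a + 1) * (n + Nat.size h)) →
    ∀ Q : Store → Prop, Q (p.run s) → HaltsWithin p.toProg s (timeBound K n h) Q := by
  obtain ⟨f, hf, hexec⟩ := p.exec hp
  obtain ⟨K, hK⟩ := hf.mul (((PolyBounded.const (a + 1)).mul .id).add (.const 1))
  refine ⟨K, fun n h s hn h0 h1 hs Q hQ => ?_⟩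
  obtain ⟨t, ht, htf, -⟩ := hexec s _ (n + Nat.size h) hs (by omega) (by rw [h1]; omega) (by omega)
  exact ⟨_, t, ht, htf.trans (hK _ (by omega)), hQ⟩

theorem size_pow_le (n a : ℕ) : Nat.size (n ^ a) ≤ a * n + 1 := by
  rw [Nat.size_le]
  calc n ^ a ≤ (2 ^ n) ^ a := Nat.pow_le_pow_left Nat.lt_two_pow_self.le a
    _ = 2 ^ (a * n) := by rw [← pow_mul, mul_comm]
    _ < 2 ^ (a * n + 1) := Nat.pow_lt_pow_right (by norm_num) (Nat.lt_succ_self _)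

theorem size_mono_bound {x n a : ℕ} (h : ℕ) (hn : 1 ≤ n) (hx : x ≤ n ^ a) :
    Nat.size x ≤ (a + 1) * (n + Nat.size h) := by
  refine (Nat.size_le_size hx).trans ((size_pow_le n a).trans ?_)
  nlinarith [Nat.zero_le (a * Nat.size h)]

theorem size_weightMatrix_le {n a : ℕ} {G : SimpleGraph (Fin n)} {w : Sym2 (Fin n) → ℕ} (h : ℕ)
    (hn : 1 ≤ n) (hw : ∀ e ∈ G.edgeSet, w e ≤ n ^ a) (i : ℕ) :
    Nat.size (weightMatrix G w i) ≤ (a + 1) * (n + Nat.size h) := by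
  refine size_mono_bound h hn ?_
  unfold weightMatrix
  dsimp only
  split_ifs with h1 h2
  · exact hw _ h2
  · exact Nat.zero_le _
  · exact Nat.zero_le _

theorem size_randomBits_le {n m : ℕ} (a h : ℕ) (hn : 1 ≤ n) (r : Fin m → Bool) (i : ℕ) :
    Nat.size (randomBits r i) ≤ (a + 1) * (n + Nat.size h) := by
  refine size_mono_bound h hn (le_trans ?_ (Nat.one_le_pow _ _ hn))
  unfold randomBits
  split_ifs
  · exact Bool.toNat_le _
  · exact Nat.zero_le _

theorem bits_forestInput {n m a h : ℕ} {G : SimpleGraph (Fin n)} {w : Sym2 (Fin n) → ℕ}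
    (hn : 1 ≤ n) (hw : ∀ e ∈ G.edgeSet, w e ≤ n ^ a) (r : Fin m → Bool) :
    (forestInput G w h r).Bits ((a + 1) * (n + Nat.size h)) := by
  have hle : n + Nat.size h ≤ (a + 1) * (n + Nat.size h) := Nat.le_mul_of_pos_left _ (by omega)
  refine ⟨fun x => ?_, fun x i => ?_⟩
  · have := size_le_self n
    simp only [forestInput]
    split_ifs
    · omega
    · omega
    · simp
  · simp only [forestInput]
    split_ifs
    · exact size_weightMatrix_le h hn hw i
    · exact size_randomBits_le a h hn r i
    · simp

theorem bits_spannerInput {n m a h : ℕ} {Gc G : SimpleGraph (Fin n)} {w : Sym2 (Fin n) → ℕ}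
    (hn : 1 ≤ n) (hw : ∀ e ∈ G.edgeSet, w e ≤ n ^ a) (r : Fin m → Bool) :
    (spannerInput Gc G w h r).Bits ((a + 1) * (n + Nat.size h)) := by
  have hle : n + Nat.size h ≤ (a + 1) * (n + Nat.size h) := Nat.le_mul_of_pos_left _ (by omega)
  refine ⟨fun x => ?_, fun x i => ?_⟩
  · have := size_le_self n
    simp only [spannerInput]
    split_ifs
    · omega
    · omega
    · simp
  · simp only [spannerInput]
    split_ifs
    · exact size_weightMatrix_le h hn hw i
    · exact size_randomBits_le a h hn r i
    · exact size_weightMatrix_le h hn (fun _ _ => Nat.one_le_pow _ _ hn) i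
    · simp

/-! ### Constants -/

theorem coinProb_eq_one {m : ℕ} {E : Set (Fin m → Bool)} (hE : ∀ r, r ∈ E) : coinProb E = 1 := by
  rw [Set.eq_univ_of_forall hE]
  simp [coinProb, Set.ncard_univ]

/-- If `Nat.size n = k + 2`, then `log n ≥ (k + 1) * log 2`, and `log 2 > 2 / 3` gives `3 * (k + 1)
* log 2 ≥ k + 2`. -/
theorem size_le_log {n : ℕ} (hn : 2 ≤ n) : (Nat.size n : ℝ) ≤ 3 * Real.log n := by
  obtain ⟨k, hk⟩ : ∃ k, Nat.size n = k + 2 := by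
    have : 1 < Nat.size n := Nat.lt_size.2 (by simpa using hn)
    exact ⟨Nat.size n - 2, by omega⟩
  have h1 : 2 ^ (k + 1) ≤ n := Nat.lt_size.1 (by omega)
  have h2 : ((k : ℝ) + 1) * Real.log 2 ≤ Real.log n := by
    have : Real.log ((2 : ℝ) ^ (k + 1)) ≤ Real.log n :=
      Real.log_le_log (by positivity) (by exact_mod_cast h1)
    rw [Real.log_pow] at this
    exact_mod_cast this
  have h3 := Real.log_two_gt_d9
  rw [hk]
  push_cast
  have : (0 : ℝ) ≤ k := by positivity
  nlinarith

theorem le_log_of_le {n M x y : ℕ} (hn : 2 ≤ n) (h : x ≤ M * Nat.size n ^ 3 * y) :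
    (x : ℝ) ≤ 27 * M * Real.log n ^ 3 * y := by
  have h1 : (x : ℝ) ≤ M * (Nat.size n : ℝ) ^ 3 * y := by exact_mod_cast h
  have h2 : (Nat.size n : ℝ) ^ 3 ≤ (3 * Real.log n) ^ 3 :=
    pow_le_pow_left₀ (by positivity) (size_le_log hn) 3
  calc (x : ℝ) ≤ M * (Nat.size n : ℝ) ^ 3 * y := h1
    _ ≤ M * (3 * Real.log n) ^ 3 * y := by gcongr
    _ = _ := by ring

/-- The guarantee for one demand set. -/
theorem PathSystem.bounds {n M h : ℕ} {G : SimpleGraph (Fin n)} {w : Sym2 (Fin n) → ℕ}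
    (P : PathSystem G) {Δ : Set (Fin n × Fin n)} (hn : 1 ≤ n)
    (hP : ∀ H, IsFeasible G h Δ H → cost w (P.induced Δ) ≤ M * Nat.size n ^ 3 * cost w H ∧
      ∀ p ∈ Δ, (P.induced Δ).Reachable p.1 p.2 ∧
        (P.induced Δ).dist p.1 p.2 ≤ M * Nat.size n ^ 3 * h) (hF : ∃ F, IsFeasible G h Δ F) :
    (cost w (P.induced Δ) : ℝ) ≤ 27 * M * Real.log n ^ 3 * opt G w h Δ ∧
      ∀ p ∈ Δ, (P.induced Δ).Reachable p.1 p.2 ∧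
        ((P.induced Δ).dist p.1 p.2 : ℝ) ≤ 27 * M * h * Real.log n ^ 3 := by
  obtain ⟨F, hF⟩ := hF
  obtain ⟨H, hH, hcost⟩ := Nat.sInf_mem (s := {k | ∃ H, IsFeasible G h Δ H ∧ cost w H = k})
    ⟨_, F, hF, rfl⟩
  obtain ⟨h1, h2⟩ := hP H hH
  rw [hcost] at h1
  -- For `n = 1` the logarithm vanishes and both bounds read zero; they hold because there are no
  -- edges.
  obtain rfl | hn2 : n = 1 ∨ 2 ≤ n := by omega
  · have hbot : P.induced Δ = ⊥ := by
      ext x y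
      simp [Subsingleton.elim x y]
    refine ⟨?_, fun p hp => ⟨(h2 p hp).1, ?_⟩⟩
    · rw [hbot]; simp [cost]
    · rw [Subsingleton.elim p.1 p.2]; simp
  · refine ⟨le_log_of_le hn2 h1, fun p hp => ⟨(h2 p hp).1, ?_⟩⟩
    have := le_log_of_le hn2 (h2 p hp).2
    linarith

theorem forest_algorithm (a c : ℕ) : ∃ (prog : Prog) (K : ℕ) (C : ℝ),
      ∀ (n : ℕ) (G : SimpleGraph (Fin n)) (w : Sym2 (Fin n) → ℕ) (h : ℕ),
        1 ≤ n → 1 ≤ h → (∀ e ∈ G.edgeSet, 1 ≤ w e ∧ w e ≤ n ^ a) →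
        ∃ out : (Fin (timeBound K n h) → Bool) → PathSystem G,
          (∀ r, HaltsWithin prog (forestInput G w h r) (timeBound K n h)
            (fun s => HoldsPaths s (out r))) ∧
          1 - 1 / (n : ℝ) ^ c ≤ coinProb {r | ∀ D : Set (Fin n × Fin n),
            (∃ F, IsFeasible G h D F) →
              (cost w ((out r).induced D) : ℝ) ≤ C * Real.log n ^ 3 * opt G w h D ∧
              ∀ p ∈ D, ((out r).induced D).Reachable p.1 p.2 ∧
                (((out r).induced D).dist p.1 p.2 : ℝ) ≤ C * h * Real.log n ^ 3} := by
  obtain ⟨K, hK⟩ := (forestCmd a).haltsWithin (forestCmd_safe a) a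
  refine ⟨(forestCmd a).toProg, K, 27 * (50688 * (a + 1) ^ 2 : ℕ), fun n G w h hn hh hw => ?_⟩
  have hex : ∀ r : Fin (timeBound K n h) → Bool, _ := fun r =>
    exists_pathSystem (s := forestInput G w h r) (a := a) hn hh hw (by simp [forestInput])
      (by simp [forestInput]) (by simp [forestInput]) (by simp [forestInput])
  choose out hout1 hout2 hout3 using hex
  refine ⟨out, fun r => hK n h _ hn (by simp [forestInput]) (by simp [forestInput])
    (bits_forestInput hn (fun e he => (hw e he).2) r) _ (hout1 r), ?_⟩
  rw [coinProb_eq_one fun r => Set.mem_ofPred.2 fun Δ hF => (out r).bounds hn (hout3 r Δ) hF]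
  have : (0 : ℝ) ≤ 1 / (n : ℝ) ^ c := by positivity
  linarith

/-! ### Spanners -/

/-- The cell of the pair of vertices in registers `28` and `29`. -/
abbrev pairCell : Expr := V 28 * V 0 + V 29

/-- Mark an edge of the current path. -/
def markEdgeCmd : Cmd :=
  .set 30 (V 10 * V 0 + V 11) ;;
  .ite (V 30 <ₑ .arr 3 pairCell)
    (.set 25 (.arr 5 (.arr 4 pairCell + V 30)) ;;
      .set 26 (.arr 5 (.arr 4 pairCell + (V 30 + 1))) ;;
      .put 12 (V 25 * V 0 + V 26) 1 ;; .put 12 (V 26 * V 0 + V 25) 1) .skip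

/-- Mark the edges of the paths of all reachable pairs of the client graph. -/
def markPathsCmd (a : ℕ) : Cmd :=
  .rep 28 1 (.rep 29 1 (.ite ((0 <ₑ .arr 2 pairCell) *
      (0 <ₑ .arr 6 ((V 5 * V 0 + V 28) * V 0 + V 29)))
    (.rep 10 (2 * a + 3) (.rep 11 1 markEdgeCmd)) .skip))

/-- Copy the marks to the output. -/
def outputCmd : Cmd := .rep 28 1 (.rep 29 1 (.put 3 pairCell (.arr 12 pairCell)))

/-- The spanner algorithm. -/
def spannerCmd (a : ℕ) : Cmd := forestCmd a ;; markPathsCmd a ;; outputCmd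

theorem spannerCmd_safe (a : ℕ) : (spannerCmd a).Safe := by
  refine ⟨forestCmd_safe a, ?_⟩
  simp [markPathsCmd, markEdgeCmd, outputCmd, Cmd.Safe, Cmd.regs]

section Spanner

variable {n : ℕ} {Gc G : SimpleGraph (Fin n)}

/-- Marks in array `12` are added, and only at edges of `H`. -/
def MarksMore (H : SimpleGraph (Fin n)) (A B : ℕ → ℕ → ℕ) : Prop :=
  ((∀ x y : Fin n, A 12 (x * n + y) = 0 ∨ A 12 (x * n + y) = 1 ∧ H.Adj x y) →
    ∀ x y : Fin n, B 12 (x * n + y) = 0 ∨ B 12 (x * n + y) = 1 ∧ H.Adj x y) ∧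
  ∀ i, A 12 i = 1 → B 12 i = 1

theorem MarksMore.refl {H : SimpleGraph (Fin n)} (A : ℕ → ℕ → ℕ) : MarksMore H A A :=
  ⟨fun h => h, fun _ h => h⟩

theorem MarksMore.trans {H : SimpleGraph (Fin n)} {A B C : ℕ → ℕ → ℕ} (h : MarksMore H A B)
    (h' : MarksMore H B C) : MarksMore H A C :=
  ⟨fun hA => h'.1 (h.1 hA), fun i hA => h'.2 i (h.2 i hA)⟩

theorem MarksMore.of_update {H : SimpleGraph (Fin n)} {A B : ℕ → ℕ → ℕ} {x y : Fin n}
    (hxy : H.Adj x y) (hB : B 12 = Function.update (A 12) (x * n + y) 1) : MarksMore H A B := by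
  refine ⟨fun hA x' y' => ?_, fun i hi => ?_⟩
  · rw [hB, Function.update_apply]
    split_ifs with hc
    · obtain ⟨h1, h2⟩ := (cell_inj y'.2 y.2).1 hc
      rw [Fin.ext h1, Fin.ext h2]
      exact .inr ⟨rfl, hxy⟩
    · exact hA x' y'
  · rw [hB, Function.update_apply]
    split_ifs
    · rfl
    · exact hi

/-- Both marks for the edge from `x` to `y` are there. -/
def Marked (n : ℕ) (A : ℕ → ℕ → ℕ) (x y : ℕ) : Prop := A 12 (x * n + y) = 1 ∧ A 12 (y * n + x) = 1

theorem markEdgeCmd_run {P : PathSystem G} {H : SimpleGraph (Fin n)} {s : Store} (h0 : s.reg 0 = n)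
    (hP : HoldsPaths s P) {u v : Fin n} (hu : s.reg 28 = u) (hv : s.reg 29 = v)
    (huv : G.Reachable u v) {k : ℕ} (hk : s.reg 10 * n + s.reg 11 = k)
    (hH : ∀ k < (P u v huv).length, H.Adj ((P u v huv).getVert k) ((P u v huv).getVert (k + 1))) :
    MarksMore H s.arr (markEdgeCmd.run s).arr ∧ (k < (P u v huv).length →
      Marked n (markEdgeCmd.run s).arr ((P u v huv).getVert k) ((P u v huv).getVert (k + 1))) := by
  obtain ⟨h3, h5⟩ := hP u v huv
  simp only [markEdgeCmd, Cmd.run_seq, Cmd.run_set]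
  rw [Cmd.run_ite_of (P := k < (P u v huv).length)]
  · split_ifs with hlt
    · have hadj := hH k hlt
      have e1 := h5 k hlt.le
      have e2 := h5 (k + 1) hlt
      set x := (P u v huv).getVert k
      set y := (P u v huv).getVert (k + 1)
      simp only [Cmd.run_seq, Cmd.run_set, Cmd.run_put]
      refine ⟨MarksMore.trans (B := fun a => if a = 12 then
        Function.update (s.arr 12) (x * n + y) 1 else s.arr a)
        (.of_update hadj (by simp)) (.of_update hadj.symm ?_), fun _ => ?_⟩
      · simp [h0, hk, hu, hv, e1, e2]
      · simp [h0, hk, hu, hv, e1, e2, Marked, Function.update_apply]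
    · exact ⟨.refl _, fun h => absurd h hlt⟩
  · rw [Expr.lt_ne_zero]
    simp [h0, hk, hu, hv, h3]

theorem HoldsPaths.congr {P : PathSystem G} {s s' : Store} (hP : HoldsPaths s P)
    (h3 : s'.arr 3 = s.arr 3) (h4 : s'.arr 4 = s.arr 4) (h5 : s'.arr 5 = s.arr 5) :
    HoldsPaths s' P := by
  intro u v huv
  rw [h3, h4, h5]
  exact hP u v huv

/-- The nested loops enumerate the positions `m * n + m'` below `(2 * a + 3) * n * n`, which exceeds
or equals the length of every stored path. -/
theorem markPathCmd_run {a : ℕ} {P : PathSystem G} {H : SimpleGraph (Fin n)} {s : Store}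
    (h0 : s.reg 0 = n) (hP : HoldsPaths s P) {u v : Fin n} (hu : s.reg 28 = u) (hv : s.reg 29 = v)
    (huv : G.Reachable u v) (hlen : (P u v huv).length ≤ (2 * a + 3) * n * n)
    (hH : ∀ k < (P u v huv).length, H.Adj ((P u v huv).getVert k) ((P u v huv).getVert (k + 1))) :
    let B := ((Cmd.rep 10 (2 * a + 3) (.rep 11 1 markEdgeCmd)).run s).arr
    MarksMore H s.arr B ∧ ∀ k < (P u v huv).length,
      Marked n B ((P u v huv).getVert k) ((P u v huv).getVert (k + 1)) := by
  have main := Cmd.rep_mono (p := .rep 11 1 markEdgeCmd) (x := 10) (k := 2 * a + 3) (s := s)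
    (N := (2 * a + 3) * n) (MarksMore H) (fun m B => ∀ m' < n, m * n + m' < (P u v huv).length →
      Marked n B ((P u v huv).getVert (m * n + m')) ((P u v huv).getVert (m * n + m' + 1)))
    (by rw [h0]) .refl (fun _ _ _ => .trans)
    (fun m A B hAB hA m' hm' hlt => (hA m' hm' hlt).imp (hAB.2 _) (hAB.2 _))
    fun m hm t ht hmt hR => by
      simp only [markEdgeCmd, Cmd.regs, Cmd.arrs] at ht
      have := Cmd.rep_mono (p := markEdgeCmd) (x := 11) (k := 1) (s := t)
        (N := n) (MarksMore H) (fun m' B => m * n + m' < (P u v huv).length →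
          Marked n B ((P u v huv).getVert (m * n + m')) ((P u v huv).getVert (m * n + m' + 1)))
        (by simp [ht.1 0, h0]) .refl (fun _ _ _ => .trans)
        (fun m' A B hAB hA hlt => (hA hlt).imp (hAB.2 _) (hAB.2 _)) fun m' hm' t' ht' hmt' hR' => by
          simp only [markEdgeCmd, Cmd.regs, Cmd.arrs] at ht'
          exact markEdgeCmd_run (H := H) (by simp [ht'.1 0, ht.1 0, h0])
            (hP.congr (by simp [ht'.2 3, ht.2 3]) (by simp [ht'.2 4, ht.2 4])
              (by simp [ht'.2 5, ht.2 5])) (by simp [ht'.1 28, ht.1 28, hu])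
            (by simp [ht'.1 29, ht.1 29, hv]) huv (by rw [ht'.1 10 (by simp), hmt, hmt']) hH
      exact this
  refine ⟨main.1, fun k hk => ?_⟩
  have hn : 0 < n := u.pos
  have := main.2 (k / n) (Nat.div_lt_of_lt_mul (by rw [mul_comm]; omega)) (k % n)
    (Nat.mod_lt _ hn) (by rw [Nat.div_add_mod']; exact hk)
  rwa [Nat.div_add_mod'] at this

/-- Marks appear only at edges of the induced graph and are never removed, so both halves are
monotone properties to which `Cmd.rep_mono` applies; array `12` starts empty. -/
theorem markPathsCmd_run {a L : ℕ} {P : PathSystem G} {s : Store}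
    (h0 : s.reg 0 = n) (h5 : s.reg 5 = L) (hP : HoldsPaths s P)
    (hlen : ∀ u v huv, (P u v huv).length ≤ (2 * a + 3) * n * n)
    (h2 : s.arr 2 = weightMatrix Gc fun _ => 1)
    (h6 : ∀ u v : Fin n, G.Reachable u v ↔ distTable n s.arr L u v ≠ 0) (h12 : s.arr 12 = 0) :
    let B := ((markPathsCmd a).run s).arr
    ∀ x y : Fin n, ((P.induced {p | Gc.Adj p.1 p.2}).Adj x y → B 12 (x * n + y) = 1) ∧
      (¬ (P.induced {p | Gc.Adj p.1 p.2}).Adj x y → B 12 (x * n + y) = 0) := by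
  classical
  set H := P.induced {p | Gc.Adj p.1 p.2} with hHdef
  let Q : ℕ → ℕ → (ℕ → ℕ → ℕ) → Prop := fun m m' B => ∀ u v : Fin n, (u : ℕ) = m → (v : ℕ) = m' →
    Gc.Adj u v → ∀ huv, ∀ k < (P u v huv).length,
      Marked n B ((P u v huv).getVert k) ((P u v huv).getVert (k + 1))
  have hQ : ∀ m m' A B, MarksMore H A B → Q m m' A → Q m m' B :=
    fun m m' A B hAB hA u v hu hv huv hr k hk =>
      (hA u v hu hv huv hr k hk).imp (hAB.2 _) (hAB.2 _)
  let p1 := Cmd.ite ((0 <ₑ .arr 2 pairCell) * (0 <ₑ .arr 6 ((V 5 * V 0 + V 28) * V 0 + V 29)))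
    (.rep 10 (2 * a + 3) (.rep 11 1 markEdgeCmd)) .skip
  have main := Cmd.rep_mono (p := .rep 29 1 p1) (x := 28) (k := 1) (s := s) (N := n) (MarksMore H)
    (fun m B => ∀ m' < n, Q m m' B) (by simp [h0]) .refl (fun _ _ _ => .trans)
    (fun m A B hAB hA m' hm' => hQ _ _ _ _ hAB (hA m' hm')) fun m hm t ht hmt hR => by
      simp only [p1, markEdgeCmd, Cmd.regs, Cmd.arrs] at ht
      exact Cmd.rep_mono (p := p1) (x := 29) (k := 1) (s := t) (N := n) (MarksMore H)
        (fun m' B => Q m m' B) (by simp [ht.1 0, h0]) .refl (fun _ _ _ => .trans)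
        (fun m' A B hAB hA => hQ _ _ _ _ hAB hA) fun m' hm' t' ht' hmt' hR' => by
          simp only [p1, markEdgeCmd, Cmd.regs, Cmd.arrs] at ht'
          have e0 : t'.reg 0 = n := by simp [ht'.1 0, ht.1 0, h0]
          have e5 : t'.reg 5 = L := by simp [ht'.1 5, ht.1 5, h5]
          have e28 : t'.reg 28 = m := by simp [ht'.1 28, hmt]
          have e2 : t'.arr 2 = weightMatrix Gc fun _ => 1 := by simp [ht'.2 2, ht.2 2, h2]
          have e6 : t'.arr 6 = s.arr 6 := by simp [ht'.2 6, ht.2 6]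
          have eP : HoldsPaths t' P := hP.congr (by simp [ht'.2 3, ht.2 3])
            (by simp [ht'.2 4, ht.2 4]) (by simp [ht'.2 5, ht.2 5])
          let u : Fin n := ⟨m, hm⟩
          let v : Fin n := ⟨m', hm'⟩
          have eW := weightMatrix_apply Gc (fun _ => 1) u v
          simp only [u, v] at eW
          simp only [p1]
          rw [Cmd.run_ite_of (P := Gc.Adj u v ∧ G.Reachable u v)]
          · split_ifs with hc
            · have := markPathCmd_run (a := a) (H := H) e0 eP (u := u) (v := v) e28 hmt' hc.2
                (hlen u v hc.2) fun k hk => by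
                  have hadj := (P u v hc.2).adj_getVert_succ hk
                  rw [hHdef, PathSystem.induced, SimpleGraph.fromEdgeSet_adj]
                  exact ⟨⟨(u, v), hc.1, hc.2,
                    (SimpleGraph.Walk.mk_mem_edges_iff_exists _).2 ⟨k, hk, rfl⟩⟩, hadj.ne⟩
              refine ⟨this.1, fun u' v' hu' hv' _ huv' k hk => ?_⟩
              obtain rfl : u' = u := Fin.ext hu'
              obtain rfl : v' = v := Fin.ext hv'
              exact this.2 k hk
            · refine ⟨.refl _, fun u' v' hu' hv' hadj huv' => ?_⟩
              obtain rfl : u' = u := Fin.ext hu'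
              obtain rfl : v' = v := Fin.ext hv'
              exact absurd ⟨hadj, huv'⟩ hc
          · rw [h6]
            simp only [Expr.mul_ne_zero, Expr.lt_ne_zero, Expr.eval_zero, pos_iff_ne_zero]
            simp [e0, e5, e28, hmt', e2, e6, eW, distTable, u, v]
  have hfin : ∀ x y : Fin n, H.Adj x y → ((markPathsCmd a).run s).arr 12 (x * n + y) = 1 := by
    intro x y hxy
    rw [hHdef, PathSystem.induced, SimpleGraph.fromEdgeSet_adj] at hxy
    obtain ⟨⟨⟨u, v⟩, hp, hr, he⟩, -⟩ := hxy
    obtain ⟨k, hk, hxy⟩ := (SimpleGraph.Walk.mk_mem_edges_iff_exists _).1 he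
    have := main.2 u u.2 v v.2 u v rfl rfl hp hr k hk
    rcases Sym2.eq_iff.1 hxy with ⟨rfl, rfl⟩ | ⟨rfl, rfl⟩
    · exact this.1
    · exact this.2
  intro B x y
  refine ⟨hfin x y, fun hxy => ?_⟩
  have := main.1.1 (fun x y => .inl (by rw [h12]; rfl)) x y
  exact this.resolve_right fun h => hxy h.2

theorem outputCmd_run {H : SimpleGraph (Fin n)} {s : Store} (h0 : s.reg 0 = n)
    (hH : ∀ x y : Fin n, (H.Adj x y → s.arr 12 (x * n + y) = 1) ∧
      (¬ H.Adj x y → s.arr 12 (x * n + y) = 0)) : HoldsGraph (outputCmd.run s) H := by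
  have main := Cmd.rep_induct (p := .rep 29 1 (.put 3 pairCell (.arr 12 pairCell))) (x := 28)
    (k := 1) (s := s) (N := n) (I := fun m t => ∀ x < m, ∀ y < n,
      t.arr 3 (x * n + y) = s.arr 12 (x * n + y)) (by simp [h0]) (fun _ _ _ h => h) (by simp)
    fun m hm t ht hmt hI => by
      simp only [Cmd.regs, Cmd.arrs] at ht
      have hf := Cmd.rep_fill (p := .put 3 pairCell (.arr 12 pairCell)) (x := 29) (a := 3) (s := t)
        (m * n) (fun y => s.arr 12 (m * n + y)) (n := n) (by simp [ht.1 0, h0])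
        fun m' hm' t' ht' hmt' _ => by
          simp only [Cmd.regs, Cmd.arrs] at ht'
          simp [ht'.1 28, hmt, ht'.1 0, ht.1 0, h0, hmt', ht'.2 12, ht.2 12]
      intro x hx y hy
      obtain hlt | rfl : x < m ∨ x = m := by omega
      · rw [hf.2 _ fun y' hy' => by rw [Ne, cell_inj hy hy']; omega]
        exact hI x hlt y hy
      · exact hf.1 y hy
  intro x y
  rw [show (outputCmd.run s).arr 3 (x * n + y) = s.arr 12 (x * n + y) from main x x.2 y y.2]
  exact hH x y

theorem exists_spanner {a h : ℕ} {w : Sym2 (Fin n) → ℕ} {s : Store} (hn : 1 ≤ n) (hh : 1 ≤ h)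
    (hw : ∀ e ∈ G.edgeSet, 1 ≤ w e ∧ w e ≤ n ^ a) (h0 : s.reg 0 = n) (h1 : s.reg 1 = h)
    (hW : s.arr 0 = weightMatrix G w) (h2 : s.arr 2 = weightMatrix Gc fun _ => 1)
    (h6 : s.arr 6 = 0) (h12 : s.arr 12 = 0) :
    ∃ P : PathSystem G, HoldsGraph ((spannerCmd a).run s) (P.induced {p | Gc.Adj p.1 p.2}) ∧
      ∀ Δ : Set (Fin n × Fin n), ∀ H, IsFeasible G h Δ H →
        cost w (P.induced Δ) ≤ 50688 * (a + 1) ^ 2 * Nat.size n ^ 3 * cost w H ∧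
        ∀ p ∈ Δ, (P.induced Δ).Reachable p.1 p.2 ∧
          (P.induced Δ).dist p.1 p.2 ≤ 50688 * (a + 1) ^ 2 * Nat.size n ^ 3 * h := by
  obtain ⟨P, hP, hlen, hbound⟩ := exists_pathSystem hn hh hw h0 h1 hW h6
  refine ⟨P, ?_, hbound⟩
  obtain ⟨D, -, -, -, hR, hD, -, -, -⟩ :=
    forestCmd_run (a := a) hn (fun e he => (hw e he).1) h0 h1 hW h6
  have hf := (forestCmd a).run_agreeOff s
  have hf' := (markPathsCmd a).run_agreeOff ((forestCmd a).run s)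
  simp only [forestCmd, paramCmd, distCmd, levelDistCmd, relaxCmd, treesCmd, hierarchyCmd,
    regionCmd, centerCmd, growCmd, sumCmd, markCmd, assignCmd, repCmd, repRowCmd, pathsCmd, pathCmd,
    upCmd, acrossCmd, downCmd, legCmd, walkCmd, hopCmd, Cmd.search, Cmd.arrs] at hf
  simp only [markPathsCmd, markEdgeCmd, Cmd.regs, Cmd.arrs] at hf'
  have hL : 1 ≤ Nat.size n * (a + 1) := Nat.mul_pos (Nat.size_pos.2 hn) (by omega)
  refine outputCmd_run ((hf'.1 0 (by simp)).trans hR.size) ?_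
  exact markPathsCmd_run hR.size hR.levels hP hlen ((hf.2 2 (by simp)).trans h2)
    (fun u v => by rw [hR.dist]; exact (hD _ hL le_rfl).reachable) ((hf.2 12 (by simp)).trans h12)

/-- Client-server spanners are Steiner forests whose demands are the client edges, which reduces the
corollary to the oblivious theorem. -/
theorem isHopSpanner_iff {h : ℕ} {H : SimpleGraph (Fin n)} :
    IsHopSpanner Gc G h H ↔ IsFeasible G h {p | Gc.Adj p.1 p.2} H :=
  and_congr_right fun _ => ⟨fun hH p hp => hH p.1 p.2 hp, fun hH u v huv => hH (u, v) huv⟩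

theorem spannerOpt_eq {h : ℕ} {w : Sym2 (Fin n) → ℕ} :
    spannerOpt Gc G w h = opt G w h {p | Gc.Adj p.1 p.2} := by
  simp only [spannerOpt, opt, isHopSpanner_iff]

end Spanner

theorem spanner_algorithm (a c : ℕ) : ∃ (prog : Prog) (K : ℕ) (C : ℝ),
      ∀ (n : ℕ) (Gc Gs : SimpleGraph (Fin n)) (w : Sym2 (Fin n) → ℕ) (h : ℕ),
        1 ≤ n → 1 ≤ h → (∀ e ∈ Gs.edgeSet, 1 ≤ w e ∧ w e ≤ n ^ a) →
        ∃ out : (Fin (timeBound K n h) → Bool) → SimpleGraph (Fin n),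
          (∀ r, out r ≤ Gs ∧ HaltsWithin prog (spannerInput Gc Gs w h r) (timeBound K n h)
            (fun s => HoldsGraph s (out r))) ∧
          1 - 1 / (n : ℝ) ^ c ≤ coinProb {r | (∃ F, IsHopSpanner Gc Gs h F) →
            (cost w (out r) : ℝ) ≤ C * Real.log n ^ 3 * spannerOpt Gc Gs w h ∧
            ∀ u v, Gc.Adj u v → (out r).Reachable u v ∧
              ((out r).dist u v : ℝ) ≤ C * h * Real.log n ^ 3} := by
  obtain ⟨K, hK⟩ := (spannerCmd a).haltsWithin (spannerCmd_safe a) a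
  refine ⟨(spannerCmd a).toProg, K, 27 * (50688 * (a + 1) ^ 2 : ℕ),
    fun n Gc G w h hn hh hw => ?_⟩
  have hex : ∀ r : Fin (timeBound K n h) → Bool, _ := fun r =>
    exists_spanner (Gc := Gc) (s := spannerInput Gc G w h r) (a := a) hn hh hw
      (by simp [spannerInput]) (by simp [spannerInput]) (by simp [spannerInput])
      (by simp [spannerInput]) (by simp [spannerInput]) (by simp [spannerInput])
  choose P hP1 hP2 using hex
  refine ⟨fun r => (P r).induced {p | Gc.Adj p.1 p.2}, fun r => ⟨(P r).induced_le _,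
    hK n h _ hn (by simp [spannerInput]) (by simp [spannerInput])
      (bits_spannerInput hn (fun e he => (hw e he).2) r) _ (hP1 r)⟩, ?_⟩
  rw [coinProb_eq_one fun r => Set.mem_ofPred.2 fun hF => ?_]
  · have : (0 : ℝ) ≤ 1 / (n : ℝ) ^ c := by positivity
    linarith
  · obtain ⟨h1, h2⟩ := (P r).bounds (h := h) (w := w) hn (hP2 r {p | Gc.Adj p.1 p.2})
      (hF.imp fun F => isHopSpanner_iff.1)
    rw [spannerOpt_eq]
    exact ⟨h1, fun u v huv => h2 (u, v) huv⟩

end HopSF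

theorem mainTheorem8 :
    -- oblivious hop-constrained Steiner forest
    (∀ a c : ℕ, ∃ (prog : Prog) (K : ℕ) (C : ℝ),
      ∀ (n : ℕ) (G : SimpleGraph (Fin n)) (w : Sym2 (Fin n) → ℕ) (h : ℕ),
        1 ≤ n → 1 ≤ h → (∀ e ∈ G.edgeSet, 1 ≤ w e ∧ w e ≤ n ^ a) →
        ∃ out : (Fin (timeBound K n h) → Bool) → PathSystem G,
          (∀ r, HaltsWithin prog (forestInput G w h r) (timeBound K n h)
            (fun s => HoldsPaths s (out r))) ∧
          1 - 1 / (n : ℝ) ^ c ≤ coinProb {r | ∀ D : Set (Fin n × Fin n),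
            (∃ F, IsFeasible G h D F) →
              (cost w ((out r).induced D) : ℝ) ≤ C * Real.log n ^ 3 * opt G w h D ∧
              ∀ p ∈ D, ((out r).induced D).Reachable p.1 p.2 ∧
                (((out r).induced D).dist p.1 p.2 : ℝ) ≤ C * h * Real.log n ^ 3}) ∧
    -- minimum cost client-server spanner
    (∀ a c : ℕ, ∃ (prog : Prog) (K : ℕ) (C : ℝ),
      ∀ (n : ℕ) (Gc Gs : SimpleGraph (Fin n)) (w : Sym2 (Fin n) → ℕ) (h : ℕ),
        1 ≤ n → 1 ≤ h → (∀ e ∈ Gs.edgeSet, 1 ≤ w e ∧ w e ≤ n ^ a) →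
        ∃ out : (Fin (timeBound K n h) → Bool) → SimpleGraph (Fin n),
          (∀ r, out r ≤ Gs ∧ HaltsWithin prog (spannerInput Gc Gs w h r) (timeBound K n h)
            (fun s => HoldsGraph s (out r))) ∧
          1 - 1 / (n : ℝ) ^ c ≤ coinProb {r | (∃ F, IsHopSpanner Gc Gs h F) →
            (cost w (out r) : ℝ) ≤ C * Real.log n ^ 3 * spannerOpt Gc Gs w h ∧
            ∀ u v, Gc.Adj u v → (out r).Reachable u v ∧
              ((out r).dist u v : ℝ) ≤ C * h * Real.log n ^ 3}) :=
  ⟨forest_algorithm, spanner_algorithm⟩
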